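/- \textbf{Notation.} A framed toric variety $(X,D)$ is a complete complex toric variety $X=X(\Sigma)$ (dimension $n$, fan in $N_{\mathbb R}$, $N\cong\mathbb Z^n$, dual lattice $M$) with a torus invariant divisor $D=D_{\mathbf a}=\sum_\rho a_\rho D_\rho$, all $a_\rho\ge 1$. Write $\mathbf v_\rho$ for the primitive generator of the ray $\rho$ and $V$ for the matrix with columns $\mathbf v_\rho$. Put $\Delta_{\mathbf a}=\{\mathbf m\in M_{\mathbb R}: \langle \mathbf m,\mathbf v_\rho\rangle\ge -a_\rho\ \forall\rho\}$, $[\Delta]=\mathrm{conv}(\Delta\cap M)$, and $\Delta(X,\mathbf a)=[k_0\Delta_{\mathbf a}]$, where $k_0$ is the least positive integer $k$ with $\mathbf 0\in \mathrm{Int}[k\Delta_{\mathbf a}]$. The $f$-dual of $(X,\mathbf a)$ is $(\mathbb X_{\mathbf a},D'_{\mathbf b})$, where $\mathbb X_{\mathbf a}$ is the toric variety of the fan $\Sigma_{\mathbf a}$ of cones over the faces of $\Delta(X,\mathbf a)$ and, for each primitive generator $\boldsymbol\lambda$ of a ray of $\Sigma_{\mathbf a}$, $b_{\boldsymbol\lambda}$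 is the least positive integer with $\langle\mathbf v_\rho,\boldsymbol\lambda\rangle+b_{\boldsymbol\lambda}\ge0$ for all $\rho$. The $f$-process of $(X,\mathbf a)$ is $(X,\mathbf a)\rightsquigarrow(\mathbb X_{\mathbf a},\mathbf b)\rightsquigarrow(\mathbb X_{\mathbf b},\mathbf c)$, each step being the $f$-dual. It is calibrated if there are complete simplicial fans $\Xi$, $\Xi'$ refining the fans of $X$ and of $\mathbb X_{\mathbf b}$ and having the same rays as these, respectively, and an isomorphism of toric varieties $f:Y(\Xi)\to Y'(\Xi')$ such that, for the induced small resolutions $\varphi:Y\to X$ and $\varphi':Y'\to\mathbb X_{\mathbf b}$, $\varphi^*D_{\mathbf a}=(\varphi'\circ f)^*D''_{\mathbf c}$. \textbf{Theorem.} Let $n\ge1$ and let $D_{\mathbf a}=\sum_{i=1}^{n+1}a_iD_i$ be a strictly effective torus invariant divisor on $\mathbb P^n$, whose fan has rays $\mathbf v_i=\mathbf e_i$ ($i\le n$), $\mathbf v_{n+1}=-\mathbf 1$. Then $(\mathbb P^n,D_{\mathbf a})$ is a framed toric variety. Put $d_i=\gcd(a_j: j\ne i)$ and assume $a_1\le\dots\le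 a_{n+1}$ and $\gcd(a_1,\dots,a_{n+1})=1$. Let $$\nabla'=\mathrm{conv}\Big(\mathbf 0,\mathbf e_1,\tfrac{a_n}{a_{n-1}}\mathbf e_2,\dots,\tfrac{a_n}{a_1}\mathbf e_n\Big)\subset N_{\mathbb R}=\mathbb R^n .$$ Then the $f$-process of $(\mathbb P^n,D_{\mathbf a})$ is calibrated if and only if (a) $\mathrm{conv}(\nabla'\cap N)=\mathrm{conv}\big(\{\mathbf 0\}\cup\{\lfloor a_n/a_{n-i+1}\rfloor\,\mathbf e_i : 1\le i\le n\}\big)$, and (b) there are $i\ne j$ in $\{1,\dots,n+1\}$ with $d_i=d_j=1$. In this case, the $f$-dual framed toric variety $(\mathbb X_{\mathbf a},D'_{\mathbf b})$ is as follows. The fan of $\mathbb X_{\mathbf a}$ has exactly $n+1$ rays, with primitive generators $\boldsymbol\lambda_1,\dots,\boldsymbol\lambda_{n+1}$ determined by $d_i\langle\mathbf v_j,\boldsymbol\lambda_i\rangle=-a_j$ for $j\ne i$; let $\Lambda_{\mathbf a}$ be the matrix with these columns and $D'_i$ the corresponding prime divisors. Then $D'_{\mathbf b}=\sum_i b_iD'_i$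 with $b_i=a_{n+1}/d_i$ for $i\le n$ and $b_{n+1}=a_n/d_{n+1}$. Let $\mathbf q$, $q_i=a_i/\mathrm{lcm}(d_j:j\ne i)$, be the reduced weight vector of $\mathbf a$. Then $\mathbb X_{\mathbf a}\cong\mathbb P(\mathbf q)/G_{\mathbf a}$ as toric varieties, the image of $\{x_j=0\}$ corresponding to $D'_j$, where $G_{\mathbf a}=\bigoplus_{k=1}^s\mathbb Z/\tau_k\mathbb Z$ ($1<\tau_1\mid\tau_2\mid\dots\mid\tau_s$) is a finite abelian group of order $$|G_{\mathbf a}|=\Big(\sum_{i=1}^{n+1}a_i\Big)^{n-1}$$ acting on $\mathbb P(\mathbf q)$ by $$\big(([\varepsilon_k]_{\tau_k})_k,[x_1:\dots:x_{n+1}]\big)\mapsto\Big[\prod_{k=1}^s\exp\Big(\frac{2\pi i\,\gamma_{k,j}\varepsilon_k}{\tau_k}\Big)x_j\Big]_{j=1}^{n+1}.$$ Here $s$, the $\tau_k$ and the integer matrix $(\gamma_{k,j})$ are given by any run of the following algorithm, and there is such a run (HNF denotes the row Hermite normal form). (1) Take a fan matrix $\widetilde\Lambda$ of $\mathbb P(\mathbf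 q)$ (an integer $n\times(n+1)$ matrix whose columns generate $\mathbb Z^n$, with $\widetilde\Lambda\mathbf q^T=0$) and $A\in\mathrm{GL}_n(\mathbb Z)$ with $A\Lambda_{\mathbf a}=\beta\widetilde\Lambda$, $\beta=\mathrm{diag}(1,\dots,1,\tau_1,\dots,\tau_s)$. (2) Take a row $\mathbf u$ such that the matrix $U_{\mathbf q}$ with first row $\mathbf u$ and remaining rows $\widetilde\Lambda$ is in $\mathrm{GL}_{n+1}(\mathbb Z)$ and $U_{\mathbf q}\mathbf q^T=(1,0,\dots,0)^T$. (3) Take $W\in\mathrm{GL}_{n+1}(\mathbb Z)$ bringing the transpose of the upper $n+1-s$ rows of $U_{\mathbf q}$ to HNF by left multiplication. (4) Let ${}_s\widetilde\Lambda$, ${}_sW$ be the lower $s$ rows of $\widetilde\Lambda$, $W$, and $G={}_s\widetilde\Lambda\cdot{}_sW^T$. (5) Take $U_G\in\mathrm{GL}_s(\mathbb Z)$ with $U_GG^T$ in HNF and put $(\gamma_{k,j})=U_G\cdot{}_sW$. In particular, if $\mathbf a$ is a reduced weight vector (all $d_i=1$), then $\mathbf q=\mathbf a$, so that $\mathbb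 X_{\mathbf a}\cong\mathbb P(\mathbf a)/G_{\mathbf a}$, and $\mathbf b=(a_{n+1},\dots,a_{n+1},a_n)$. -/

import Mathlib

open scoped Pointwise NNReal

noncomputable section

namespace FDuality

/-! ### Complex varieties as spaces with functions -/

/-- A space with functions: a topological space together with, for every set `W`
(only open ones matter), the functions that are regular on `W`. A function on `W` is represented
by any extension to the whole space. -/
class SpaceWithFunctions (X : Type) extends TopologicalSpace X where
  regular : Set X → (X → ℂ) → Prop

/-- The Zariski structure determined by an algebra `A` of functions: the non-vanishing loci of
elements of `A` generate the topology, and regular functions are locally quotients of elements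
of `A`. -/
@[reducible] def SpaceWithFunctions.ofAlgebra {X : Type} (A : Subalgebra ℂ (X → ℂ)) : SpaceWithFunctions X where
  toTopologicalSpace := TopologicalSpace.generateFrom {W | ∃ p ∈ A, W = {x | p x ≠ 0}}
  regular W f := ∀ x ∈ W, ∃ W' : Set X,
    (TopologicalSpace.generateFrom {W | ∃ p ∈ A, W = {x | p x ≠ 0}}).IsOpen W' ∧ x ∈ W' ∧ W' ⊆ W ∧
      ∃ p ∈ A, ∃ q ∈ A, ∀ y ∈ W', q y ≠ 0 ∧ f y = p y / q y

/-- The final structure on `Y` for a family of maps `π i : U i → Y`: a set is open, and a function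
is regular on it, iff this holds after pulling back along every `π i`. It is used for patching
charts along open subsets and for quotients by groups. -/
@[reducible] def SpaceWithFunctions.final {ι Y : Type} {U : ι → Type} [∀ i, SpaceWithFunctions (U i)]
    (π : ∀ i, U i → Y) : SpaceWithFunctions Y where
  toTopologicalSpace := ⨆ i, TopologicalSpace.coinduced (π i) inferInstance
  regular W f := ∀ i, SpaceWithFunctions.regular (π i ⁻¹' W) (f ∘ π i)

/-- A bijection that is a homeomorphism and identifies the regular functions on open sets. -/
def IsVarietyIso {X Y : Type} [SpaceWithFunctions X] [SpaceWithFunctions Y] (e : X ≃ Y) : Prop :=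
  (∀ W : Set Y, IsOpen W ↔ IsOpen (e ⁻¹' W)) ∧
    ∀ W : Set Y, IsOpen W → ∀ f : Y → ℂ,
      SpaceWithFunctions.regular W f ↔ SpaceWithFunctions.regular (e ⁻¹' W) (f ∘ e)

/-! ### Cones and fans in `ℝⁿ`, with lattice `ℤⁿ`; the dual lattice is `ℤⁿ` via the dot product -/

/-- The inclusion of the lattice `ℤⁿ` in `ℝⁿ`. -/
def lat {n : ℕ} (v : Fin n → ℤ) : Fin n → ℝ := fun i => (v i : ℝ)

/-- The convex cone generated by a set of vectors. -/
def cone {n : ℕ} (S : Set (Fin n → ℝ)) : Set (Fin n → ℝ) :=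
  (Submodule.span ℝ≥0 S : Set (Fin n → ℝ))

/-- `τ` is a face of the cone `σ`. -/
def IsFace {n : ℕ} (τ σ : Set (Fin n → ℝ)) : Prop :=
  ∃ u : Fin n → ℝ, (∀ v ∈ σ, 0 ≤ dotProduct u v) ∧ τ = {v ∈ σ | dotProduct u v = 0}

/-- A fan: a finite collection of strongly convex rational polyhedral cones, closed under faces,
any two of which meet in a common face. -/
structure IsFan {n : ℕ} (F : Set (Set (Fin n → ℝ))) : Prop where
  finite : F.Finite
  rational : ∀ σ ∈ F, ∃ S : Set (Fin n → ℤ), S.Finite ∧ σ = cone (lat '' S)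
  pointed : ∀ σ ∈ F, ∀ v ∈ σ, -v ∈ σ → v = 0
  face_mem : ∀ σ ∈ F, ∀ τ, IsFace τ σ → τ ∈ F
  inter_face : ∀ σ ∈ F, ∀ τ ∈ F, IsFace (σ ∩ τ) σ ∧ IsFace (σ ∩ τ) τ

/-- The support of the fan is the whole space. -/
def IsCompleteFan {n : ℕ} (F : Set (Set (Fin n → ℝ))) : Prop := ⋃₀ F = Set.univ

/-- Every cone is generated by linearly independent lattice vectors. -/
def IsSimplicialFan {n : ℕ} (F : Set (Set (Fin n → ℝ))) : Prop :=
  ∀ σ ∈ F, ∃ S : Set (Fin n → ℤ),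
    LinearIndependent ℝ (fun v : S => lat v.1) ∧ σ = cone (lat '' S)

/-- A lattice vector with coprime entries. -/
def IsPrimitive {n : ℕ} (v : Fin n → ℤ) : Prop := Finset.univ.gcd v = 1

/-- The primitive generators of the rays of a fan, i.e. the columns of its fan matrix. -/
def rays {n : ℕ} (F : Set (Set (Fin n → ℝ))) : Set (Fin n → ℤ) :=
  {v | IsPrimitive v ∧ cone {lat v} ∈ F}

/-- The complete simplicial fans whose rays are generated by the vectors of `R`. -/
def SF {n : ℕ} (R : Set (Fin n → ℤ)) : Set (Set (Set (Fin n → ℝ))) :=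
  {Ξ | IsFan Ξ ∧ IsCompleteFan Ξ ∧ IsSimplicialFan Ξ ∧ rays Ξ = R}

/-- `Ξ` refines `F` (for complete fans). -/
def Refines {n : ℕ} (Ξ F : Set (Set (Fin n → ℝ))) : Prop := ∀ τ ∈ Ξ, ∃ σ ∈ F, τ ⊆ σ

/-! ### The toric variety of a fan -/

/-- The semigroup `σ^∨ ∩ M`. -/
def dualMonoid {n : ℕ} (σ : Set (Fin n → ℝ)) : AddSubmonoid (Fin n → ℤ) where
  carrier := {u | ∀ v ∈ σ, 0 ≤ dotProduct (lat u) v}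
  zero_mem' := by intro v _; simp [lat, dotProduct]
  add_mem' := by
    intro u u' hu hu' v hv
    have h : lat (u + u') = lat u + lat u' := by ext i; simp [lat]
    rw [h, add_dotProduct]
    exact add_nonneg (hu v hv) (hu' v hv)

/-- The points of the affine toric variety `Spec ℂ[σ^∨ ∩ M]`: the semigroup morphisms from
`σ^∨ ∩ M` to the multiplicative semigroup `ℂ`. -/
def AffinePoints {n : ℕ} (σ : Set (Fin n → ℝ)) : Type := Multiplicative (dualMonoid σ) →* ℂ

/-- The value at a point of the character `χ^u`, for `u` in `σ^∨ ∩ M`. -/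
def AffinePoints.eval {n : ℕ} {σ : Set (Fin n → ℝ)} (u : dualMonoid σ) (x : AffinePoints σ) : ℂ :=
  (show Multiplicative (dualMonoid σ) →* ℂ from x) (Multiplicative.ofAdd u)

/-- The affine variety structure, with coordinate ring `ℂ[σ^∨ ∩ M]`. -/
instance {n : ℕ} (σ : Set (Fin n → ℝ)) : SpaceWithFunctions (AffinePoints σ) :=
  SpaceWithFunctions.ofAlgebra (Algebra.adjoin ℂ (Set.range (AffinePoints.eval (σ := σ))))

/-- The torus `(ℂ^*)ⁿ`. -/
abbrev Torus (n : ℕ) : Type := Fin n → ℂˣ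

/-- The point of the affine toric variety given by a torus element `t`, namely `u ↦ t^u`. -/
def torusAffine {n : ℕ} (σ : Set (Fin n → ℝ)) (t : Torus n) : AffinePoints σ :=
  show Multiplicative (dualMonoid σ) →* ℂ from
  { toFun := fun u => ((∏ i, t i ^ ((Multiplicative.toAdd u).1 i) : ℂˣ) : ℂ)
    map_one' := by simp
    map_mul' := by
      intro u u'
      rw [← Units.val_mul, ← Finset.prod_mul_distrib]
      simp [zpow_add] }

/-- The action of the torus, `(t • x)(u) = t^u x(u)`. -/
def torusAct {n : ℕ} {σ : Set (Fin n → ℝ)} (t : Torus n) (x : AffinePoints σ) : AffinePoints σ :=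
  show Multiplicative (dualMonoid σ) →* ℂ from
  (show Multiplicative (dualMonoid σ) →* ℂ from torusAffine σ t) *
    (show Multiplicative (dualMonoid σ) →* ℂ from x)

open Classical in
/-- The characteristic point `x_σ`: it maps `u` to `1` if `u ∈ σ^⊥` and to `0` otherwise. -/
def characteristicPoint {n : ℕ} (σ : Set (Fin n → ℝ)) : AffinePoints σ :=
  show Multiplicative (dualMonoid σ) →* ℂ from
  { toFun := fun u => if ∀ v ∈ σ, dotProduct (lat (Multiplicative.toAdd u).1) v = 0 then 1 else 0
    map_one' := by
      rw [if_pos]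
      intro v _
      simp [lat, dotProduct]
    map_mul' := by
      intro u u'
      have key : ∀ v, dotProduct (lat (Multiplicative.toAdd (u * u')).1) v
          = dotProduct (lat (Multiplicative.toAdd u).1) v
            + dotProduct (lat (Multiplicative.toAdd u').1) v := by
        intro v
        rw [← add_dotProduct]
        congr 1
        ext i
        simp [lat]
      by_cases h : ∀ v ∈ σ, dotProduct (lat (Multiplicative.toAdd u).1) v = 0
      · by_cases h' : ∀ v ∈ σ, dotProduct (lat (Multiplicative.toAdd u').1) v = 0
        · rw [if_pos h, if_pos h', if_pos]
          · simp
          · intro v hv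
            rw [key, h v hv, h' v hv, add_zero]
        · rw [if_neg h', if_neg]
          · simp
          · intro hc
            apply h'
            intro v hv
            have := hc v hv
            rw [key, h v hv, zero_add] at this
            exact this
      · rw [if_neg h, if_neg]
        · simp
        · intro hc
          apply h
          intro v hv
          have h1 := hc v hv
          rw [key] at h1
          have h2 := (Multiplicative.toAdd u).2 v hv
          have h3 := (Multiplicative.toAdd u').2 v hv
          linarith }

/-- Two points of charts are patched when the first lies in the chart of a face of the cone of the
second, and restricts to it. -/
def Patch {n : ℕ} (F : Set (Set (Fin n → ℝ))) (p p' : (σ : F) × AffinePoints σ.1) : Prop :=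
  IsFace p.1.1 p'.1.1 ∧ ∀ (u : Fin n → ℤ) (h : u ∈ dualMonoid p.1.1) (h' : u ∈ dualMonoid p'.1.1),
    p.2.eval ⟨u, h⟩ = p'.2.eval ⟨u, h'⟩

/-- The toric variety of a fan, obtained by patching the affine toric varieties of its cones
along the charts of common faces. -/
def ToricVariety {n : ℕ} (F : Set (Set (Fin n → ℝ))) : Type := Quot (Patch F)

/-- The map from an affine chart. -/
def ToricVariety.chart {n : ℕ} {F : Set (Set (Fin n → ℝ))} (σ : F) (x : AffinePoints σ.1) :
    ToricVariety F := Quot.mk _ ⟨σ, x⟩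

instance {n : ℕ} (F : Set (Set (Fin n → ℝ))) : SpaceWithFunctions (ToricVariety F) :=
  SpaceWithFunctions.final (fun σ : F => ToricVariety.chart σ)

/-- The embedding of the torus as the chart of the zero cone. -/
def ToricVariety.ofTorus {n : ℕ} {F : Set (Set (Fin n → ℝ))} (h : ({0} : Set (Fin n → ℝ)) ∈ F)
    (t : Torus n) : ToricVariety F :=
  ToricVariety.chart ⟨{0}, h⟩ (torusAffine {0} t)

/-- An isomorphism of toric varieties: an isomorphism of varieties that restricts to a group
homomorphism of the tori. -/
def IsToricIso {n : ℕ} {F₁ F₂ : Set (Set (Fin n → ℝ))}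
    (f : ToricVariety F₁ ≃ ToricVariety F₂) : Prop :=
  IsVarietyIso f ∧ ∃ (h₁ : {0} ∈ F₁) (h₂ : {0} ∈ F₂) (φ : Torus n →* Torus n),
    ∀ t : Torus n,
      f (ToricVariety.ofTorus h₁ t) = ToricVariety.ofTorus h₂ (φ t)

/-- The torus invariant prime divisor of a ray: the closure of the torus orbit of its
characteristic point. -/
def primeDivisor {n : ℕ} (F : Set (Set (Fin n → ℝ))) (v : rays F) : Set (ToricVariety F) :=
  closure (Set.range fun t : Torus n =>
    ToricVariety.chart ⟨cone {lat v.1}, v.2.2⟩ (torusAct t (characteristicPoint _)))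

/-- The torus invariant Weil divisor `∑ c_ρ D_ρ`, as a formal sum of prime divisors. -/
def toricDivisor {n : ℕ} (F : Set (Set (Fin n → ℝ))) (c : (Fin n → ℤ) → ℤ) :
    Set (ToricVariety F) →₀ ℤ :=
  ∑ᶠ v : rays F, Finsupp.single (primeDivisor F v) (c v.1)

/-! ### Framed toric varieties and framed duality -/

/-- A fan together with the coefficients of a torus invariant divisor; only the coefficients at
the primitive generators of the rays are used. -/
structure FramedFan (n : ℕ) where
  fan : Set (Set (Fin n → ℝ))
  coeff : (Fin n → ℤ) → ℤ

/-- A framed toric variety: a complete toric variety with a strictly effective torus invariant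
divisor. -/
def FramedFan.IsFramedToricVariety {n : ℕ} (X : FramedFan n) : Prop :=
  IsFan X.fan ∧ IsCompleteFan X.fan ∧ ∀ v ∈ rays X.fan, 0 < X.coeff v

/-- The polytope of the divisor. -/
def FramedFan.polytope {n : ℕ} (X : FramedFan n) : Set (Fin n → ℝ) :=
  {m | ∀ v ∈ rays X.fan, -(X.coeff v : ℝ) ≤ dotProduct m (lat v)}

/-- The integer part of a polytope: the convex hull of its lattice points. -/
def integerPart {n : ℕ} (Δ : Set (Fin n → ℝ)) : Set (Fin n → ℝ) :=
  convexHull ℝ (Δ ∩ Set.range lat)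

/-- The least positive `k` such that `0` is an interior point of the integer part of `k Δ`. -/
def FramedFan.k₀ {n : ℕ} (X : FramedFan n) : ℕ :=
  sInf {k : ℕ | 0 < k ∧ 0 ∈ interior (integerPart ((k : ℝ) • X.polytope))}

/-- The framing polytope. -/
def FramedFan.framingPolytope {n : ℕ} (X : FramedFan n) : Set (Fin n → ℝ) :=
  integerPart ((X.k₀ : ℝ) • X.polytope)

/-- `Φ` is a facet of the full dimensional polytope `Δ`. -/
def IsFacet {n : ℕ} (Φ Δ : Set (Fin n → ℝ)) : Prop :=
  Φ.Nonempty ∧ (∃ (w : Fin n → ℝ) (c : ℝ), (∀ m ∈ Δ, c ≤ dotProduct w m) ∧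
    Φ = {m ∈ Δ | dotProduct w m = c}) ∧ Module.finrank ℝ (vectorSpan ℝ Φ) + 1 = n

/-- The fan over a polytope: the faces of the cones projecting from the origin the facets that
do not contain the origin in their relative interior. -/
def fanOver {n : ℕ} (Δ : Set (Fin n → ℝ)) : Set (Set (Fin n → ℝ)) :=
  {τ | ∃ Φ, IsFacet Φ Δ ∧ 0 ∉ intrinsicInterior ℝ Φ ∧
    IsFace τ {x | ∃ m ∈ Φ, ∃ r : ℝ, 0 ≤ r ∧ x = r • m}}

/-- The framed dual: the toric variety of the fan over the framing polytope, framed by the least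
strictly positive coefficients `b` with `⟨v, λ⟩ + b_λ ≥ 0` for all rays `v` and `λ` of the two
fans. -/
def FramedFan.dual {n : ℕ} (X : FramedFan n) : FramedFan n where
  fan := fanOver X.framingPolytope
  coeff l := sInf {b : ℤ | 0 < b ∧ ∀ v ∈ rays X.fan, 0 ≤ dotProduct v l + b}

/-- The process `(X, a) ⇝ (X_a, b) ⇝ (X_b, c)` is calibrated: there are simplicial refinements
with the same rays of the fans of `X` and `X_b`, and an isomorphism of the corresponding toric
varieties identifying the pull-backs of the two framings. (The two refinements induce small
resolutions, so the pull-back of `∑ a_ρ D_ρ` is the divisor with the same coefficients on the same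
rays.) -/
def FramedFan.IsCalibrated {n : ℕ} (X : FramedFan n) : Prop :=
  ∃ Ξ ∈ SF (rays X.fan), ∃ Ξ' ∈ SF (rays X.dual.dual.fan),
    Refines Ξ X.fan ∧ Refines Ξ' X.dual.dual.fan ∧
    ∃ f : ToricVariety Ξ ≃ ToricVariety Ξ', IsToricIso f ∧
      toricDivisor Ξ X.coeff =
        (toricDivisor Ξ' X.dual.dual.coeff).mapDomain (fun D => f ⁻¹' D)

/-! ### Projective space -/

/-- The columns `e_1, …, e_n, -(1, …, 1)` of the fan matrix of projective space. -/
def projRay {n : ℕ} (i : Fin (n + 1)) : Fin n → ℤ :=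
  Fin.lastCases (motive := fun _ => Fin n → ℤ) (fun _ => -1) (fun j => Pi.single j 1) i

/-- Projective space with the divisor `∑ a_i D_i`; the cones of its fan are generated by the
proper subsets of the columns of the fan matrix. -/
def projectiveFraming {n : ℕ} (a : Fin (n + 1) → ℕ) : FramedFan n where
  fan := {σ | ∃ I : Set (Fin (n + 1)), I ≠ Set.univ ∧ σ = cone ((fun i => lat (projRay i)) '' I)}
  coeff v := ∑ i, if projRay i = v then (a i : ℤ) else 0

/-- `d_i = gcd (a_j : j ≠ i)`. -/
def gcdOthers {n : ℕ} (a : Fin (n + 1) → ℕ) (i : Fin (n + 1)) : ℕ :=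
  (Finset.univ.erase i).gcd a

/-- The reduced weight vector of a vector `a` of positive integers with greatest common divisor
`1`: `q_i = a_i / lcm (d_j : j ≠ i)`. -/
def reducedWeights {n : ℕ} (a : Fin (n + 1) → ℕ) (i : Fin (n + 1)) : ℕ :=
  a i / (Finset.univ.erase i).lcm (gcdOthers a)

/-- The second to last entry `a_n` of `(a_1, …, a_{n+1})`. -/
def secondLast {n : ℕ} (a : Fin (n + 1) → ℕ) : ℕ := a ⟨n - 1, by omega⟩

/-- The polytope `∇' = conv (0, e_1, (a_n / a_{n-1}) e_2, …, (a_n / a_1) e_n)`. -/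
def nablaPrime {n : ℕ} (a : Fin (n + 1) → ℕ) : Set (Fin n → ℝ) :=
  convexHull ℝ (insert 0 (Set.range fun i : Fin n =>
    (Pi.single i ((secondLast a : ℝ) / (a i.rev.castSucc : ℝ)) : Fin n → ℝ)))

/-- `conv (∇' ∩ N)` is the convex hull of `0` and the points `⌊a_n / a_{n-i+1}⌋ e_i`. -/
def ConditionA {n : ℕ} (a : Fin (n + 1) → ℕ) : Prop :=
  convexHull ℝ (nablaPrime a ∩ Set.range lat) =
    convexHull ℝ (insert 0 (Set.range fun i : Fin n =>
      (Pi.single i (⌊(secondLast a : ℝ) / (a i.rev.castSucc : ℝ)⌋ : ℝ) : Fin n → ℝ)))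

/-- At least two of the `d_i` are equal to `1`. -/
def ConditionB {n : ℕ} (a : Fin (n + 1) → ℕ) : Prop :=
  ∃ i j, i ≠ j ∧ gcdOthers a i = 1 ∧ gcdOthers a j = 1

/-! ### Weighted projective spaces and their quotients by finite groups -/

/-- `ℂ^m` without the origin. -/
def PuncturedSpace (m : ℕ) : Type := {x : Fin m → ℂ // x ≠ 0}

instance (m : ℕ) : SpaceWithFunctions (PuncturedSpace m) :=
  SpaceWithFunctions.ofAlgebra
    (Algebra.adjoin ℂ (Set.range fun (j : Fin m) (x : PuncturedSpace m) => x.1 j))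

/-- The weighted projective space `P(q)`: the quotient of `ℂ^m \ {0}` by the action
`t • x = (t^{q_j} x_j)` of `ℂ^*`. -/
def WeightedProjectiveSpace {m : ℕ} (q : Fin m → ℕ) : Type :=
  Quot (fun x y : PuncturedSpace m => ∃ t : ℂˣ, ∀ j, y.1 j = (t : ℂ) ^ q j * x.1 j)

/-- The point with given homogeneous coordinates. -/
def WeightedProjectiveSpace.mk {m : ℕ} (q : Fin m → ℕ) (x : PuncturedSpace m) :
    WeightedProjectiveSpace q := Quot.mk _ x

instance {m : ℕ} (q : Fin m → ℕ) : SpaceWithFunctions (WeightedProjectiveSpace q) :=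
  SpaceWithFunctions.final (fun _ : Unit => WeightedProjectiveSpace.mk q)

/-- The coefficient `∏_k exp (2πi γ_{k,j} ε_k / τ_k)` of the `j`-th coordinate. -/
def torsionCoeff {m s : ℕ} {τ : Fin s → ℕ+} (γ : Matrix (Fin s) (Fin m) ℤ)
    (ε : ∀ k, ZMod (τ k)) (j : Fin m) : ℂ :=
  ∏ k, ZMod.stdAddChar ((γ k j : ZMod (τ k)) * ε k)

theorem torsionCoeff_intCast {m s : ℕ} {τ : Fin s → ℕ+} (γ : Matrix (Fin s) (Fin m) ℤ)
    (ε : Fin s → ℤ) (j : Fin m) :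
    torsionCoeff (τ := τ) γ (fun k => (ε k : ZMod (τ k))) j =
      ∏ k, Complex.exp (2 * Real.pi * Complex.I * (γ k j * ε k) / (τ k : ℕ)) := by
  unfold torsionCoeff
  refine Finset.prod_congr rfl fun k _ => ?_
  rw [← Int.cast_mul, ZMod.stdAddChar_coe]
  push_cast
  rfl

theorem torsionCoeff_zero {m s : ℕ} {τ : Fin s → ℕ+} (γ : Matrix (Fin s) (Fin m) ℤ) (j : Fin m) :
    torsionCoeff (τ := τ) γ 0 j = 1 := by
  simp [torsionCoeff]

theorem torsionCoeff_add {m s : ℕ} {τ : Fin s → ℕ+} (γ : Matrix (Fin s) (Fin m) ℤ)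
    (ε ε' : ∀ k, ZMod (τ k)) (j : Fin m) :
    torsionCoeff γ (ε + ε') j = torsionCoeff γ ε j * torsionCoeff γ ε' j := by
  simp only [torsionCoeff, Pi.add_apply, mul_add, AddChar.map_add_eq_mul, Finset.prod_mul_distrib]

theorem torsionCoeff_ne_zero {m s : ℕ} {τ : Fin s → ℕ+} (γ : Matrix (Fin s) (Fin m) ℤ)
    (ε : ∀ k, ZMod (τ k)) (j : Fin m) : torsionCoeff γ ε j ≠ 0 := by
  intro h
  have h1 := torsionCoeff_add γ ε (-ε) j
  rw [add_neg_cancel, torsionCoeff_zero, h, zero_mul] at h1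
  exact one_ne_zero h1

/-- The diagonal action on coordinate vectors. -/
def torsionActVec {m s : ℕ} {τ : Fin s → ℕ+} (γ : Matrix (Fin s) (Fin m) ℤ)
    (ε : ∀ k, ZMod (τ k)) (x : PuncturedSpace m) : PuncturedSpace m :=
  ⟨fun j => torsionCoeff γ ε j * x.1 j, by
    intro h
    apply x.2
    funext j
    have := congrFun h j
    simpa [torsionCoeff_ne_zero] using this⟩

/-- The action of `⊕ ℤ/τ_k` on `P(q)` given by the matrix `γ`. -/
@[reducible] def torsionAction {m s : ℕ} (q : Fin m → ℕ) (τ : Fin s → ℕ+) (γ : Matrix (Fin s) (Fin m) ℤ) :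
    AddAction (∀ k, ZMod (τ k)) (WeightedProjectiveSpace q) where
  vadd ε := Quot.map (torsionActVec γ ε) (by
    rintro x y ⟨t, ht⟩
    refine ⟨t, fun j => ?_⟩
    simp only [torsionActVec, ht j]
    ring)
  zero_vadd := by
    rintro ⟨x⟩
    refine congrArg (Quot.mk _) (Subtype.ext (funext fun j => ?_))
    simp [torsionActVec, torsionCoeff_zero]
  add_vadd := by
    rintro ε ε' ⟨x⟩
    refine congrArg (Quot.mk _) (Subtype.ext (funext fun j => ?_))
    simp [torsionActVec, torsionCoeff_add, mul_assoc]

/-- The quotient `P(q) / G`, `G = ⊕ ℤ/τ_k` acting through `γ`. -/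
def WPSQuotient {m s : ℕ} (q : Fin m → ℕ) (τ : Fin s → ℕ+) (γ : Matrix (Fin s) (Fin m) ℤ) : Type :=
  letI := torsionAction q τ γ
  AddAction.orbitRel.Quotient (∀ k, ZMod (τ k)) (WeightedProjectiveSpace q)

/-- The quotient map from `P(q)`. -/
def WPSQuotient.proj {m s : ℕ} (q : Fin m → ℕ) (τ : Fin s → ℕ+) (γ : Matrix (Fin s) (Fin m) ℤ)
    (x : WeightedProjectiveSpace q) : WPSQuotient q τ γ :=
  letI := torsionAction q τ γ
  (Quotient.mk _ x : AddAction.orbitRel.Quotient (∀ k, ZMod (τ k)) (WeightedProjectiveSpace q))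

instance {m s : ℕ} (q : Fin m → ℕ) (τ : Fin s → ℕ+) (γ : Matrix (Fin s) (Fin m) ℤ) :
    SpaceWithFunctions (WPSQuotient q τ γ) :=
  SpaceWithFunctions.final (fun _ : Unit => WPSQuotient.proj q τ γ)

/-- The point of the quotient with given homogeneous coordinates. -/
def WPSQuotient.mk {m s : ℕ} (q : Fin m → ℕ) (τ : Fin s → ℕ+) (γ : Matrix (Fin s) (Fin m) ℤ)
    (x : PuncturedSpace m) : WPSQuotient q τ γ :=
  WPSQuotient.proj q τ γ (WeightedProjectiveSpace.mk q x)

/-- The point of `ℂ^{n+1} \ {0}` given by a vector of nonzero numbers. -/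
def torusVec {n : ℕ} (t : Torus (n + 1)) : PuncturedSpace (n + 1) :=
  ⟨fun j => (t j : ℂ), fun h => (t 0).ne_zero (congrFun h 0)⟩

/-- An isomorphism of toric varieties from `P(q) / G` to the toric variety of a fan: an
isomorphism of varieties that restricts to a homomorphism on the tori (the torus of `P(q) / G` is a
quotient of `(ℂ^*)^{n+1}`), and takes the image of each coordinate hyperplane `x_j = 0` to the prime
divisor of the ray `Λ j`. -/
def IsQuotientToricIso {n s : ℕ} {q : Fin (n + 1) → ℕ} {τ : Fin s → ℕ+}
    {γ : Matrix (Fin s) (Fin (n + 1)) ℤ} {F : Set (Set (Fin n → ℝ))}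
    (Λ : Fin (n + 1) → Fin n → ℤ) (e : WPSQuotient q τ γ ≃ ToricVariety F) : Prop :=
  IsVarietyIso e ∧
  (∃ (h : {0} ∈ F) (φ : Torus (n + 1) →* Torus n), ∀ t,
    e (WPSQuotient.mk q τ γ (torusVec t)) = ToricVariety.ofTorus h (φ t)) ∧
  ∀ j, ∃ h : Λ j ∈ rays F,
    e '' (WPSQuotient.mk q τ γ '' {x | x.1 j = 0}) = primeDivisor F ⟨Λ j, h⟩

/-! ### The algorithm for the torsion matrix -/

/-- The (row) Hermite normal form: echelon form with `r` nonzero rows, positive pivots `H i (p i)`,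
and entries above a pivot reduced modulo the pivot. -/
def IsHermiteNormalForm {k l : ℕ} (H : Matrix (Fin k) (Fin l) ℤ) : Prop :=
  ∃ (r : ℕ) (p : Fin k → Fin l), r ≤ k ∧
    (∀ i i' : Fin k, i < i' → i'.1 < r → p i < p i') ∧
    (∀ i : Fin k, i.1 < r → 0 < H i (p i) ∧ (∀ j, j < p i → H i j = 0) ∧
      ∀ i' < i, 0 ≤ H i' (p i) ∧ H i' (p i) < H i (p i)) ∧
    ∀ i : Fin k, r ≤ i.1 → ∀ j, H i j = 0

/-- The upper `k` rows of a matrix. -/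
def upperRows {m l : ℕ} (k : ℕ) (h : k ≤ m) (A : Matrix (Fin m) (Fin l) ℤ) :
    Matrix (Fin k) (Fin l) ℤ :=
  fun i j => A ⟨i.1, by omega⟩ j

/-- The lower `k` rows of a matrix. -/
def lowerRows {m l : ℕ} (k : ℕ) (h : k ≤ m) (A : Matrix (Fin m) (Fin l) ℤ) :
    Matrix (Fin k) (Fin l) ℤ :=
  fun i j => A ⟨m - k + i.1, by omega⟩ j

/-- `diag (1, …, 1, τ_1, …, τ_s)` of size `n`. -/
def switchingMatrix (n : ℕ) {s : ℕ} (τ : Fin s → ℕ+) : Matrix (Fin n) (Fin n) ℤ :=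
  Matrix.diagonal fun i =>
    if h : n - s ≤ i.1 ∧ i.1 - (n - s) < s then ((τ ⟨i.1 - (n - s), h.2⟩ : ℕ) : ℤ) else 1

/-- A fan matrix of `P(q)`: its columns generate the lattice and satisfy `∑ q_j v_j = 0`. -/
def IsWPSFanMatrix {n : ℕ} (q : Fin (n + 1) → ℕ) (L : Matrix (Fin n) (Fin (n + 1)) ℤ) : Prop :=
  Submodule.span ℤ (Set.range fun j => L.col j) = ⊤ ∧ L.mulVec (fun j => (q j : ℤ)) = 0

/-- `γ` and the torsion coefficients `τ` are an output of the algorithm for the fan matrix `Λ` and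
the reduced weight vector `q`, for some admissible choices in each of its steps. -/
def IsTorsionMatrix {n : ℕ} (Λ : Matrix (Fin n) (Fin (n + 1)) ℤ) (q : Fin (n + 1) → ℕ)
    {s : ℕ} (τ : Fin s → ℕ+) (γ : Matrix (Fin s) (Fin (n + 1)) ℤ) : Prop :=
  (∀ k, 1 < τ k) ∧ (∀ k l, k ≤ l → (τ k : ℕ) ∣ τ l) ∧
  ∃ (hs : s ≤ n) (L : Matrix (Fin n) (Fin (n + 1)) ℤ) (A : Matrix (Fin n) (Fin n) ℤ)
    (u : Fin (n + 1) → ℤ) (U W : Matrix (Fin (n + 1)) (Fin (n + 1)) ℤ)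
    (G U_G : Matrix (Fin s) (Fin s) ℤ),
    (IsWPSFanMatrix q L ∧ IsUnit A ∧ A * Λ = switchingMatrix n τ * L) ∧
    (U = Matrix.of (Fin.cons u L) ∧ IsUnit U ∧
      U.mulVec (fun j => (q j : ℤ)) = Pi.single 0 1) ∧
    (IsUnit W ∧
      IsHermiteNormalForm (W * (upperRows (n + 1 - s) (by omega) U).transpose)) ∧
    G = lowerRows s hs L * (lowerRows s (by omega) W).transpose ∧
    (IsUnit U_G ∧ IsHermiteNormalForm (U_G * G.transpose)) ∧
    γ = U_G * lowerRows s (by omega) W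

end FDuality

end

/-!
Write `A = ∑ a_i`. All fans that occur are governed by families of `n + 1` vectors with a single
positive relation (`SimplexSystem`): the cones over the proper subsets of such a family form a
complete simplicial fan (`simplexFan`), which is also the fan over the simplex that the family spans
(`SimplexSystem.fanOver_convexHull`).

**The dual.** The polytope of `∑ a_i D_i` is the lattice simplex with vertices `m_i` given by
`⟨v_j, m_i⟩ = A δ_ij - a_j` (`vertexVec`), and `m_i = d_i λ_i` with `λ_i` primitive (`dualRay`). Hence
the dual fan is the simplex fan of the `λ_i`, and the coefficients `b_i` can be read off
(`gcdOthers_mul_coeff_dual`).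

**Calibration.** The lattice points of the polytope of the dual are `-𝟏` and the points `x ≥ 0` with
`∑_{k ≤ n} a_k x_k ≤ a_n` (`lat_mem_polytope_dual_iff`). Condition (a) says that the latter span the
simplex on the axes; then the double dual has the fan of projective space, and condition (b) says that
its coefficients are the `a_i` again, so that the identity calibrates the process. Conversely, prime
divisors of distinct rays of a simplicial fan are distinct (`primeDivisor_injective`), so an
isomorphism that matches two divisors preserves the number of their components and the sum of their
coefficients (`card_rays_eq_and_sum_coeff_eq`). Every complete simplicial refinement of the fan of the
double dual has the `v_i` among its rays, as they are directions of exposed points. Equality of the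
numbers of components leaves no further rays, and convexity of the polytope forces (a)
(`cornerCondition_of_rays`). Since the coefficients satisfy `c_i ≤ a_i`, equality of the sums
gives `c = a`, which is (b).

**The algorithm.** A Hermite normal form with an integral left inverse consists of an identity matrix
and zero rows (`IsHermiteNormalForm.eq_one`). This turns a run of the algorithm into a pair of inverse
unimodular matrices `U`, `E` whose bases are adapted to `q`, to the rows of `Λ`, and to the `γ_k`
(`AdaptedBasis`), and shows that the row lattice of `Λ` is
`{m | ⟨q, m⟩ = 0, ⟨γ_k, m⟩ ≡ 0 mod τ_k}` (`AdaptedBasis.mem_rowLattice_iff`). A run exists by the Smith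
normal form (`exists_isTorsionMatrix`), and comparing maximal minors gives the order of the group
(`AdaptedBasis.prod_torsion`).

**The quotient.** A vector `z` consists of homogeneous coordinates of a point when each character `χ^u`
takes the value `∏ z_j ^ ⟨u, λ_j⟩` there (`IsLift`). Homogeneous coordinates exist because `ℂ^*` is
divisible (`AdaptedBasis.exists_isLift`), and by the description of the row lattice they are unique up
to `ℂ^* × G` (`AdaptedBasis.exists_of_isLift`); this is the bijection. That it identifies open sets and
regular functions comes down to splitting a polynomial into its parts on which `ℂ^* × G` acts by
characters. A part that does not vanish at a point descends to the chart after multiplication by a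
monomial (`AdaptedBasis.exists_descent`), and linear independence of characters together with the
identity principle (`regular_mul_eq`) lets each part replace the polynomial. Coordinate hyperplanes map
onto prime divisors because the torus orbit of the ray is dense in both
(`IsCoordinateMap.image_hyperplane`).
-/

noncomputable section

namespace FDuality

/-! ### Cones spanned by finite families -/

theorem mem_cone_image {n : ℕ} {ι : Type*} [Fintype ι] (w : ι → Fin n → ℝ) (I : Set ι)
    (v : Fin n → ℝ) :
    v ∈ cone (w '' I) ↔
      ∃ c : ι → ℝ, (∀ i, 0 ≤ c i) ∧ (∀ i, i ∉ I → c i = 0) ∧ v = ∑ i, c i • w i := by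
  classical
  constructor
  · intro hv
    refine Submodule.span_induction (p := fun v _ => ∃ c : ι → ℝ, (∀ i, 0 ≤ c i) ∧
      (∀ i, i ∉ I → c i = 0) ∧ v = ∑ i, c i • w i) ?_ ?_ ?_ ?_ hv
    · rintro _ ⟨i, hi, rfl⟩
      refine ⟨Pi.single i 1, fun j => ?_, fun j hj => ?_, ?_⟩
      · by_cases h : j = i
        · subst h; simp
        · simp [h]
      · have : j ≠ i := fun h => hj (h ▸ hi)
        simp [this]
      · simp [Pi.single_apply]
    · exact ⟨0, by simp, by simp, by simp⟩
    · rintro _ _ _ _ ⟨c, h1, h2, rfl⟩ ⟨d, h3, h4, rfl⟩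
      refine ⟨c + d, fun i => add_nonneg (h1 i) (h3 i), fun i hi => by simp [h2 i hi, h4 i hi], ?_⟩
      simp [add_smul, Finset.sum_add_distrib]
    · rintro a _ _ ⟨c, h1, h2, rfl⟩
      refine ⟨fun i => a * c i, fun i => mul_nonneg a.2 (h1 i), fun i hi => by simp [h2 i hi], ?_⟩
      simp [Finset.smul_sum, NNReal.smul_def, smul_smul]
  · rintro ⟨c, h1, h2, rfl⟩
    refine Submodule.sum_mem _ fun i _ => ?_
    by_cases hi : i ∈ I
    · have := Submodule.smul_mem (Submodule.span ℝ≥0 (w '' I)) (⟨c i, h1 i⟩ : ℝ≥0)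
        (Submodule.subset_span ⟨i, hi, rfl⟩)
      exact this
    · simp [h2 i hi]

theorem cone_mono {n : ℕ} {S T : Set (Fin n → ℝ)} (h : S ⊆ T) : cone S ⊆ cone T :=
  Submodule.span_mono h

theorem subset_cone {n : ℕ} (S : Set (Fin n → ℝ)) : S ⊆ cone S := Submodule.subset_span

theorem zero_mem_cone {n : ℕ} (S : Set (Fin n → ℝ)) : (0 : Fin n → ℝ) ∈ cone S :=
  Submodule.zero_mem _

theorem smul_mem_cone {n : ℕ} {S : Set (Fin n → ℝ)} {v : Fin n → ℝ} {r : ℝ} (hr : 0 ≤ r)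
    (hv : v ∈ cone S) : r • v ∈ cone S :=
  Submodule.smul_mem (Submodule.span ℝ≥0 S) (⟨r, hr⟩ : ℝ≥0) hv

theorem sum_mem_cone {n : ℕ} {S : Set (Fin n → ℝ)} {ι : Type*} (s : Finset ι)
    {f : ι → Fin n → ℝ} (h : ∀ i ∈ s, f i ∈ cone S) : ∑ i ∈ s, f i ∈ cone S :=
  Submodule.sum_mem _ h

theorem mem_cone_singleton {n : ℕ} {v x : Fin n → ℝ} :
    x ∈ cone {v} ↔ ∃ r : ℝ, 0 ≤ r ∧ x = r • v := by
  unfold cone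
  rw [SetLike.mem_coe, Submodule.mem_span_singleton]
  constructor
  · rintro ⟨a, rfl⟩; exact ⟨a, a.2, rfl⟩
  · rintro ⟨r, hr, rfl⟩; exact ⟨⟨r, hr⟩, rfl⟩

theorem cone_empty {n : ℕ} : cone (∅ : Set (Fin n → ℝ)) = {0} := by
  simp [cone]

/-! ### Lattice vectors -/

theorem lat_injective {n : ℕ} : Function.Injective (lat : (Fin n → ℤ) → Fin n → ℝ) := by
  intro v w h
  ext i
  have := congrFun h i
  simpa [lat] using this

theorem lat_zero {n : ℕ} : lat (0 : Fin n → ℤ) = 0 := by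
  ext i; simp [lat]

theorem lat_neg {n : ℕ} (v : Fin n → ℤ) : lat (-v) = -lat v := by
  ext i; simp [lat]

theorem lat_smul {n : ℕ} (k : ℤ) (v : Fin n → ℤ) : lat (k • v) = (k : ℝ) • lat v := by
  ext i; simp [lat]

theorem lat_dotProduct {n : ℕ} (v w : Fin n → ℤ) :
    dotProduct (lat v) (lat w) = ((dotProduct v w : ℤ) : ℝ) := by
  simp [lat, dotProduct]

theorem IsPrimitive.ne_zero {n : ℕ} {v : Fin n → ℤ} (hv : IsPrimitive v) : v ≠ 0 := by
  rintro rfl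
  unfold IsPrimitive at hv
  have : (Finset.univ.gcd (0 : Fin n → ℤ)) = 0 := by
    rw [Finset.gcd_eq_zero_iff]; simp
  rw [this] at hv
  exact zero_ne_one hv

/-- Two primitive vectors on the same ray coincide. -/
theorem IsPrimitive.eq_of_smul {n : ℕ} {v w : Fin n → ℤ} (hv : IsPrimitive v)
    (hw : IsPrimitive w) {r : ℝ} (hr : 0 ≤ r) (h : lat v = r • lat w) : v = w := by
  obtain ⟨k, hk⟩ : ∃ k, w k ≠ 0 := by
    by_contra! hc
    exact hw.ne_zero (funext hc)
  have hc : ∀ i, (v i : ℝ) = r * w i := fun i => by simpa [lat] using congrFun h i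
  have key : ∀ i, |w k| * v i = |v k| * w i := by
    intro i
    have : ((|w k| * v i : ℤ) : ℝ) = ((|v k| * w i : ℤ) : ℝ) := by
      push_cast
      rw [hc k, hc i, abs_mul, abs_of_nonneg hr]
      ring
    exact_mod_cast this
  have h1 : Finset.univ.gcd (fun i => |w k| * v i) = |w k| := by
    rw [Finset.gcd_mul_left, hv, mul_one, Int.normalize_of_nonneg (abs_nonneg _)]
  have h2 : Finset.univ.gcd (fun i => |v k| * w i) = |v k| := by
    rw [Finset.gcd_mul_left, hw, mul_one, Int.normalize_of_nonneg (abs_nonneg _)]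
  have h3 : |w k| = |v k| := by rw [← h1, ← h2]; simp only [key]
  funext i
  have := key i
  rw [← h3] at this
  exact mul_left_cancel₀ (by simpa using hk) this

/-- Every nonzero lattice vector is a positive multiple of a primitive one. -/
theorem exists_primitive {n : ℕ} {v : Fin n → ℤ} (hv : v ≠ 0) :
    ∃ (w : Fin n → ℤ) (k : ℤ), IsPrimitive w ∧ 0 < k ∧ v = k • w := by
  obtain ⟨i, hi⟩ : ∃ i, v i ≠ 0 := by
    by_contra! hc
    exact hv (funext hc)
  have hpos : Finset.univ.gcd v ≠ 0 := fun hc =>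
    hi (Finset.gcd_eq_zero_iff.1 hc i (Finset.mem_univ i))
  have hnn : 0 ≤ Finset.univ.gcd v := Finset.Int.finsetGcd_nonneg
  obtain ⟨w, h1, h2⟩ := Finset.extract_gcd v ⟨i, Finset.mem_univ i⟩
  exact ⟨w, Finset.univ.gcd v, h2, by omega, funext fun j => by simpa using h1 j⟩

theorem singleton_ne_univ {n : ℕ} (hn : 0 < n) (i : Fin (n + 1)) :
    ({i} : Set (Fin (n + 1))) ≠ Set.univ := by
  intro hc
  have : Nontrivial (Fin (n + 1)) := Fin.nontrivial_iff_two_le.2 (by omega)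
  obtain ⟨j, hj⟩ := exists_ne i
  have : j ∈ ({i} : Set (Fin (n + 1))) := hc ▸ Set.mem_univ j
  exact hj this

/-! ### Simplex systems -/

/-- The vectors `w_0, …, w_n` of `ℝⁿ` span the space and are subject to the positive relation
`∑ q_i w_i = 0`, unique up to scaling. Equivalently, they are the vertices of a simplex with `0`
in its interior. -/
structure SimplexSystem {n : ℕ} (w : Fin (n + 1) → Fin n → ℝ) (q : Fin (n + 1) → ℝ) : Prop where
  pos : ∀ i, 0 < q i
  rel : ∑ i, q i • w i = 0
  unique : ∀ c : Fin (n + 1) → ℝ, ∑ i, c i • w i = 0 → ∃ t, ∀ i, c i = t * q i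

namespace SimplexSystem

variable {n : ℕ} {w : Fin (n + 1) → Fin n → ℝ} {q : Fin (n + 1) → ℝ}

theorem exists_coords (h : SimplexSystem w q) (v : Fin n → ℝ) :
    ∃ c : Fin (n + 1) → ℝ, v = ∑ i, c i • w i := by
  have hr := LinearMap.finrank_range_add_finrank_ker (Fintype.linearCombination ℝ w)
  have hk : LinearMap.ker (Fintype.linearCombination ℝ w) ≤ Submodule.span ℝ {q} := by
    intro c hc
    rw [LinearMap.mem_ker, Fintype.linearCombination_apply] at hc
    obtain ⟨t, ht⟩ := h.unique c hc
    exact Submodule.mem_span_singleton.2 ⟨t, by ext i; simp [ht i]⟩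
  have hk1 := (Submodule.finrank_mono hk).trans (finrank_span_le_card ({q} : Set (Fin (n + 1) → ℝ)))
  have htop : LinearMap.range (Fintype.linearCombination ℝ w) = ⊤ := by
    apply Submodule.eq_top_of_finrank_eq
    have := Submodule.finrank_le (LinearMap.range (Fintype.linearCombination ℝ w))
    simp only [Module.finrank_fintype_fun_eq_card, Fintype.card_fin, Set.toFinset_singleton,
      Finset.card_singleton] at *
    omega
  obtain ⟨c, hc⟩ := (LinearMap.range_eq_top.1 htop) v
  exact ⟨c, by rw [← hc, Fintype.linearCombination_apply]⟩

/-- The relation `q` is the only constraint on the values of a functional on the vectors. -/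
theorem exists_dual (h : SimplexSystem w q) (m : Fin (n + 1) → ℝ) (hm : ∑ i, q i * m i = 0) :
    ∃ u : Fin n → ℝ, ∀ k, dotProduct u (w k) = m k := by
  let T : (Fin n → ℝ) →ₗ[ℝ] (Fin (n + 1) → ℝ) :=
    LinearMap.pi fun k => (dotProductBilin ℝ ℝ).flip (w k)
  have hT : ∀ u k, T u k = dotProduct u (w k) := fun u k => rfl
  let Q : (Fin (n + 1) → ℝ) →ₗ[ℝ] ℝ := Fintype.linearCombination ℝ q
  have hQ : ∀ m, Q m = ∑ i, m i * q i := fun m => by simp [Q, Fintype.linearCombination_apply]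
  have hinj : LinearMap.ker T = ⊥ := by
    rw [LinearMap.ker_eq_bot']
    intro u hu
    rw [← dotProduct_self_eq_zero]
    obtain ⟨c, hc⟩ := h.exists_coords u
    have : dotProduct u (∑ i, c i • w i) = 0 := by
      rw [dotProduct_sum]
      refine Finset.sum_eq_zero fun i _ => ?_
      rw [dotProduct_smul, ← hT, hu]; simp
    rwa [← hc] at this
  have hle : LinearMap.range T ≤ LinearMap.ker Q := by
    rintro _ ⟨u, rfl⟩
    rw [LinearMap.mem_ker, hQ]
    simp only [hT]
    have := congrArg (dotProduct u) h.rel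
    rw [dotProduct_sum, dotProduct_zero] at this
    simpa [dotProduct_smul, mul_comm] using this
  have hQr : LinearMap.range Q = ⊤ := by
    rw [LinearMap.range_eq_top]
    intro r
    refine ⟨Pi.single 0 (r / q 0), ?_⟩
    rw [hQ]
    simp [Pi.single_apply, (h.pos 0).ne']
  have h1 := LinearMap.finrank_range_add_finrank_ker Q
  have h2 := LinearMap.finrank_range_add_finrank_ker T
  rw [hinj] at h2
  rw [hQr] at h1
  simp only [finrank_top, Module.finrank_self, finrank_bot,
    Module.finrank_fintype_fun_eq_card, Fintype.card_fin] at h1 h2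
  have heq := Submodule.eq_of_le_of_finrank_eq hle (by omega)
  have hmem : m ∈ LinearMap.ker Q := by
    rw [LinearMap.mem_ker, hQ]; simpa [mul_comm] using hm
  rw [← heq] at hmem
  obtain ⟨u, hu⟩ := hmem
  exact ⟨u, fun k => by rw [← hT, hu]⟩

/-- A functional with prescribed values on all the vectors but one. -/
theorem exists_dual_of_ne (h : SimplexSystem w q) (i : Fin (n + 1)) (m : Fin (n + 1) → ℝ) :
    ∃ u : Fin n → ℝ, ∀ k, k ≠ i → dotProduct u (w k) = m k := by
  obtain ⟨u, hu⟩ := h.exists_dual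
    (Function.update m i (-(∑ k ∈ Finset.univ.erase i, q k * m k) / q i)) (by
      rw [← Finset.add_sum_erase _ _ (Finset.mem_univ i)]
      have : ∑ x ∈ Finset.univ.erase i, q x * Function.update m i
          (-(∑ k ∈ Finset.univ.erase i, q k * m k) / q i) x =
          ∑ x ∈ Finset.univ.erase i, q x * m x :=
        Finset.sum_congr rfl fun x hx => by
          rw [Function.update_of_ne (Finset.ne_of_mem_erase hx)]
      rw [this, Function.update_self]
      field_simp [(h.pos i).ne']
      ring)
  exact ⟨u, fun k hk => by rw [hu, Function.update_of_ne hk]⟩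

/-- Coefficients that vanish somewhere are determined by the vector. -/
theorem coords_unique (h : SimplexSystem w q) {c d : Fin (n + 1) → ℝ} (hc : ∀ i, 0 ≤ c i)
    (hd : ∀ i, 0 ≤ d i) {i j : Fin (n + 1)} (hi : c i = 0) (hj : d j = 0)
    (e : ∑ i, c i • w i = ∑ i, d i • w i) : c = d := by
  obtain ⟨t, ht⟩ := h.unique (c - d) (by
    simp only [Pi.sub_apply, sub_smul, Finset.sum_sub_distrib, e, sub_self])
  have h1 := ht i
  have h2 := ht j
  simp only [Pi.sub_apply, hi, hj] at h1 h2
  have t0 : t = 0 := by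
    have hp := h.pos i
    have hp' := h.pos j
    have a1 := hd i
    have a2 := hc j
    apply le_antisymm
    · by_contra! hlt
      have := mul_pos hlt hp
      linarith
    · by_contra! hlt
      have := mul_neg_of_neg_of_pos hlt hp'
      linarith
  ext k
  have := ht k
  rw [t0, zero_mul, Pi.sub_apply] at this
  linarith

theorem exists_nonneg_coords (h : SimplexSystem w q) (v : Fin n → ℝ) :
    ∃ (c : Fin (n + 1) → ℝ) (i : Fin (n + 1)), (∀ k, 0 ≤ c k) ∧ c i = 0 ∧ v = ∑ k, c k • w k := by
  obtain ⟨c, hc⟩ := h.exists_coords v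
  obtain ⟨i, -, hi⟩ := Finset.exists_min_image Finset.univ (fun k => c k / q k)
    Finset.univ_nonempty
  refine ⟨fun k => c k - c i / q i * q k, i, fun k => ?_, ?_, ?_⟩
  · have := hi k (Finset.mem_univ k)
    rw [le_div_iff₀ (h.pos k)] at this
    linarith
  · have := (h.pos i).ne'
    field_simp
    ring
  · simp only [sub_smul, Finset.sum_sub_distrib, ← hc]
    have := h.rel
    simp only [mul_smul, ← Finset.smul_sum, this, smul_zero, sub_zero]

theorem mem_of_mem_cone (h : SimplexSystem w q) (hn : 0 < n) {I : Set (Fin (n + 1))}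
    (hI : I ≠ Set.univ) {k : Fin (n + 1)} (hk : w k ∈ cone (w '' I)) : k ∈ I := by
  obtain ⟨c, h1, h2, h3⟩ := (mem_cone_image w I _).1 hk
  obtain ⟨i, hi⟩ := (Set.ne_univ_iff_exists_notMem I).1 hI
  have : Nontrivial (Fin (n + 1)) := Fin.nontrivial_iff_two_le.2 (by omega)
  obtain ⟨j, hj⟩ := exists_ne k
  have := h.coords_unique (c := c) (d := Pi.single k 1) h1
    (fun l => by by_cases hl : l = k <;> simp [hl]) (h2 i hi)
    (j := j) (by simp [hj]) (by rw [← h3]; simp [Pi.single_apply])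
  by_contra hc
  have h4 := h2 k hc
  rw [this] at h4
  simp at h4

/-- The faces of the cone over a proper subset of the vectors are the cones over its subsets, since
by `exists_dual_of_ne` any nonnegative values on the subset are attained by a functional. -/
theorem isFace_cone_iff (h : SimplexSystem w q) {I : Set (Fin (n + 1))} (hI : I ≠ Set.univ)
    {τ : Set (Fin n → ℝ)} : IsFace τ (cone (w '' I)) ↔ ∃ J ⊆ I, τ = cone (w '' J) := by
  classical
  constructor
  · rintro ⟨u, h1, rfl⟩
    refine ⟨{i | i ∈ I ∧ dotProduct u (w i) = 0}, fun i hi => hi.1, ?_⟩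
    have h1' : ∀ i ∈ I, 0 ≤ dotProduct u (w i) := fun i hi => h1 _ (subset_cone _ ⟨i, hi, rfl⟩)
    ext v
    simp only [Set.mem_sep_iff, mem_cone_image]
    constructor
    · rintro ⟨⟨c, a1, a2, rfl⟩, h2⟩
      refine ⟨c, a1, fun i hi => ?_, rfl⟩
      by_cases hiI : i ∈ I
      · rw [dotProduct_sum, Finset.sum_eq_zero_iff_of_nonneg] at h2
        · have := h2 i (Finset.mem_univ i)
          rw [dotProduct_smul, smul_eq_mul, mul_eq_zero] at this
          exact this.resolve_right fun hc => hi ⟨hiI, hc⟩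
        · intro j _
          rw [dotProduct_smul, smul_eq_mul]
          by_cases hj : j ∈ I
          · exact mul_nonneg (a1 j) (h1' j hj)
          · simp [a2 j hj]
      · exact a2 i hiI
    · rintro ⟨c, a1, a2, rfl⟩
      refine ⟨⟨c, a1, fun i hi => a2 i fun hc => hi hc.1, rfl⟩, ?_⟩
      rw [dotProduct_sum]
      refine Finset.sum_eq_zero fun i _ => ?_
      rw [dotProduct_smul, smul_eq_mul]
      by_cases hi : i ∈ I ∧ dotProduct u (w i) = 0
      · simp [hi.2]
      · simp [a2 i hi]
  · rintro ⟨J, hJ, rfl⟩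
    obtain ⟨i, hi⟩ := (Set.ne_univ_iff_exists_notMem I).1 hI
    obtain ⟨u, hu⟩ := h.exists_dual_of_ne i (fun k => if k ∈ J then 0 else 1)
    have hu' : ∀ k ∈ I, dotProduct u (w k) = if k ∈ J then 0 else 1 :=
      fun k hk => hu k fun hc => hi (hc ▸ hk)
    have hsum : ∀ c : Fin (n + 1) → ℝ, (∀ i, i ∉ I → c i = 0) →
        dotProduct u (∑ i, c i • w i) = ∑ i, if i ∈ J then 0 else c i := by
      intro c hc
      rw [dotProduct_sum]
      refine Finset.sum_congr rfl fun k _ => ?_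
      rw [dotProduct_smul, smul_eq_mul]
      by_cases hk : k ∈ I
      · rw [hu' k hk]; split_ifs <;> simp
      · rw [hc k hk]; simp
    refine ⟨u, ?_, ?_⟩
    · intro v hv
      obtain ⟨c, a1, a2, rfl⟩ := (mem_cone_image _ _ _).1 hv
      rw [hsum c a2]
      exact Finset.sum_nonneg fun k _ => by split_ifs; exacts [le_rfl, a1 k]
    · ext v
      simp only [mem_cone_image]
      constructor
      · rintro ⟨c, a1, a2, rfl⟩
        have a3 : ∀ i, i ∉ I → c i = 0 := fun i hi => a2 i fun hc => hi (hJ hc)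
        refine ⟨⟨c, a1, a3, rfl⟩, ?_⟩
        rw [hsum c a3]
        exact Finset.sum_eq_zero fun k _ => by split_ifs with hk; exacts [rfl, a2 k hk]
      · rintro ⟨⟨c, a1, a2, rfl⟩, h0⟩
        rw [hsum c a2, Finset.sum_eq_zero_iff_of_nonneg
          (fun k _ => by split_ifs; exacts [le_rfl, a1 k])] at h0
        refine ⟨c, a1, fun k hk => ?_, rfl⟩
        have := h0 k (Finset.mem_univ k)
        rwa [if_neg hk] at this

theorem cone_inter (h : SimplexSystem w q) {I J : Set (Fin (n + 1))} (hI : I ≠ Set.univ)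
    (hJ : J ≠ Set.univ) : cone (w '' I) ∩ cone (w '' J) = cone (w '' (I ∩ J)) := by
  apply Set.Subset.antisymm
  · rintro v ⟨h1, h2⟩
    obtain ⟨c, a1, a2, rfl⟩ := (mem_cone_image _ _ _).1 h1
    obtain ⟨d, b1, b2, e⟩ := (mem_cone_image _ _ _).1 h2
    obtain ⟨i, hi⟩ := (Set.ne_univ_iff_exists_notMem I).1 hI
    obtain ⟨j, hj⟩ := (Set.ne_univ_iff_exists_notMem J).1 hJ
    have := h.coords_unique a1 b1 (a2 i hi) (b2 j hj) e
    refine (mem_cone_image _ _ _).2 ⟨c, a1, fun k hk => ?_, rfl⟩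
    by_cases hkI : k ∈ I
    · rw [this]; exact b2 k fun hc => hk ⟨hkI, hc⟩
    · exact a2 k hkI
  · exact Set.subset_inter (cone_mono (Set.image_mono Set.inter_subset_left))
      (cone_mono (Set.image_mono Set.inter_subset_right))

end SimplexSystem

/-- The fan whose cones are generated by the proper subsets of a family of `n + 1` vectors. -/
def simplexFan {n : ℕ} (w : Fin (n + 1) → Fin n → ℝ) : Set (Set (Fin n → ℝ)) :=
  {σ | ∃ I : Set (Fin (n + 1)), I ≠ Set.univ ∧ σ = cone (w '' I)}

namespace SimplexSystem

variable {n : ℕ} {w : Fin (n + 1) → Fin n → ℝ} {q : Fin (n + 1) → ℝ}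

theorem isCompleteFan (h : SimplexSystem w q) : IsCompleteFan (simplexFan w) := by
  refine Set.eq_univ_of_forall fun v => ?_
  obtain ⟨c, i, h1, h2, h3⟩ := h.exists_nonneg_coords v
  refine ⟨cone (w '' {i}ᶜ), ⟨{i}ᶜ, by simp, rfl⟩, (mem_cone_image _ _ _).2 ⟨c, h1, ?_, h3⟩⟩
  intro k hk
  simp only [Set.mem_compl_iff, Set.mem_singleton_iff, not_not] at hk
  rw [hk, h2]

theorem isFan {Λ : Fin (n + 1) → Fin n → ℤ} (h : SimplexSystem (fun i => lat (Λ i)) q) :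
    IsFan (simplexFan fun i => lat (Λ i)) where
  finite := by
    refine (Set.finite_range fun I : Set (Fin (n + 1)) =>
      cone ((fun i => lat (Λ i)) '' I)).subset ?_
    rintro _ ⟨I, -, rfl⟩
    exact ⟨I, rfl⟩
  rational := by
    rintro _ ⟨I, -, rfl⟩
    exact ⟨Λ '' I, Set.toFinite _, by rw [Set.image_image]⟩
  pointed := by
    rintro _ ⟨I, hI, rfl⟩ v hv hv'
    obtain ⟨c, a1, a2, rfl⟩ := (mem_cone_image _ _ _).1 hv
    obtain ⟨d, b1, b2, e⟩ := (mem_cone_image _ _ _).1 hv'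
    obtain ⟨i, hi⟩ := (Set.ne_univ_iff_exists_notMem I).1 hI
    have := h.coords_unique (c := c + d) (d := 0) (fun k => add_nonneg (a1 k) (b1 k))
      (fun k => le_rfl) (i := i) (j := i) (by simp [a2 i hi, b2 i hi]) rfl
      (by simp [add_smul, Finset.sum_add_distrib, ← e])
    have hc : c = 0 := by
      ext k
      have h1 := congrFun this k
      have h2 := a1 k
      have h3 := b1 k
      simp only [Pi.add_apply, Pi.zero_apply] at *
      linarith
    simp [hc]
  face_mem := by
    rintro _ ⟨I, hI, rfl⟩ τ hτ
    obtain ⟨J, hJ, rfl⟩ := (h.isFace_cone_iff hI).1 hτ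
    exact ⟨J, fun hc => hI (Set.univ_subset_iff.1 (hc ▸ hJ)), rfl⟩
  inter_face := by
    rintro _ ⟨I, hI, rfl⟩ _ ⟨J, hJ, rfl⟩
    rw [h.cone_inter hI hJ]
    exact ⟨(h.isFace_cone_iff hI).2 ⟨_, Set.inter_subset_left, rfl⟩,
      (h.isFace_cone_iff hJ).2 ⟨_, Set.inter_subset_right, rfl⟩⟩

theorem linearIndepOn (h : SimplexSystem w q) {I : Set (Fin (n + 1))} (hI : I ≠ Set.univ) :
    LinearIndepOn ℝ w I := by
  classical
  obtain ⟨i, hi⟩ := (Set.ne_univ_iff_exists_notMem I).1 hI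
  rw [linearIndepOn_iff'']
  intro s g hs h0 hg
  obtain ⟨t, ht⟩ := h.unique g (by
    rw [← hg]
    exact (Finset.sum_subset (Finset.subset_univ s) fun k _ hk => by simp [h0 k hk]).symm)
  have hi0 := ht i
  rw [h0 i fun hc => hi (hs hc)] at hi0
  have t0 : t = 0 := by simpa [(h.pos i).ne'] using hi0.symm
  intro k _
  rw [ht k, t0, zero_mul]

theorem isSimplicialFan {Λ : Fin (n + 1) → Fin n → ℤ} (h : SimplexSystem (fun i => lat (Λ i)) q) :
    IsSimplicialFan (simplexFan fun i => lat (Λ i)) := by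
  rintro _ ⟨I, hI, rfl⟩
  refine ⟨Λ '' I, ?_, by rw [Set.image_image]⟩
  exact (h.linearIndepOn hI).image_of_comp Λ lat

theorem rays_simplexFan {Λ : Fin (n + 1) → Fin n → ℤ} (hn : 0 < n) (hp : ∀ i, IsPrimitive (Λ i)) :
    rays (simplexFan fun i => lat (Λ i)) = Set.range Λ := by
  ext v
  constructor
  · rintro ⟨hv, I, hI, e⟩
    have hv0 : lat v ≠ 0 := fun hc => hv.ne_zero (lat_injective (hc.trans lat_zero.symm))
    obtain ⟨i, hi⟩ : I.Nonempty := by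
      by_contra hc
      rw [Set.not_nonempty_iff_eq_empty] at hc
      rw [hc, Set.image_empty, cone_empty] at e
      have : lat v ∈ cone {lat v} := subset_cone _ rfl
      rw [e] at this
      exact hv0 this
    have : lat (Λ i) ∈ cone {lat v} := e ▸ subset_cone _ ⟨i, hi, rfl⟩
    obtain ⟨r, hr, hr'⟩ := mem_cone_singleton.1 this
    exact ⟨i, (hp i).eq_of_smul hv hr hr'⟩
  · rintro ⟨i, rfl⟩
    exact ⟨hp i, {i}, singleton_ne_univ hn i, by rw [Set.image_singleton]⟩

theorem injective (h : SimplexSystem w q) (hn : 0 < n) : Function.Injective w := by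
  intro i j hij
  have := h.mem_of_mem_cone hn (singleton_ne_univ hn j) (k := i) (by
    rw [hij]; exact subset_cone _ ⟨j, rfl, rfl⟩)
  exact this

end SimplexSystem

/-! ### The fan over a simplex -/

/-- A point of the convex hull of a subfamily is a convex combination supported on it. -/
theorem mem_convexHull_image {n : ℕ} {ι : Type*} [Fintype ι] (p : ι → Fin n → ℝ) (J : Set ι)
    (x : Fin n → ℝ) :
    x ∈ convexHull ℝ (p '' J) ↔ ∃ c : ι → ℝ, (∀ i, 0 ≤ c i) ∧ (∀ i, i ∉ J → c i = 0) ∧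
      ∑ i, c i = 1 ∧ x = ∑ i, c i • p i := by
  classical
  constructor
  · intro hx
    refine convexHull_min (t := {x | ∃ c : ι → ℝ, (∀ i, 0 ≤ c i) ∧ (∀ i, i ∉ J → c i = 0) ∧
      ∑ i, c i = 1 ∧ x = ∑ i, c i • p i}) ?_ ?_ hx
    · rintro _ ⟨i, hi, rfl⟩
      refine ⟨Pi.single i 1, fun j => ?_, fun j hj => ?_, by simp, by simp [Pi.single_apply]⟩
      · by_cases h : j = i <;> simp [h]
      · have : j ≠ i := fun h => hj (h ▸ hi)
        simp [this]
    · rintro _ ⟨c, a1, a2, a3, rfl⟩ _ ⟨d, b1, b2, b3, rfl⟩ s t hs ht hst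
      refine ⟨s • c + t • d, fun i => ?_, fun i hi => by simp [a2 i hi, b2 i hi], ?_, ?_⟩
      · exact add_nonneg (mul_nonneg hs (a1 i)) (mul_nonneg ht (b1 i))
      · simp [Finset.sum_add_distrib, ← Finset.mul_sum, a3, b3, hst]
      · simp [Finset.sum_add_distrib, add_smul, Finset.smul_sum, smul_smul]
  · rintro ⟨c, a1, a2, a3, rfl⟩
    have h1 : ∑ i, c i • p i = ∑ i ∈ Finset.univ.filter (· ∈ J), c i • p i := by
      refine (Finset.sum_subset (Finset.filter_subset _ _) fun i _ hi => ?_).symm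
      simp only [Finset.mem_filter, Finset.mem_univ, true_and] at hi
      simp [a2 i hi]
    have h2 : ∑ i ∈ Finset.univ.filter (· ∈ J), c i = 1 := by
      rw [← a3]
      refine Finset.sum_subset (Finset.filter_subset _ _) fun i _ hi => ?_
      simp only [Finset.mem_filter, Finset.mem_univ, true_and] at hi
      simp [a2 i hi]
    rw [h1]
    refine (convex_convexHull ℝ _).sum_mem (fun i _ => a1 i) h2 fun i hi => ?_
    exact subset_convexHull ℝ _ ⟨i, by simpa using hi, rfl⟩

theorem cone_image_smul {n : ℕ} {ι : Type*} [Fintype ι] (w : ι → Fin n → ℝ) {c : ι → ℝ}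
    (hc : ∀ i, 0 < c i) (I : Set ι) : cone ((fun i => c i • w i) '' I) = cone (w '' I) := by
  ext v
  simp only [mem_cone_image]
  constructor
  · rintro ⟨d, h1, h2, rfl⟩
    exact ⟨fun i => d i * c i, fun i => mul_nonneg (h1 i) (hc i).le, fun i hi => by simp [h2 i hi],
      by simp [smul_smul]⟩
  · rintro ⟨d, h1, h2, rfl⟩
    refine ⟨fun i => d i / c i, fun i => div_nonneg (h1 i) (hc i).le,
      fun i hi => by simp [h2 i hi], Finset.sum_congr rfl fun i _ => ?_⟩
    rw [smul_smul, div_mul_cancel₀ _ (hc i).ne']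

theorem simplexFan_smul {n : ℕ} (w : Fin (n + 1) → Fin n → ℝ) {c : Fin (n + 1) → ℝ}
    (hc : ∀ i, 0 < c i) : simplexFan (fun i => c i • w i) = simplexFan w := by
  simp only [simplexFan, cone_image_smul w hc]

namespace SimplexSystem

variable {n : ℕ} {w p : Fin (n + 1) → Fin n → ℝ} {q : Fin (n + 1) → ℝ}

theorem smul (h : SimplexSystem w q) {c : Fin (n + 1) → ℝ} (hc : ∀ i, 0 < c i) :
    SimplexSystem (fun i => c i • w i) (fun i => q i / c i) where
  pos i := div_pos (h.pos i) (hc i)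
  rel := by
    rw [← h.rel]
    refine Finset.sum_congr rfl fun i _ => ?_
    rw [smul_smul, div_mul_cancel₀ _ (hc i).ne']
  unique d hd := by
    obtain ⟨t, ht⟩ := h.unique (fun i => d i * c i) (by simpa [smul_smul] using hd)
    refine ⟨t, fun i => ?_⟩
    have := (hc i).ne'
    field_simp
    exact ht i

theorem exists_affine_coords (h : SimplexSystem p q) (x : Fin n → ℝ) :
    ∃ c : Fin (n + 1) → ℝ, ∑ i, c i = 1 ∧ x = ∑ i, c i • p i := by
  obtain ⟨c, hc⟩ := h.exists_coords x
  have hQ : 0 < ∑ i, q i := Finset.sum_pos (fun i _ => h.pos i) Finset.univ_nonempty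
  refine ⟨fun i => c i + (1 - ∑ i, c i) / (∑ i, q i) * q i, ?_, ?_⟩
  · rw [Finset.sum_add_distrib, ← Finset.mul_sum, div_mul_cancel₀ _ hQ.ne']
    ring
  · simp only [add_smul, Finset.sum_add_distrib, mul_smul, ← Finset.smul_sum, h.rel, smul_zero,
      add_zero, hc]

/-- The simplex is cut out by the functionals that take the value `-1` on its facets. -/
theorem mem_convexHull_iff (h : SimplexSystem p q) {u : Fin (n + 1) → Fin n → ℝ}
    (hu : ∀ i k, k ≠ i → dotProduct (u i) (p k) = -1) (x : Fin n → ℝ) :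
    x ∈ convexHull ℝ (Set.range p) ↔ ∀ i, -1 ≤ dotProduct (u i) x := by
  have hQ : 0 < ∑ i, q i := Finset.sum_pos (fun i _ => h.pos i) Finset.univ_nonempty
  have hii : ∀ i, q i * dotProduct (u i) (p i) = (∑ k, q k) - q i := by
    intro i
    have h1 := congrArg (dotProduct (u i)) h.rel
    rw [dotProduct_sum, dotProduct_zero, ← Finset.add_sum_erase _ _ (Finset.mem_univ i),
      dotProduct_smul, smul_eq_mul] at h1
    rw [← Finset.add_sum_erase _ _ (Finset.mem_univ i)]
    have : ∑ k ∈ Finset.univ.erase i, dotProduct (u i) (q k • p k) =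
        ∑ k ∈ Finset.univ.erase i, -q k := Finset.sum_congr rfl fun k hk => by
      rw [dotProduct_smul, hu i k (Finset.ne_of_mem_erase hk)]; simp
    rw [this, Finset.sum_neg_distrib] at h1
    linarith
  have key : ∀ c : Fin (n + 1) → ℝ, ∑ i, c i = 1 → ∀ i,
      dotProduct (u i) (∑ k, c k • p k) = -1 + c i * ((∑ k, q k) / q i) := by
    intro c hc i
    rw [dotProduct_sum, ← Finset.add_sum_erase _ _ (Finset.mem_univ i)]
    have : ∑ k ∈ Finset.univ.erase i, dotProduct (u i) (c k • p k) =
        ∑ k ∈ Finset.univ.erase i, -c k := Finset.sum_congr rfl fun k hk => by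
      rw [dotProduct_smul, hu i k (Finset.ne_of_mem_erase hk)]; simp
    rw [this, Finset.sum_neg_distrib, dotProduct_smul, smul_eq_mul]
    rw [← Finset.add_sum_erase _ _ (Finset.mem_univ i)] at hc
    have h2 : dotProduct (u i) (p i) = (∑ k, q k) / q i - 1 := by
      have := (h.pos i).ne'
      field_simp
      linarith [hii i]
    rw [h2]
    linear_combination -hc
  rw [← Set.image_univ, mem_convexHull_image]
  constructor
  · rintro ⟨c, h1, -, h2, rfl⟩ i
    rw [key c h2]
    have := mul_nonneg (h1 i) (div_pos hQ (h.pos i)).le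
    linarith
  · intro hx
    obtain ⟨c, h1, rfl⟩ := h.exists_affine_coords x
    refine ⟨c, fun i => ?_, by simp, h1, rfl⟩
    have := hx i
    rw [key c h1] at this
    exact nonneg_of_mul_nonneg_left (by linarith) (div_pos hQ (h.pos i))

/-- Normals of the facets of the simplex. -/
theorem exists_facet_functional (h : SimplexSystem p q) :
    ∃ u : Fin (n + 1) → Fin n → ℝ, ∀ i k, k ≠ i → dotProduct (u i) (p k) = -1 := by
  choose u hu using fun i => h.exists_dual_of_ne i (fun _ => -1)
  exact ⟨u, hu⟩

theorem zero_mem_interior (h : SimplexSystem p q) :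
    (0 : Fin n → ℝ) ∈ interior (convexHull ℝ (Set.range p)) := by
  obtain ⟨u, hu⟩ := h.exists_facet_functional
  rw [mem_interior]
  refine ⟨⋂ i, {x | -1 < dotProduct (u i) x}, ?_, ?_, ?_⟩
  · intro x hx
    rw [h.mem_convexHull_iff hu]
    exact fun i => (Set.mem_iInter.1 hx i).le
  · refine isOpen_iInter_of_finite fun i => ?_
    exact isOpen_lt continuous_const (continuous_const.dotProduct continuous_id)
  · simp

theorem affineIndependent (h : SimplexSystem p q) : AffineIndependent ℝ p := by
  rw [affineIndependent_iff]
  intro s e h0 h1 i hi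
  classical
  have hQ : 0 < ∑ i, q i := Finset.sum_pos (fun i _ => h.pos i) Finset.univ_nonempty
  obtain ⟨t, ht⟩ := h.unique (fun i => if i ∈ s then e i else 0) (by
    rw [← h1]; simp)
  have h2 : ∑ i, (if i ∈ s then e i else 0) = 0 := by
    rw [Finset.sum_ite_mem, Finset.univ_inter, h0]
  simp only [ht, ← Finset.mul_sum] at h2
  have t0 : t = 0 := by simpa [hQ.ne'] using h2
  have := ht i
  rwa [if_pos hi, t0, zero_mul] at this

theorem finrank_vectorSpan_face (h : SimplexSystem p q) {J : Set (Fin (n + 1))}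
    (hJ : J.Nonempty) :
    Module.finrank ℝ (vectorSpan ℝ (convexHull ℝ (p '' J))) + 1 = J.ncard := by
  classical
  rw [← direction_affineSpan, affineSpan_convexHull, direction_affineSpan, Set.image_eq_range]
  have h1 := h.affineIndependent.subtype (s := J)
  have hpos : 0 < Fintype.card J := Fintype.card_pos_iff.2 hJ.to_subtype
  have h2 := AffineIndependent.finrank_vectorSpan h1 (n := Fintype.card J - 1) (by omega)
  rw [← Nat.card_coe_set_eq, Nat.card_eq_fintype_card]
  have h3 : (Set.range fun x : J => p x) = Set.range (p ∘ Subtype.val) := rfl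
  have h4 : Module.finrank ℝ (vectorSpan ℝ (Set.range fun x : J => p x)) = Fintype.card J - 1 :=
    h2
  omega

theorem cone_over_face (J : Set (Fin (n + 1))) (hJ : J.Nonempty) :
    {x | ∃ m ∈ convexHull ℝ (p '' J), ∃ r : ℝ, 0 ≤ r ∧ x = r • m} = cone (p '' J) := by
  ext x
  simp only [Set.mem_ofPred_eq, mem_convexHull_image, mem_cone_image]
  constructor
  · rintro ⟨_, ⟨c, h1, h2, h3, rfl⟩, r, hr, rfl⟩
    exact ⟨fun i => r * c i, fun i => mul_nonneg hr (h1 i), fun i hi => by simp [h2 i hi],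
      by simp [Finset.smul_sum, smul_smul]⟩
  · rintro ⟨c, h1, h2, rfl⟩
    by_cases h0 : ∑ i, c i = 0
    · rw [Finset.sum_eq_zero_iff_of_nonneg fun i _ => h1 i] at h0
      obtain ⟨j, hj⟩ := hJ
      refine ⟨p j, ⟨Pi.single j 1, fun i => ?_, fun i hi => ?_, by simp,
        by simp [Pi.single_apply]⟩, 0, le_rfl, ?_⟩
      · by_cases h : i = j <;> simp [h]
      · have : i ≠ j := fun h => hi (h ▸ hj)
        simp [this]
      · simp [h0]
    · have hs : 0 < ∑ i, c i := lt_of_le_of_ne (Finset.sum_nonneg fun i _ => h1 i) (Ne.symm h0)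
      refine ⟨∑ i, (c i / ∑ i, c i) • p i, ⟨_, fun i => div_nonneg (h1 i) hs.le,
        fun i hi => by simp [h2 i hi], by rw [← Finset.sum_div, div_self h0], rfl⟩,
        ∑ i, c i, hs.le, ?_⟩
      simp [Finset.smul_sum, smul_smul, mul_div_cancel₀ _ h0]

/-- The facets of the simplex are the hulls of the families that omit one vertex, so the fan over its
faces consists of the cones over the proper subsets of the vertices. -/
theorem fanOver_convexHull (hn : 0 < n) (h : SimplexSystem p q) :
    fanOver (convexHull ℝ (Set.range p)) = simplexFan p := by
  have hcard : ∀ i : Fin (n + 1), (({i} : Set (Fin (n + 1)))ᶜ).ncard = n := by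
    intro i
    rw [Set.ncard_compl, Nat.card_eq_fintype_card, Fintype.card_fin, Set.ncard_singleton]
    omega
  have hne : ∀ i : Fin (n + 1), (({i} : Set (Fin (n + 1)))ᶜ).Nonempty := fun i => by
    rw [← Set.ncard_pos, hcard]; exact hn
  ext τ
  constructor
  · rintro ⟨Φ, ⟨h1, ⟨u, c, h2, rfl⟩, h3⟩, -, h4⟩
    set J : Set (Fin (n + 1)) := {i | dotProduct u (p i) = c} with hJ
    have hle : ∀ i, c ≤ dotProduct u (p i) := fun i => h2 _ (subset_convexHull ℝ _ ⟨i, rfl⟩)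
    have hΦ : {m ∈ convexHull ℝ (Set.range p) | dotProduct u m = c} = convexHull ℝ (p '' J) := by
      ext x
      rw [← Set.image_univ]
      simp only [mem_convexHull_image]
      constructor
      · rintro ⟨⟨d, a1, -, a3, rfl⟩, e⟩
        refine ⟨d, a1, fun i hi => ?_, a3, rfl⟩
        have e' : ∑ i, d i * (dotProduct u (p i) - c) = 0 := by
          simp only [mul_sub, Finset.sum_sub_distrib, ← Finset.sum_mul, a3]
          rw [dotProduct_sum] at e
          simp only [dotProduct_smul, smul_eq_mul] at e
          rw [e]; ring
        rw [Finset.sum_eq_zero_iff_of_nonneg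
          (fun i _ => mul_nonneg (a1 i) (sub_nonneg.2 (hle i)))] at e'
        have := e' i (Finset.mem_univ i)
        rw [mul_eq_zero, sub_eq_zero] at this
        exact this.resolve_right hi
      · rintro ⟨d, a1, a2, a3, rfl⟩
        refine ⟨⟨d, a1, by simp, a3, rfl⟩, ?_⟩
        have : ∀ i, d i * dotProduct u (p i) = d i * c := fun i => by
          by_cases hi : i ∈ J
          · rw [hi]
          · simp [a2 i hi]
        simp only [dotProduct_sum, dotProduct_smul, smul_eq_mul, this, ← Finset.sum_mul, a3,
          one_mul]
    rw [hΦ] at h1 h3 h4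
    have hJn : J.Nonempty := by
      rw [convexHull_nonempty_iff] at h1
      exact Set.image_nonempty.1 h1
    rw [h.finrank_vectorSpan_face hJn] at h3
    have hJ' : J ≠ Set.univ := by
      intro hc
      rw [hc, Set.ncard_univ, Nat.card_eq_fintype_card, Fintype.card_fin] at h3
      omega
    rw [cone_over_face J hJn, h.isFace_cone_iff hJ'] at h4
    obtain ⟨I, hI, rfl⟩ := h4
    exact ⟨I, fun hc => hJ' (Set.univ_subset_iff.1 (hc ▸ hI)), rfl⟩
  · rintro ⟨I, hI, rfl⟩
    obtain ⟨i, hi⟩ := (Set.ne_univ_iff_exists_notMem I).1 hI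
    obtain ⟨u, hu⟩ := h.exists_facet_functional
    have hle : ∀ m ∈ convexHull ℝ (Set.range p), -1 ≤ dotProduct (u i) m :=
      fun m hm => (h.mem_convexHull_iff hu m).1 hm i
    have hcon : ∀ m ∈ convexHull ℝ (p '' {i}ᶜ), dotProduct (u i) m = -1 := by
      intro m hm
      obtain ⟨d, a1, a2, a3, rfl⟩ := (mem_convexHull_image _ _ _).1 hm
      have : ∀ k, d k * dotProduct (u i) (p k) = d k * -1 := fun k => by
        by_cases hk : k = i
        · rw [a2 k (by simpa using hk)]; simp
        · rw [hu i k hk]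
      simp only [dotProduct_sum, dotProduct_smul, smul_eq_mul, this, ← Finset.sum_mul, a3, one_mul]
    have hQ : 0 < ∑ i, q i := Finset.sum_pos (fun i _ => h.pos i) Finset.univ_nonempty
    refine ⟨convexHull ℝ (p '' {i}ᶜ), ⟨(convexHull_nonempty_iff).2 ((hne i).image p),
      ⟨u i, -1, hle, ?_⟩, ?_⟩, ?_, ?_⟩
    · apply Set.Subset.antisymm
      · exact fun m hm => ⟨convexHull_mono (Set.image_subset_range _ _) hm, hcon m hm⟩
      · rintro m ⟨hm, e⟩
        rw [← Set.image_univ] at hm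
        obtain ⟨d, a1, -, a3, rfl⟩ := (mem_convexHull_image _ _ _).1 hm
        refine (mem_convexHull_image _ _ _).2 ⟨d, a1, fun k hk => ?_, a3, rfl⟩
        have hki : k = i := by simpa using hk
        subst hki
        -- the functional takes a value above `-1` at the opposite vertex
        have hk1 : -1 < dotProduct (u k) (p k) := by
          have h1 := congrArg (dotProduct (u k)) h.rel
          rw [dotProduct_sum, dotProduct_zero] at h1
          by_contra! hc
          have : ∑ j, dotProduct (u k) (q j • p j) < 0 := by
            refine Finset.sum_neg (fun j _ => ?_) Finset.univ_nonempty
            rw [dotProduct_smul, smul_eq_mul]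
            refine mul_neg_of_pos_of_neg (h.pos j) ?_
            by_cases hj : j = k
            · rw [hj]; linarith
            · rw [hu k j hj]; norm_num
          linarith
        have e' : ∑ j, d j * (dotProduct (u k) (p j) + 1) = 0 := by
          simp only [mul_add, Finset.sum_add_distrib, mul_one, a3]
          simp only [dotProduct_sum, dotProduct_smul, smul_eq_mul] at e
          rw [e]; ring
        rw [Finset.sum_eq_zero_iff_of_nonneg (fun j _ => mul_nonneg (a1 j) (by
          have := hle _ (subset_convexHull ℝ _ ⟨j, rfl⟩)
          linarith))] at e'
        have := e' k (Finset.mem_univ k)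
        rw [mul_eq_zero] at this
        exact this.resolve_right (by linarith)
    · rw [h.finrank_vectorSpan_face (hne i), hcard]
    · intro hc
      have := hcon 0 (intrinsicInterior_subset hc)
      simp at this
    · rw [cone_over_face _ (hne i), h.isFace_cone_iff (by simp)]
      exact ⟨I, fun k hk hc => hi (by rw [Set.mem_singleton_iff] at hc; exact hc ▸ hk), rfl⟩

end SimplexSystem

/-! ### Prime divisors of simplicial toric varieties are distinct -/

/-- Clearing denominators. -/
theorem exists_nat_mul_eq_intCast {n : ℕ} (f : Fin n → ℚ) :
    ∃ (D : ℕ) (z : Fin n → ℤ), 0 < D ∧ ∀ i, (z i : ℚ) = D * f i := by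
  refine ⟨∏ i, (f i).den, fun i => (∏ j ∈ Finset.univ.erase i, ((f j).den : ℤ)) * (f i).num,
    Finset.prod_pos fun i _ => (f i).den_pos, fun i => ?_⟩
  rw [← Finset.mul_prod_erase _ _ (Finset.mem_univ i)]
  push_cast
  have h1 : ((f i).den : ℚ) * f i = (f i).num := by
    rw [mul_comm]; exact Rat.mul_den_eq_num (f i)
  rw [mul_right_comm, h1, mul_comm]

/-- Linearly independent lattice vectors are separated by lattice functionals. -/
theorem exists_lattice_functional {n : ℕ} {S : Set (Fin n → ℤ)}
    (hS : LinearIndependent ℝ (fun v : S => lat v.1)) (S₀ : Set (Fin n → ℤ)) :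
    ∃ u : Fin n → ℤ, ∀ s ∈ S, (s ∈ S₀ → dotProduct u s = 0) ∧ (s ∉ S₀ → 0 < dotProduct u s) := by
  classical
  let r : S → Fin n → ℚ := fun s i => (s.1 i : ℚ)
  let castL : (Fin n → ℚ) →ₗ[ℚ] (Fin n → ℝ) :=
    LinearMap.pi fun i => (Algebra.linearMap ℚ ℝ).comp (LinearMap.proj i)
  have hr : LinearIndependent ℚ r := by
    have h1 : LinearIndependent ℚ (fun v : S => lat v.1) := by
      refine LinearIndependent.restrict_scalars (fun x y h => ?_) hS
      simpa [Rat.smul_def] using h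
    refine LinearIndependent.of_comp castL ?_
    convert h1 using 1
    funext s i
    simp [castL, r, lat]
  obtain ⟨φ, hφ⟩ := LinearMap.exists_extend
    ((Module.Basis.span hr).constr ℚ (fun s : S => if s.1 ∈ S₀ then (0 : ℚ) else 1))
  have hφs : ∀ s : S, φ (r s) = if s.1 ∈ S₀ then (0 : ℚ) else 1 := by
    intro s
    have h1 := LinearMap.congr_fun hφ (Module.Basis.span hr s)
    rw [Module.Basis.constr_basis, LinearMap.comp_apply, Submodule.subtype_apply,
      Module.Basis.span_apply] at h1
    exact h1
  obtain ⟨D, z, hD, hz⟩ := exists_nat_mul_eq_intCast fun i => φ (Pi.single i 1)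
  have hzs : ∀ s : S, ((dotProduct z s.1 : ℤ) : ℚ) = D * φ (r s) := by
    intro s
    have h1 : r s = ∑ i, (s.1 i : ℚ) • (Pi.single i (1 : ℚ) : Fin n → ℚ) := by
      funext j
      simp [r, Pi.single_apply]
    rw [h1, map_sum, Finset.mul_sum]
    simp only [dotProduct, Int.cast_sum, Int.cast_mul, hz, map_smul, smul_eq_mul]
    exact Finset.sum_congr rfl fun i _ => by ring
  refine ⟨z, fun s hs => ⟨fun h => ?_, fun h => ?_⟩⟩
  · have := hzs ⟨s, hs⟩
    rw [hφs, if_pos h, mul_zero] at this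
    exact_mod_cast this
  · have := hzs ⟨s, hs⟩
    rw [hφs, if_neg h, mul_one] at this
    have h2 : (0 : ℚ) < (dotProduct z s : ℤ) := by rw [this]; exact_mod_cast hD
    exact_mod_cast h2

theorem cone_eq_image_univ {n : ℕ} (S : Set (Fin n → ℤ)) :
    cone (lat '' S) = cone ((fun s : S => lat s.1) '' Set.univ) := by
  rw [Set.image_univ, Set.image_eq_range]

theorem finite_of_linearIndependent_lat {n : ℕ} {S : Set (Fin n → ℤ)}
    (hS : LinearIndependent ℝ (fun v : S => lat v.1)) : Finite S := hS.finite

theorem mem_dualMonoid_cone {n : ℕ} {S : Set (Fin n → ℤ)} {u : Fin n → ℤ} :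
    u ∈ dualMonoid (cone (lat '' S)) ↔ ∀ s ∈ S, 0 ≤ dotProduct u s := by
  constructor
  · intro h s hs
    have := h (lat s) (subset_cone _ ⟨s, hs, rfl⟩)
    rw [lat_dotProduct] at this
    exact_mod_cast this
  · intro h v hv
    refine Submodule.span_induction (p := fun v _ => 0 ≤ dotProduct (lat u) v) ?_ ?_ ?_ ?_ hv
    · rintro _ ⟨s, hs, rfl⟩
      rw [lat_dotProduct]
      exact_mod_cast h s hs
    · simp
    · intro x y _ _ hx hy
      rw [dotProduct_add]
      exact add_nonneg hx hy
    · intro a x _ hx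
      rw [NNReal.smul_def, dotProduct_smul]
      exact mul_nonneg a.2 hx

/-- A face of a simplicial cone is cut out by a lattice functional `u₀`, and the dual monoid of the
face is the localization of that of the cone at `u₀`. -/
theorem exists_lattice_face {n : ℕ} {S : Set (Fin n → ℤ)}
    (hS : LinearIndependent ℝ (fun v : S => lat v.1)) {τ : Set (Fin n → ℝ)}
    (hτ : IsFace τ (cone (lat '' S))) :
    ∃ u₀ : Fin n → ℤ, u₀ ∈ dualMonoid (cone (lat '' S)) ∧
      τ = {v ∈ cone (lat '' S) | dotProduct (lat u₀) v = 0} ∧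
      ∀ u ∈ dualMonoid τ, ∃ k : ℕ, u + k • u₀ ∈ dualMonoid (cone (lat '' S)) := by
  classical
  obtain ⟨u, hu, rfl⟩ := hτ
  have := finite_of_linearIndependent_lat hS
  have := Fintype.ofFinite S
  obtain ⟨u₀, h0⟩ := exists_lattice_functional hS {s | dotProduct u (lat s) = 0}
  have hus : ∀ s ∈ S, 0 ≤ dotProduct u (lat s) := fun s hs => hu _ (subset_cone _ ⟨s, hs, rfl⟩)
  have hnn : ∀ s ∈ S, 0 ≤ dotProduct u₀ s := fun s hs => by
    by_cases h : dotProduct u (lat s) = 0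
    · rw [(h0 s hs).1 h]
    · exact ((h0 s hs).2 h).le
  refine ⟨u₀, mem_dualMonoid_cone.2 hnn, ?_, ?_⟩
  · ext v
    refine and_congr_right fun hv => ?_
    rw [cone_eq_image_univ] at hv
    obtain ⟨c, h1, -, rfl⟩ := (mem_cone_image _ _ _).1 hv
    simp only [dotProduct_sum, dotProduct_smul, smul_eq_mul, lat_dotProduct]
    rw [Finset.sum_eq_zero_iff_of_nonneg fun s _ => mul_nonneg (h1 s) (hus s.1 s.2),
      Finset.sum_eq_zero_iff_of_nonneg fun s _ => mul_nonneg (h1 s)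
        (by exact_mod_cast hnn s.1 s.2)]
    refine forall₂_congr fun s _ => ?_
    rw [mul_eq_zero, mul_eq_zero]
    refine or_congr_right ?_
    rw [Int.cast_eq_zero]
    constructor
    · exact fun h => (h0 s.1 s.2).1 h
    · intro h
      by_contra hc
      exact absurd h ((h0 s.1 s.2).2 hc).ne'
  · intro v hv
    refine ⟨∑ s : S, (dotProduct v s.1).natAbs, mem_dualMonoid_cone.2 fun s hs => ?_⟩
    rw [add_dotProduct, smul_dotProduct, nsmul_eq_mul]
    by_cases h : dotProduct u (lat s) = 0
    · rw [(h0 s hs).1 h, mul_zero, add_zero]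
      have := hv (lat s) ⟨subset_cone _ ⟨s, hs, rfl⟩, h⟩
      rw [lat_dotProduct] at this
      exact_mod_cast this
    · have h1 := (h0 s hs).2 h
      have h2 : (dotProduct v s).natAbs ≤ ∑ s : S, (dotProduct v s.1).natAbs :=
        Finset.single_le_sum (f := fun s : S => (dotProduct v s.1).natAbs)
          (fun _ _ => Nat.zero_le _) (Finset.mem_univ (⟨s, hs⟩ : S))
      have h3 : -dotProduct v s ≤ ((∑ s : S, (dotProduct v s.1).natAbs : ℕ) : ℤ) := by omega
      nlinarith

namespace AffinePoints

variable {n : ℕ} {σ : Set (Fin n → ℝ)}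

theorem eval_zero (x : AffinePoints σ) : eval 0 x = 1 :=
  (show Multiplicative (dualMonoid σ) →* ℂ from x).map_one

theorem eval_add (u v : dualMonoid σ) (x : AffinePoints σ) :
    eval (u + v) x = eval u x * eval v x :=
  (show Multiplicative (dualMonoid σ) →* ℂ from x).map_mul _ _

theorem eval_nsmul (k : ℕ) (u : dualMonoid σ) (x : AffinePoints σ) :
    eval (k • u) x = eval u x ^ k :=
  (show Multiplicative (dualMonoid σ) →* ℂ from x).map_pow _ _

theorem eval_sum {ι : Type*} (s : Finset ι) (u : ι → dualMonoid σ) (x : AffinePoints σ) :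
    eval (∑ i ∈ s, u i) x = ∏ i ∈ s, eval (u i) x := by
  classical
  induction s using Finset.induction_on with
  | empty => simp [eval_zero]
  | insert a s ha ih => rw [Finset.sum_insert ha, Finset.prod_insert ha, eval_add, ih]

theorem ext {x y : AffinePoints σ} (h : ∀ u, eval u x = eval u y) : x = y :=
  MonoidHom.ext fun u => h (Multiplicative.toAdd u)

theorem eval_torusAct (u : dualMonoid σ) (t : Torus n) (x : AffinePoints σ) :
    eval u (torusAct t x) = ((∏ i, t i ^ (u.1 i) : ℂˣ) : ℂ) * eval u x := rfl

theorem eval_torusAffine (u : dualMonoid σ) (t : Torus n) :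
    eval u (torusAffine σ t) = ((∏ i, t i ^ (u.1 i) : ℂˣ) : ℂ) := rfl

open Classical in
theorem eval_characteristicPoint (u : dualMonoid σ) :
    eval u (characteristicPoint σ) = if ∀ v ∈ σ, dotProduct (lat u.1) v = 0 then 1 else 0 := rfl

theorem isOpen_eval_ne_zero (u : dualMonoid σ) : IsOpen {x : AffinePoints σ | eval u x ≠ 0} :=
  TopologicalSpace.isOpen_generateFrom_of_mem
    ⟨eval u, Algebra.subset_adjoin ⟨u, rfl⟩, rfl⟩

end AffinePoints

theorem ToricVariety.isOpen_iff {n : ℕ} {F : Set (Set (Fin n → ℝ))} {W : Set (ToricVariety F)} :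
    IsOpen W ↔ ∀ σ : F, IsOpen (ToricVariety.chart σ ⁻¹' W) := by
  refine isOpen_iSup_iff.trans ?_
  rfl

/-- The condition on a point of a chart to lie on the divisor of the ray through `w`: all characters
that are positive on `w` vanish there. -/
def OnDivisor {n : ℕ} {F : Set (Set (Fin n → ℝ))} (w : Fin n → ℤ)
    (p : (σ : F) × AffinePoints σ.1) : Prop :=
  lat w ∈ p.1.1 ∧ ∀ u : dualMonoid p.1.1, 0 < dotProduct u.1 w → p.2.eval u = 0

theorem onDivisor_iff_of_patch {n : ℕ} {F : Set (Set (Fin n → ℝ))} (hF : IsSimplicialFan F)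
    (w : Fin n → ℤ) {p p' : (σ : F) × AffinePoints σ.1} (h : Patch F p p') :
    OnDivisor w p ↔ OnDivisor w p' := by
  obtain ⟨⟨τ, hτ⟩, x⟩ := p
  obtain ⟨⟨σ, hσ⟩, y⟩ := p'
  obtain ⟨h1, h2⟩ := h
  simp only at h1 h2
  have hsub : τ ⊆ σ := by
    obtain ⟨u, -, rfl⟩ := h1
    exact fun v hv => hv.1
  have hdual : ∀ u ∈ dualMonoid σ, u ∈ dualMonoid τ := fun u hu v hv => hu v (hsub hv)
  constructor
  · rintro ⟨a1, a2⟩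
    exact ⟨hsub a1, fun u hu => by rw [← h2 u.1 (hdual _ u.2) u.2]; exact a2 _ hu⟩
  · rintro ⟨a1, a2⟩
    simp only at a1 a2
    obtain ⟨S, hS, rfl⟩ := hF σ hσ
    obtain ⟨u₀, b1, b2, b3⟩ := exists_lattice_face hS h1
    have hneg : -u₀ ∈ dualMonoid τ := fun v hv => by
      rw [b2] at hv
      rw [lat_neg, neg_dotProduct, hv.2, neg_zero]
    have hx0 : x.eval ⟨u₀, hdual _ b1⟩ ≠ 0 := by
      intro hc
      have := AffinePoints.eval_add ⟨u₀, hdual _ b1⟩ ⟨-u₀, hneg⟩ x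
      rw [hc, zero_mul] at this
      have h0 : (⟨u₀, hdual _ b1⟩ + ⟨-u₀, hneg⟩ : dualMonoid τ) = 0 :=
        Subtype.ext (add_neg_cancel u₀)
      rw [h0, AffinePoints.eval_zero] at this
      exact one_ne_zero this
    have hw0 : dotProduct u₀ w = 0 := by
      by_contra hc
      have hnn : 0 ≤ dotProduct u₀ w := by
        have := b1 _ a1
        rw [lat_dotProduct] at this
        exact_mod_cast this
      exact hx0 ((h2 u₀ _ b1).trans (a2 ⟨u₀, b1⟩ (lt_of_le_of_ne hnn (Ne.symm hc))))
    refine ⟨show lat w ∈ τ by rw [b2]; exact ⟨a1, by rw [lat_dotProduct, hw0, Int.cast_zero]⟩,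
      fun u hu => ?_⟩
    obtain ⟨k, hk⟩ := b3 u.1 u.2
    have e1 : y.eval ⟨_, hk⟩ = 0 := a2 ⟨_, hk⟩ (by
      simp only [add_dotProduct, smul_dotProduct, hw0]; simpa using hu)
    rw [← h2 _ (hdual _ hk) hk] at e1
    have e2 : (⟨u.1 + k • u₀, hdual _ hk⟩ : dualMonoid τ) = u + k • ⟨u₀, hdual _ b1⟩ := rfl
    rw [e2, AffinePoints.eval_add, AffinePoints.eval_nsmul, mul_eq_zero] at e1
    exact e1.resolve_right (pow_ne_zero _ hx0)

/-- The primitive generator of a ray can be recovered from its prime divisor. -/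
theorem primeDivisor_injective {n : ℕ} {F : Set (Set (Fin n → ℝ))} (hF : IsSimplicialFan F) :
    Function.Injective (primeDivisor F) := by
  have hle : ∀ v w : rays F, primeDivisor F v = primeDivisor F w → lat w.1 ∈ cone {lat v.1} := by
    intro v w e
    let C : Set (ToricVariety F) :=
      {ξ | Quot.lift (OnDivisor w.1) (fun _ _ h => propext (onDivisor_iff_of_patch hF w.1 h)) ξ}
    have hC : IsClosed C := by
      rw [← isOpen_compl_iff, ToricVariety.isOpen_iff]
      intro σ
      have : ToricVariety.chart σ ⁻¹' Cᶜ = {x | lat w.1 ∉ σ.1} ∪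
          ⋃ u : {u : dualMonoid σ.1 // 0 < dotProduct u.1 w.1}, {x | AffinePoints.eval u.1 x ≠ 0} := by
        ext x
        have : x ∈ ToricVariety.chart σ ⁻¹' Cᶜ ↔ ¬ OnDivisor w.1 ⟨σ, x⟩ := Iff.rfl
        rw [this, OnDivisor]
        simp only [Set.mem_union, Set.mem_iUnion, Set.mem_ofPred_eq, Subtype.exists, not_and_or,
          not_forall, exists_prop]
      rw [this]
      exact isOpen_const.union (isOpen_iUnion fun u => AffinePoints.isOpen_eval_ne_zero _)
    have hsub : primeDivisor F w ⊆ C := by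
      refine closure_minimal ?_ hC
      rintro _ ⟨t, rfl⟩
      change OnDivisor w.1 ⟨_, _⟩
      refine ⟨subset_cone _ rfl, fun u hu => ?_⟩
      rw [AffinePoints.eval_torusAct, AffinePoints.eval_characteristicPoint, if_neg, mul_zero]
      intro hc
      have := hc (lat w.1) (subset_cone _ rfl)
      rw [lat_dotProduct] at this
      exact hu.ne' (by exact_mod_cast this)
    have h1 : ToricVariety.chart ⟨cone {lat v.1}, v.2.2⟩ (torusAct 1 (characteristicPoint _)) ∈ C :=
      hsub (e ▸ subset_closure ⟨1, rfl⟩)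
    exact (show OnDivisor w.1 ⟨_, _⟩ from h1).1
  intro v w e
  obtain ⟨r, hr, hr'⟩ := mem_cone_singleton.1 (hle v w e)
  exact Subtype.ext (w.2.1.eq_of_smul v.2.1 hr hr').symm

theorem finite_rays {n : ℕ} {F : Set (Set (Fin n → ℝ))} (hF : F.Finite) : (rays F).Finite := by
  refine Set.Finite.of_finite_image (f := fun v => cone {lat v})
    (hF.subset (by rintro _ ⟨v, hv, rfl⟩; exact hv.2)) ?_
  intro v hv w hw e
  have : lat v ∈ cone {lat w} := by
    have h : lat v ∈ cone {lat v} := subset_cone _ rfl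
    rwa [show cone {lat v} = cone {lat w} from e] at h
  obtain ⟨r, hr, hr'⟩ := mem_cone_singleton.1 this
  exact hv.1.eq_of_smul hw.1 hr hr'

theorem toricDivisor_eq_sum {n : ℕ} {F : Set (Set (Fin n → ℝ))} [Fintype (rays F)]
    (c : (Fin n → ℤ) → ℤ) :
    toricDivisor F c = ∑ v : rays F, Finsupp.single (primeDivisor F v) (c v.1) :=
  finsum_eq_sum_of_fintype _

/-- The coefficients of a divisor can be read off. -/
theorem toricDivisor_apply {n : ℕ} {F : Set (Set (Fin n → ℝ))} (hF : IsSimplicialFan F)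
    [Fintype (rays F)] (c : (Fin n → ℤ) → ℤ) (v : rays F) :
    toricDivisor F c (primeDivisor F v) = c v.1 := by
  classical
  rw [toricDivisor_eq_sum, Finsupp.finsetSum_apply, Finset.sum_eq_single v]
  · simp
  · intro w _ hw
    rw [Finsupp.single_apply, if_neg fun h => hw (primeDivisor_injective hF h)]
  · simp

theorem card_support_toricDivisor {n : ℕ} {F : Set (Set (Fin n → ℝ))} (hF : IsSimplicialFan F)
    [Fintype (rays F)] {c : (Fin n → ℤ) → ℤ} (hc : ∀ v ∈ rays F, c v ≠ 0) :
    (toricDivisor F c).support.card = Fintype.card (rays F) := by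
  classical
  have : (toricDivisor F c).support = Finset.univ.image (primeDivisor F) := by
    ext D
    simp only [Finsupp.mem_support_iff, Finset.mem_image, Finset.mem_univ, true_and]
    constructor
    · intro h
      by_contra! hne
      apply h
      rw [toricDivisor_eq_sum, Finsupp.finsetSum_apply]
      exact Finset.sum_eq_zero fun v _ => by rw [Finsupp.single_apply, if_neg (hne v)]
    · rintro ⟨v, rfl⟩
      rw [toricDivisor_apply hF]
      exact hc v.1 v.2
  rw [this, Finset.card_image_of_injective _ (primeDivisor_injective hF), Finset.card_univ]

theorem degree_toricDivisor {n : ℕ} {F : Set (Set (Fin n → ℝ))} [Fintype (rays F)]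
    (c : (Fin n → ℤ) → ℤ) :
    (toricDivisor F c).sum (fun _ m => m) = ∑ v : rays F, c v.1 := by
  classical
  rw [toricDivisor_eq_sum, ← Finsupp.sum_finsetSum_index]
  · simp
  · simp
  · simp

/-- Divisors that correspond under a bijection of the varieties have as many components, and the
same sum of coefficients. -/
theorem card_rays_eq_and_sum_coeff_eq {n : ℕ} {F F' : Set (Set (Fin n → ℝ))}
    (hF : IsSimplicialFan F) (hF' : IsSimplicialFan F') [Fintype (rays F)] [Fintype (rays F')]
    {c c' : (Fin n → ℤ) → ℤ} (hc : ∀ v ∈ rays F, c v ≠ 0) (hc' : ∀ v ∈ rays F', c' v ≠ 0)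
    (f : ToricVariety F ≃ ToricVariety F')
    (h : toricDivisor F c = (toricDivisor F' c').mapDomain (fun D => f ⁻¹' D)) :
    Fintype.card (rays F) = Fintype.card (rays F') ∧
      ∑ v : rays F, c v.1 = ∑ v : rays F', c' v.1 := by
  classical
  have hinj : Function.Injective (fun D : Set (ToricVariety F') => f ⁻¹' D) :=
    Set.preimage_injective.2 f.surjective
  constructor
  · rw [← card_support_toricDivisor hF hc, ← card_support_toricDivisor hF' hc', h,
      Finsupp.mapDomain_support_of_injective hinj, Finset.card_image_of_injective _ hinj]
  · rw [← degree_toricDivisor, ← degree_toricDivisor, h, Finsupp.sum_mapDomain_index]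
    · simp
    · simp

/-! ### Projective space -/

theorem projRay_castSucc {n : ℕ} (k : Fin n) : projRay k.castSucc = Pi.single k 1 := by
  simp [projRay]

theorem projRay_last {n : ℕ} : projRay (Fin.last n) = fun _ => -1 := by
  simp [projRay]

theorem lat_projRay_castSucc {n : ℕ} (k : Fin n) :
    lat (projRay k.castSucc) = Pi.single k 1 := by
  rw [projRay_castSucc]
  ext i
  by_cases h : i = k
  · subst h; simp [lat]
  · simp [lat, h]

theorem lat_projRay_last {n : ℕ} : lat (projRay (Fin.last n)) = fun _ => -1 := by
  rw [projRay_last]; ext i; simp [lat]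

theorem sum_projRay_smul {n : ℕ} (c : Fin (n + 1) → ℝ) :
    ∑ i, c i • lat (projRay i) = fun k : Fin n => c k.castSucc - c (Fin.last n) := by
  rw [Fin.sum_univ_castSucc]
  ext k
  simp [lat_projRay_castSucc, lat_projRay_last, Pi.single_apply, sub_eq_add_neg]

theorem simplexSystem_projRay {n : ℕ} :
    SimplexSystem (fun i : Fin (n + 1) => lat (projRay i)) (fun _ => 1) where
  pos _ := one_pos
  rel := by rw [sum_projRay_smul]; ext; simp
  unique c hc := by
    rw [sum_projRay_smul] at hc
    refine ⟨c (Fin.last n), fun i => ?_⟩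
    refine Fin.lastCases (by simp) (fun k => ?_) i
    have := congrFun hc k
    simp only [Pi.zero_apply] at this
    linarith

theorem isPrimitive_projRay {n : ℕ} (hn : 0 < n) (i : Fin (n + 1)) :
    IsPrimitive (projRay i) := by
  unfold IsPrimitive
  have key : ∀ (v : Fin n → ℤ) (k : Fin n), IsUnit (v k) → Finset.univ.gcd v = 1 := by
    intro v k hk
    have h1 : Finset.univ.gcd v ∣ v k := Finset.gcd_dvd (Finset.mem_univ k)
    have h2 : IsUnit (Finset.univ.gcd v) := isUnit_of_dvd_unit h1 hk
    rw [← Finset.normalize_gcd]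
    exact normalize_eq_one.2 h2
  refine Fin.lastCases ?_ (fun k => ?_) i
  · rw [projRay_last]
    exact key _ ⟨0, hn⟩ (by norm_num)
  · rw [projRay_castSucc]
    exact key _ k (by simp)

theorem projRay_injective {n : ℕ} (hn : 0 < n) :
    Function.Injective (projRay : Fin (n + 1) → Fin n → ℤ) := by
  intro i j h
  exact simplexSystem_projRay.injective hn (congrArg lat h)

theorem rays_projectiveFraming {n : ℕ} (hn : 0 < n) (a : Fin (n + 1) → ℕ) :
    rays (projectiveFraming a).fan = Set.range projRay :=
  SimplexSystem.rays_simplexFan hn (isPrimitive_projRay hn)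

theorem coeff_projectiveFraming {n : ℕ} (hn : 0 < n) (a : Fin (n + 1) → ℕ) (i : Fin (n + 1)) :
    (projectiveFraming a).coeff (projRay i) = a i := by
  simp [projectiveFraming, (projRay_injective hn).eq_iff]

theorem isFramedToricVariety_projectiveFraming {n : ℕ} (hn : 0 < n) {a : Fin (n + 1) → ℕ}
    (ha : ∀ i, 0 < a i) : (projectiveFraming a).IsFramedToricVariety := by
  refine ⟨simplexSystem_projRay.isFan, simplexSystem_projRay.isCompleteFan, fun v hv => ?_⟩
  rw [rays_projectiveFraming hn] at hv
  obtain ⟨i, rfl⟩ := hv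
  rw [coeff_projectiveFraming hn]
  exact_mod_cast ha i

/-! ### The framing polytope of projective space -/

/-- The vertices of the polytope of `∑ a_i D_i`: the `i`-th one satisfies
`⟨v_j, m_i⟩ = -a_j` for all `j ≠ i`. -/
def vertexVec {n : ℕ} (a : Fin (n + 1) → ℕ) (i : Fin (n + 1)) : Fin n → ℤ :=
  fun k => (if i = k.castSucc then ∑ j, (a j : ℤ) else 0) - a k.castSucc

theorem projRay_dot_castSucc {n : ℕ} (k : Fin n) (x : Fin n → ℤ) :
    dotProduct (projRay k.castSucc) x = x k := by
  rw [projRay_castSucc]; simp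

theorem projRay_dot_last {n : ℕ} (x : Fin n → ℤ) :
    dotProduct (projRay (Fin.last n)) x = -∑ k, x k := by
  rw [projRay_last]; simp [dotProduct]

theorem projRay_dot_vertexVec {n : ℕ} (a : Fin (n + 1) → ℕ) (i j : Fin (n + 1)) :
    dotProduct (projRay j) (vertexVec a i) = (if i = j then ∑ k, (a k : ℤ) else 0) - a j := by
  refine Fin.lastCases ?_ (fun k => ?_) j
  · rw [projRay_dot_last]
    simp only [vertexVec, Finset.sum_sub_distrib]
    refine Fin.lastCases ?_ (fun l => ?_) i
    · rw [if_pos rfl, Fin.sum_univ_castSucc (fun k => (a k : ℤ))]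
      have : ∀ k : Fin n, ¬ Fin.last n = k.castSucc := fun k => (Fin.castSucc_lt_last k).ne'
      simp [this]
    · rw [if_neg (Fin.castSucc_lt_last l).ne]
      have : ∑ x : Fin n, (if l.castSucc = x.castSucc then ∑ j, (a j : ℤ) else 0)
          = ∑ j, (a j : ℤ) := by
        simp [Fin.castSucc_inj]
      rw [this, Fin.sum_univ_castSucc (fun k => (a k : ℤ))]
      ring
  · rw [projRay_dot_castSucc, vertexVec]

theorem lat_dot_projRay_vertexVec {n : ℕ} (a : Fin (n + 1) → ℕ) (i j : Fin (n + 1)) :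
    dotProduct (lat (projRay j)) (lat (vertexVec a i)) =
      (if i = j then ∑ k, (a k : ℝ) else 0) - a j := by
  rw [lat_dotProduct, projRay_dot_vertexVec]
  push_cast
  rfl

theorem eq_of_dot_projRay {n : ℕ} {x y : Fin n → ℝ}
    (h : ∀ j, dotProduct (lat (projRay j)) x = dotProduct (lat (projRay j)) y) : x = y := by
  ext k
  have := h k.castSucc
  simpa [lat_projRay_castSucc] using this

theorem simplexSystem_vertexVec {n : ℕ} {a : Fin (n + 1) → ℕ} (ha : ∀ i, 0 < a i) :
    SimplexSystem (fun i => lat (vertexVec a i)) (fun i => (a i : ℝ)) := by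
  have hA : 0 < ∑ k, (a k : ℝ) :=
    Finset.sum_pos (fun i _ => by exact_mod_cast ha i) Finset.univ_nonempty
  have key : ∀ (c : Fin (n + 1) → ℝ) j, dotProduct (lat (projRay j))
      (∑ i, c i • lat (vertexVec a i)) = c j * ∑ k, (a k : ℝ) - (∑ i, c i) * a j := by
    intro c j
    simp only [dotProduct_sum, dotProduct_smul, lat_dot_projRay_vertexVec, smul_eq_mul, mul_sub,
      Finset.sum_sub_distrib, ← Finset.sum_mul]
    simp
  refine ⟨fun i => by exact_mod_cast ha i, ?_, fun c hc => ?_⟩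
  · apply eq_of_dot_projRay
    intro j
    rw [key, dotProduct_zero]
    ring
  · refine ⟨(∑ i, c i) / ∑ k, (a k : ℝ), fun j => ?_⟩
    have := key c j
    rw [hc, dotProduct_zero] at this
    field_simp
    linarith

theorem integerPart_convexHull_lat {n : ℕ} (S : Set (Fin n → ℤ)) :
    integerPart (convexHull ℝ (lat '' S)) = convexHull ℝ (lat '' S) := by
  apply Set.Subset.antisymm
  · exact convexHull_min Set.inter_subset_left (convex_convexHull ℝ _)
  · refine convexHull_mono fun x hx => ⟨subset_convexHull ℝ _ hx, ?_⟩
    obtain ⟨v, -, rfl⟩ := hx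
    exact ⟨v, rfl⟩

/-- If the integer part of the polytope already contains `0` in its interior, then `k₀ = 1`. -/
theorem FramedFan.framingPolytope_eq {n : ℕ} {X : FramedFan n}
    (h : 0 ∈ interior (integerPart X.polytope)) : X.framingPolytope = integerPart X.polytope := by
  have : X.k₀ = 1 := by
    refine IsLeast.csInf_eq ⟨⟨one_pos, ?_⟩, fun k hk => hk.1⟩
    rw [Nat.cast_one, one_smul]
    exact h
  rw [FramedFan.framingPolytope, this, Nat.cast_one, one_smul]

theorem polytope_projectiveFraming {n : ℕ} (hn : 0 < n) {a : Fin (n + 1) → ℕ}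
    (ha : ∀ i, 0 < a i) : (projectiveFraming a).polytope =
      convexHull ℝ (Set.range fun i => lat (vertexVec a i)) := by
  ext m
  rw [(simplexSystem_vertexVec ha).mem_convexHull_iff
    (u := fun i => (a i : ℝ)⁻¹ • lat (projRay i)) (fun i k hk => ?_)]
  · rw [FramedFan.polytope, rays_projectiveFraming hn]
    simp only [Set.forall_mem_range, Set.mem_ofPred_eq, coeff_projectiveFraming hn]
    refine forall_congr' fun i => ?_
    have : (0 : ℝ) < a i := by exact_mod_cast ha i
    rw [smul_dotProduct, smul_eq_mul, dotProduct_comm, inv_mul_eq_div, le_div_iff₀ this]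
    simp
  · have : (0 : ℝ) < a i := by exact_mod_cast ha i
    rw [smul_dotProduct, lat_dot_projRay_vertexVec, if_neg hk, smul_eq_mul]
    field_simp
    ring

theorem range_lat_comp {n : ℕ} {ι : Type*} (f : ι → Fin n → ℤ) :
    (Set.range fun i => lat (f i)) = lat '' Set.range f := by
  rw [← Set.range_comp]; rfl

theorem framingPolytope_projectiveFraming {n : ℕ} (hn : 0 < n) {a : Fin (n + 1) → ℕ}
    (ha : ∀ i, 0 < a i) : (projectiveFraming a).framingPolytope =
      convexHull ℝ (Set.range fun i => lat (vertexVec a i)) := by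
  have h : integerPart (projectiveFraming a).polytope =
      convexHull ℝ (Set.range fun i => lat (vertexVec a i)) := by
    rw [polytope_projectiveFraming hn ha, range_lat_comp, integerPart_convexHull_lat]
  rw [FramedFan.framingPolytope_eq, h]
  rw [h]
  exact (simplexSystem_vertexVec ha).zero_mem_interior

/-! ### The dual of projective space -/

theorem gcdOthers_dvd {n : ℕ} (a : Fin (n + 1) → ℕ) {i j : Fin (n + 1)} (h : j ≠ i) :
    gcdOthers a i ∣ a j :=
  Finset.gcd_dvd (Finset.mem_erase.2 ⟨h, Finset.mem_univ j⟩)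

theorem gcdOthers_pos {n : ℕ} (hn : 0 < n) {a : Fin (n + 1) → ℕ} (ha : ∀ i, 0 < a i)
    (i : Fin (n + 1)) : 0 < gcdOthers a i := by
  have : Nontrivial (Fin (n + 1)) := Fin.nontrivial_iff_two_le.2 (by omega)
  obtain ⟨j, hj⟩ := exists_ne i
  exact Nat.pos_of_dvd_of_pos (gcdOthers_dvd a hj) (ha j)

theorem gcdOthers_dvd_vertexVec {n : ℕ} (a : Fin (n + 1) → ℕ) (i : Fin (n + 1)) (k : Fin n) :
    (gcdOthers a i : ℤ) ∣ vertexVec a i k := by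
  unfold vertexVec
  by_cases h : i = k.castSucc
  · rw [if_pos h, ← Finset.sum_erase_add _ _ (Finset.mem_univ i), ← h, add_sub_cancel_right]
    exact Finset.dvd_sum fun j hj =>
      Int.natCast_dvd_natCast.2 (gcdOthers_dvd a (Finset.ne_of_mem_erase hj))
  · rw [if_neg h, zero_sub, dvd_neg]
    exact Int.natCast_dvd_natCast.2 (gcdOthers_dvd a fun hc => h hc.symm)

/-- The primitive generators of the rays of the dual fan. -/
def dualRay {n : ℕ} (a : Fin (n + 1) → ℕ) (i : Fin (n + 1)) : Fin n → ℤ :=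
  fun k => vertexVec a i k / gcdOthers a i

theorem gcdOthers_smul_dualRay {n : ℕ} (a : Fin (n + 1) → ℕ) (i : Fin (n + 1)) :
    (gcdOthers a i : ℤ) • dualRay a i = vertexVec a i := by
  ext k
  simp only [Pi.smul_apply, smul_eq_mul, dualRay]
  exact Int.mul_ediv_cancel' (gcdOthers_dvd_vertexVec a i k)

theorem gcdOthers_mul_dot_dualRay {n : ℕ} (a : Fin (n + 1) → ℕ) (i j : Fin (n + 1)) :
    (gcdOthers a i : ℤ) * dotProduct (projRay j) (dualRay a i) =
      (if i = j then ∑ k, (a k : ℤ) else 0) - a j := by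
  rw [← projRay_dot_vertexVec, ← gcdOthers_smul_dualRay, dotProduct_smul, smul_eq_mul]

theorem isPrimitive_dualRay {n : ℕ} (hn : 0 < n) {a : Fin (n + 1) → ℕ} (ha : ∀ i, 0 < a i)
    (i : Fin (n + 1)) : IsPrimitive (dualRay a i) := by
  set g := Finset.univ.gcd (dualRay a i) with hg
  have hd : (gcdOthers a i : ℤ) ≠ 0 := by exact_mod_cast (gcdOthers_pos hn ha i).ne'
  have h1 : ∀ j, j ≠ i → (gcdOthers a i : ℤ) * g ∣ a j := by
    intro j hj
    have h2 : (gcdOthers a i : ℤ) * g ∣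
        (gcdOthers a i : ℤ) * dotProduct (projRay j) (dualRay a i) :=
      mul_dvd_mul_left _ (Finset.dvd_sum fun k _ =>
        (Finset.gcd_dvd (Finset.mem_univ k)).mul_left _)
    rw [gcdOthers_mul_dot_dualRay, if_neg hj.symm, zero_sub, dvd_neg] at h2
    exact h2
  have h3 : (gcdOthers a i * g.natAbs) ∣ gcdOthers a i := by
    refine Finset.dvd_gcd fun j hj => ?_
    have := Int.natAbs_dvd_natAbs.2 (h1 j (Finset.ne_of_mem_erase hj))
    rwa [Int.natAbs_mul, Int.natAbs_natCast, Int.natAbs_natCast] at this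
  have h4 : g.natAbs = 1 := by
    have h5 := (gcdOthers_pos hn ha i)
    have h6 := Nat.dvd_of_mul_dvd_mul_left h5 (h3.trans (mul_one _).symm.dvd)
    exact Nat.dvd_one.1 h6
  have h7 : 0 ≤ g := Finset.Int.finsetGcd_nonneg
  unfold IsPrimitive
  omega

theorem lat_dualRay {n : ℕ} (hn : 0 < n) {a : Fin (n + 1) → ℕ} (ha : ∀ i, 0 < a i)
    (i : Fin (n + 1)) : lat (dualRay a i) = (gcdOthers a i : ℝ)⁻¹ • lat (vertexVec a i) := by
  have hd : (gcdOthers a i : ℝ) ≠ 0 := by exact_mod_cast (gcdOthers_pos hn ha i).ne'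
  rw [← gcdOthers_smul_dualRay, lat_smul, Int.cast_natCast, smul_smul, inv_mul_cancel₀ hd,
    one_smul]

theorem fan_dual_projectiveFraming {n : ℕ} (hn : 0 < n) {a : Fin (n + 1) → ℕ}
    (ha : ∀ i, 0 < a i) : (projectiveFraming a).dual.fan =
      simplexFan fun i => lat (dualRay a i) := by
  have hd : ∀ i, (0 : ℝ) < (gcdOthers a i : ℝ)⁻¹ := fun i =>
    inv_pos.2 (by exact_mod_cast gcdOthers_pos hn ha i)
  simp only [lat_dualRay hn ha]
  rw [simplexFan_smul _ hd, FramedFan.dual, framingPolytope_projectiveFraming hn ha,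
    (simplexSystem_vertexVec ha).fanOver_convexHull hn]

theorem simplexSystem_dualRay' {n : ℕ} (hn : 0 < n) {a : Fin (n + 1) → ℕ} (ha : ∀ i, 0 < a i) :
    SimplexSystem (fun i => lat (dualRay a i)) (fun i => (a i : ℝ) * gcdOthers a i) := by
  have hd : ∀ i, (0 : ℝ) < (gcdOthers a i : ℝ)⁻¹ := fun i =>
    inv_pos.2 (by exact_mod_cast gcdOthers_pos hn ha i)
  have := (simplexSystem_vertexVec ha).smul hd
  simpa only [lat_dualRay hn ha, div_inv_eq_mul] using this

theorem rays_dual_projectiveFraming {n : ℕ} (hn : 0 < n) {a : Fin (n + 1) → ℕ}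
    (ha : ∀ i, 0 < a i) : rays (projectiveFraming a).dual.fan = Set.range (dualRay a) := by
  rw [fan_dual_projectiveFraming hn ha]
  exact SimplexSystem.rays_simplexFan hn (isPrimitive_dualRay hn ha)

/-- The largest of the `a_j`, `j ≠ i`, for an increasing sequence `a`. -/
def maxOthers {n : ℕ} (a : Fin (n + 1) → ℕ) (i : Fin (n + 1)) : ℕ :=
  if i = Fin.last n then secondLast a else a (Fin.last n)

theorem exists_ne_eq_maxOthers {n : ℕ} (hn : 0 < n) (a : Fin (n + 1) → ℕ) (i : Fin (n + 1)) :
    ∃ j, j ≠ i ∧ a j = maxOthers a i := by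
  unfold maxOthers secondLast
  by_cases h : i = Fin.last n
  · rw [if_pos h]
    refine ⟨⟨n - 1, by omega⟩, ?_, rfl⟩
    rw [h]
    intro hc
    have := congrArg Fin.val hc
    simp at this
    omega
  · rw [if_neg h]
    exact ⟨_, Ne.symm h, rfl⟩

theorem le_maxOthers {n : ℕ} {a : Fin (n + 1) → ℕ} (hm : Monotone a)
    {i j : Fin (n + 1)} (hj : j ≠ i) : a j ≤ maxOthers a i := by
  unfold maxOthers secondLast
  by_cases h : i = Fin.last n
  · rw [if_pos h]
    refine hm (Fin.le_def.2 ?_)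
    subst h
    have := Fin.val_lt_last hj
    simp only
    omega
  · rw [if_neg h]
    exact hm (Fin.le_last j)

theorem gcdOthers_dvd_maxOthers {n : ℕ} (hn : 0 < n) (a : Fin (n + 1) → ℕ) (i : Fin (n + 1)) :
    gcdOthers a i ∣ maxOthers a i := by
  obtain ⟨j, hj, e⟩ := exists_ne_eq_maxOthers hn a i
  exact e ▸ gcdOthers_dvd a hj

theorem maxOthers_pos {n : ℕ} (hn : 0 < n) {a : Fin (n + 1) → ℕ} (ha : ∀ i, 0 < a i)
    (i : Fin (n + 1)) : 0 < maxOthers a i := by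
  obtain ⟨j, -, e⟩ := exists_ne_eq_maxOthers hn a i
  exact e ▸ ha j

/-- The coefficient `b_i` of the dual divisor is `max_{j ≠ i} a_j / d_i`. -/
theorem gcdOthers_mul_coeff_dual {n : ℕ} (hn : 0 < n) {a : Fin (n + 1) → ℕ} (ha : ∀ i, 0 < a i)
    (hm : Monotone a) (i : Fin (n + 1)) :
    (gcdOthers a i : ℤ) * (projectiveFraming a).dual.coeff (dualRay a i) = maxOthers a i := by
  have hd : (0 : ℤ) < gcdOthers a i := by exact_mod_cast gcdOthers_pos hn ha i
  obtain ⟨b, hb⟩ := gcdOthers_dvd_maxOthers hn a i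
  have hM := maxOthers_pos hn ha i
  have hb' : (maxOthers a i : ℤ) = gcdOthers a i * b := by exact_mod_cast hb
  have : (projectiveFraming a).dual.coeff (dualRay a i) = b := by
    refine IsLeast.csInf_eq ⟨⟨?_, fun v hv => ?_⟩, fun c hc => ?_⟩
    · rcases Nat.eq_zero_or_pos b with h | h
      · rw [hb, h, mul_zero] at hM; omega
      · exact_mod_cast h
    · rw [rays_projectiveFraming hn] at hv
      obtain ⟨j, rfl⟩ := hv
      refine nonneg_of_mul_nonneg_right ?_ hd
      rw [mul_add, gcdOthers_mul_dot_dualRay, ← hb']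
      by_cases h : i = j
      · rw [if_pos h]
        have : (a j : ℤ) ≤ ∑ k, (a k : ℤ) :=
          Finset.single_le_sum (f := fun k => (a k : ℤ)) (fun _ _ => by positivity)
            (Finset.mem_univ j)
        have : (0 : ℤ) ≤ maxOthers a i := by positivity
        omega
      · rw [if_neg h]
        have := le_maxOthers hm (Ne.symm h)
        omega
    · obtain ⟨j, hj, e⟩ := exists_ne_eq_maxOthers hn a i
      have h1 := hc.2 (projRay j) (by rw [rays_projectiveFraming hn]; exact ⟨j, rfl⟩)
      have h2 := mul_nonneg hd.le h1
      rw [mul_add, gcdOthers_mul_dot_dualRay, if_neg hj.symm, e, hb'] at h2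
      exact le_of_mul_le_mul_left (by linarith) hd
  rw [this, hb']

/-! ### Reduced weights -/

section ReducedWeights

variable {n : ℕ} {a : Fin (n + 1) → ℕ}

/-- As the `a_i` have no common factor, the `d_i` are pairwise coprime; hence their least common
multiples in the definition of the reduced weights are products. -/
theorem coprime_gcdOthers (hg : Finset.univ.gcd a = 1) {i j : Fin (n + 1)} (hij : i ≠ j) :
    Nat.Coprime (gcdOthers a i) (gcdOthers a j) := by
  rw [Nat.coprime_iff_gcd_eq_one, ← Nat.dvd_one, ← hg]
  refine Finset.dvd_gcd fun k _ => ?_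
  by_cases h : k = i
  · exact (Nat.gcd_dvd_right _ _).trans (gcdOthers_dvd a (h ▸ hij))
  · exact (Nat.gcd_dvd_left _ _).trans (gcdOthers_dvd a h)

theorem reducedWeights_mul_lcm (a : Fin (n + 1) → ℕ) (i : Fin (n + 1)) :
    reducedWeights a i * (Finset.univ.erase i).lcm (gcdOthers a) = a i := by
  refine Nat.div_mul_cancel (Finset.lcm_dvd fun j hj => gcdOthers_dvd a ?_)
  exact (Finset.ne_of_mem_erase hj).symm

theorem reducedWeights_pos (ha : ∀ i, 0 < a i) (i : Fin (n + 1)) : 0 < reducedWeights a i := by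
  rcases Nat.eq_zero_or_pos (reducedWeights a i) with h | h
  · have := reducedWeights_mul_lcm a i
    rw [h, zero_mul] at this
    exact absurd this (ha i).ne
  · exact h

theorem reducedWeights_mul_prod (hg : Finset.univ.gcd a = 1) (i : Fin (n + 1)) :
    reducedWeights a i * ∏ j, gcdOthers a j = a i * gcdOthers a i := by
  rw [← Finset.prod_erase_mul _ _ (Finset.mem_univ i), ← mul_assoc,
    ← Finset.lcm_eq_prod fun j _ k _ hjk => coprime_gcdOthers hg hjk, reducedWeights_mul_lcm]

theorem gcd_reducedWeights (hg : Finset.univ.gcd a = 1) :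
    Finset.univ.gcd (reducedWeights a) = 1 := by
  have h : Finset.univ.gcd (reducedWeights a) ∣ Finset.univ.gcd a := by
    refine Finset.dvd_gcd fun i _ => ?_
    rw [← reducedWeights_mul_lcm a i]
    exact (Finset.gcd_dvd (Finset.mem_univ i)).mul_right _
  rw [hg] at h
  exact Nat.dvd_one.1 h

theorem SimplexSystem.rescale {w : Fin (n + 1) → Fin n → ℝ} {q q' : Fin (n + 1) → ℝ}
    (h : SimplexSystem w q) {t : ℝ} (ht : 0 < t) (e : ∀ i, q' i * t = q i) :
    SimplexSystem w q' where
  pos i := pos_of_mul_pos_left (by rw [e]; exact h.pos i) ht.le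
  rel := by
    have : t • ∑ i, q' i • w i = 0 := by
      rw [← h.rel, Finset.smul_sum]
      exact Finset.sum_congr rfl fun i _ => by rw [smul_smul, mul_comm, e]
    exact (smul_eq_zero.1 this).resolve_left ht.ne'
  unique c hc := by
    obtain ⟨r, hr⟩ := h.unique c hc
    exact ⟨r * t, fun i => by rw [hr, ← e]; ring⟩

theorem simplexSystem_dualRay (hn : 0 < n) (ha : ∀ i, 0 < a i) (hg : Finset.univ.gcd a = 1) :
    SimplexSystem (fun i => lat (dualRay a i)) (fun i => (reducedWeights a i : ℝ)) := by
  refine (simplexSystem_dualRay' hn ha).rescale (t := ∏ j, (gcdOthers a j : ℝ))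
    (Finset.prod_pos fun j _ => by exact_mod_cast gcdOthers_pos hn ha j) fun i => ?_
  exact_mod_cast reducedWeights_mul_prod hg i

theorem dualRay_injective (hn : 0 < n) (ha : ∀ i, 0 < a i) :
    Function.Injective (dualRay a) := by
  intro i j h
  exact (simplexSystem_dualRay' hn ha).injective hn (congrArg lat h)

theorem isFramedToricVariety_dual (hn : 0 < n) (ha : ∀ i, 0 < a i) (hm : Monotone a) :
    (projectiveFraming a).dual.IsFramedToricVariety := by
  rw [FramedFan.IsFramedToricVariety, rays_dual_projectiveFraming hn ha,
    fan_dual_projectiveFraming hn ha]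
  refine ⟨(simplexSystem_dualRay' hn ha).isFan, (simplexSystem_dualRay' hn ha).isCompleteFan, ?_⟩
  rintro _ ⟨i, rfl⟩
  have h1 := gcdOthers_mul_coeff_dual hn ha hm i
  have h2 : (0 : ℤ) < gcdOthers a i := by exact_mod_cast gcdOthers_pos hn ha i
  have h3 : (0 : ℤ) < maxOthers a i := by exact_mod_cast maxOthers_pos hn ha i
  exact pos_of_mul_pos_right (h1 ▸ h3) h2.le

end ReducedWeights

/-! ### Rays of simplicial refinements of the fan over a polytope -/

theorem FramedFan.coeff_dual_mem {n : ℕ} {X : FramedFan n} (hX : (rays X.fan).Finite)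
    (l : Fin n → ℤ) :
    0 < X.dual.coeff l ∧ ∀ v ∈ rays X.fan, 0 ≤ dotProduct v l + X.dual.coeff l := by
  have hne : {b : ℤ | 0 < b ∧ ∀ v ∈ rays X.fan, 0 ≤ dotProduct v l + b}.Nonempty := by
    refine ⟨1 + ∑ v ∈ hX.toFinset, |dotProduct v l|, ?_, fun v hv => ?_⟩
    · have : 0 ≤ ∑ v ∈ hX.toFinset, |dotProduct v l| := Finset.sum_nonneg fun _ _ => abs_nonneg _
      omega
    · have h1 : |dotProduct v l| ≤ ∑ v ∈ hX.toFinset, |dotProduct v l| :=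
        Finset.single_le_sum (f := fun v => |dotProduct v l|) (fun _ _ => abs_nonneg _)
          (hX.mem_toFinset.2 hv)
      have h2 := neg_abs_le (dotProduct v l)
      omega
  exact Int.csInf_mem hne ⟨0, fun b hb => hb.1.le⟩

theorem FramedFan.coeff_dual_le {n : ℕ} {X : FramedFan n} {l : Fin n → ℤ} {b : ℤ} (hb : 0 < b)
    (h : ∀ v ∈ rays X.fan, 0 ≤ dotProduct v l + b) : X.dual.coeff l ≤ b :=
  csInf_le ⟨0, fun _ hb => hb.1.le⟩ ⟨hb, h⟩

/-- As `0` is an interior point, the functional that cuts out a facet can be scaled to be `-1` there. -/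
theorem IsFacet.exists_normal {n : ℕ} {Φ Δ : Set (Fin n → ℝ)} (h : IsFacet Φ Δ)
    (h0 : 0 ∈ interior Δ) :
    ∃ u : Fin n → ℝ, (∀ m ∈ Δ, -1 ≤ dotProduct u m) ∧ Φ ⊆ Δ ∧ ∀ m ∈ Φ, dotProduct u m = -1 := by
  obtain ⟨-, ⟨w, c, h1, rfl⟩, h2⟩ := h
  have hc : c ≤ 0 := by simpa using h1 0 (interior_subset h0)
  rcases hc.lt_or_eq with hc | hc
  · refine ⟨(-c)⁻¹ • w, fun m hm => ?_, fun m hm => hm.1, fun m hm => ?_⟩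
    · rw [smul_dotProduct, smul_eq_mul, inv_mul_eq_div, le_div_iff₀ (by linarith)]
      linarith [h1 m hm]
    · rw [smul_dotProduct, hm.2, smul_eq_mul]
      have := hc.ne
      field_simp
  · -- a functional that is nonnegative around the origin vanishes, so the face is everything
    exfalso
    subst hc
    have hw : w = 0 := by
      have hcont : ContinuousAt (fun t : ℝ => t • w) 0 := by fun_prop
      have hev : ∀ᶠ t : ℝ in nhds 0, t • w ∈ Δ := by
        apply hcont.eventually
        simp only [zero_smul]
        exact mem_interior_iff_mem_nhds.1 h0
      have hev2 : ∀ᶠ t : ℝ in nhdsWithin 0 (Set.Iio 0), t • w ∈ Δ := hev.filter_mono inf_le_left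
      obtain ⟨t, ht, ht'⟩ := (hev2.and self_mem_nhdsWithin).exists
      have h3 := h1 _ ht
      rw [dotProduct_smul, smul_eq_mul] at h3
      have h4 : 0 ≤ dotProduct w w := by
        simp only [dotProduct]
        exact Finset.sum_nonneg fun i _ => mul_self_nonneg _
      have ht'' : t < 0 := ht'
      have h5 : dotProduct w w = 0 := by nlinarith
      exact dotProduct_self_eq_zero.1 h5
    subst hw
    have hΦ : {m ∈ Δ | dotProduct (0 : Fin n → ℝ) m = 0} = Δ := by ext; simp
    rw [hΦ] at h2
    have htop : vectorSpan ℝ Δ = ⊤ := by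
      rw [← direction_affineSpan]
      have : affineSpan ℝ Δ = ⊤ := by
        rw [eq_top_iff, ← IsOpen.affineSpan_eq_top isOpen_interior ⟨0, h0⟩]
        exact affineSpan_mono ℝ interior_subset
      rw [this, AffineSubspace.direction_top]
    rw [htop, finrank_top, Module.finrank_fintype_fun_eq_card, Fintype.card_fin] at h2
    omega

/-- Every point lies in a cone `τ` of a complete refinement of the fan over `Δ`, and `τ` lies over
a facet, with normal vector `u`. -/
theorem exists_cone_over_facet {n : ℕ} {Δ : Set (Fin n → ℝ)} (h0 : 0 ∈ interior Δ)
    {Ξ : Set (Set (Fin n → ℝ))} (hΞ : IsCompleteFan Ξ) (hr : Refines Ξ (fanOver Δ))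
    (x : Fin n → ℝ) :
    ∃ τ ∈ Ξ, x ∈ τ ∧ ∃ u : Fin n → ℝ, (∀ m ∈ Δ, -1 ≤ dotProduct u m) ∧
      ∀ y ∈ τ, ∃ m ∈ Δ, ∃ r : ℝ, 0 ≤ r ∧ y = r • m ∧ dotProduct u m = -1 := by
  obtain ⟨τ, hτ, hx⟩ : x ∈ ⋃₀ Ξ := hΞ ▸ Set.mem_univ x
  obtain ⟨σ, ⟨Φ, hΦ, -, ⟨w, -, rfl⟩⟩, hσ⟩ := hr τ hτ
  obtain ⟨u, h1, h2, h3⟩ := hΦ.exists_normal h0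
  refine ⟨τ, hτ, hx, u, h1, fun y hy => ?_⟩
  obtain ⟨⟨m, hm, r, hr0, rfl⟩, -⟩ := hσ hy
  exact ⟨m, h2 hm, r, hr0, rfl, h3 m hm⟩

theorem isFace_ray {n : ℕ} {S : Set (Fin n → ℤ)}
    (hS : LinearIndependent ℝ (fun v : S => lat v.1)) {s : Fin n → ℤ} (hs : s ∈ S) :
    IsFace (cone {lat s}) (cone (lat '' S)) := by
  classical
  have := finite_of_linearIndependent_lat hS
  have := Fintype.ofFinite S
  obtain ⟨u, hu⟩ := exists_lattice_functional hS {s}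
  have hnn : ∀ t ∈ S, 0 ≤ dotProduct u t := fun t ht => by
    by_cases h : t = s
    · rw [(hu t ht).1 h]
    · exact ((hu t ht).2 h).le
  refine ⟨lat u, mem_dualMonoid_cone.2 hnn, ?_⟩
  ext v
  constructor
  · intro hv
    refine ⟨cone_mono (by simpa using ⟨s, hs, rfl⟩) hv, ?_⟩
    obtain ⟨r, -, rfl⟩ := mem_cone_singleton.1 hv
    rw [dotProduct_smul, lat_dotProduct, (hu s hs).1 rfl]
    simp
  · rintro ⟨hv, e⟩
    rw [cone_eq_image_univ] at hv
    obtain ⟨c, h1, -, rfl⟩ := (mem_cone_image _ _ _).1 hv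
    simp only [dotProduct_sum, dotProduct_smul, smul_eq_mul, lat_dotProduct] at e
    rw [Finset.sum_eq_zero_iff_of_nonneg fun t _ => mul_nonneg (h1 t)
        (by exact_mod_cast hnn t.1 t.2)] at e
    refine sum_mem_cone _ fun t _ => ?_
    by_cases h : t.1 = s
    · rw [h]; exact smul_mem_cone (h1 t) (subset_cone _ rfl)
    · have h2 := e t (Finset.mem_univ t)
      have h3 := (hu t.1 t.2).2 h
      rw [mul_eq_zero, Int.cast_eq_zero] at h2
      rw [h2.resolve_right h3.ne', zero_smul]
      exact zero_mem_cone _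

theorem exists_ray_of_mem {n : ℕ} {Ξ : Set (Set (Fin n → ℝ))} (hΞ : IsFan Ξ)
    {S : Set (Fin n → ℤ)} (hS : LinearIndependent ℝ (fun v : S => lat v.1))
    (hτ : cone (lat '' S) ∈ Ξ) {s : Fin n → ℤ} (hs : s ∈ S) :
    ∃ v ∈ rays Ξ, ∃ k : ℤ, 0 < k ∧ s = k • v := by
  have hs0 : s ≠ 0 := by
    rintro rfl
    exact hS.ne_zero ⟨0, hs⟩ lat_zero
  obtain ⟨v, k, hv, hk, rfl⟩ := exists_primitive hs0
  refine ⟨v, ⟨hv, ?_⟩, k, hk, rfl⟩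
  have h1 := hΞ.face_mem _ hτ _ (isFace_ray hS hs)
  convert h1 using 1
  have hk' : (0 : ℝ) < k := by exact_mod_cast hk
  ext x
  simp only [mem_cone_singleton, lat_smul, smul_smul]
  constructor
  · rintro ⟨r, hr, rfl⟩
    exact ⟨r / k, div_nonneg hr hk'.le, by rw [div_mul_cancel₀ _ hk'.ne']⟩
  · rintro ⟨r, hr, rfl⟩
    exact ⟨r * k, mul_nonneg hr hk'.le, rfl⟩

/-- An exposed point of the polytope generates a ray of every complete simplicial refinement of the
fan over it. -/
theorem exists_ray_of_exposed {n : ℕ} {Δ : Set (Fin n → ℝ)} (h0 : 0 ∈ interior Δ)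
    {Ξ : Set (Set (Fin n → ℝ))} (hf : IsFan Ξ) (hΞ : IsCompleteFan Ξ) (hs : IsSimplicialFan Ξ)
    (hr : Refines Ξ (fanOver Δ)) {p G : Fin n → ℝ} (hG : dotProduct G p < 0)
    (hGp : ∀ m ∈ Δ, dotProduct G p < dotProduct G m ∨ m = p) (hp : p ∈ Δ) :
    ∃ v ∈ rays Ξ, ∃ r : ℝ, 0 < r ∧ p = r • lat v := by
  obtain ⟨τ, hτ, hpτ, u, h1, h2⟩ := exists_cone_over_facet h0 hΞ hr p
  obtain ⟨S, hS, rfl⟩ := hs τ hτ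
  have := finite_of_linearIndependent_lat hS
  have := Fintype.ofFinite S
  have h3 : ∀ s : S, ∃ m ∈ Δ, ∃ r : ℝ, 0 ≤ r ∧ lat s.1 = r • m ∧ dotProduct u m = -1 :=
    fun s => h2 _ (subset_cone _ ⟨s.1, s.2, rfl⟩)
  choose m hm r hr0 hsm hum using h3
  have hpτ' := hpτ
  rw [cone_eq_image_univ] at hpτ'
  obtain ⟨α, hα, -, hpα⟩ := (mem_cone_image _ _ _).1 hpτ'
  have hp1 : p = ∑ s, (α s * r s) • m s := by
    rw [hpα]
    exact Finset.sum_congr rfl fun s _ => by rw [hsm, smul_smul]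
  have hβ : ∀ s, 0 ≤ α s * r s := fun s => mul_nonneg (hα s) (hr0 s)
  have hsum : ∑ s, α s * r s ≤ 1 := by
    have := h1 p hp
    rw [hp1, dotProduct_sum] at this
    simp only [dotProduct_smul, hum, smul_eq_mul, mul_neg, mul_one, Finset.sum_neg_distrib] at this
    linarith
  obtain ⟨s, hs1, hs2⟩ : ∃ s, 0 < α s * r s ∧ m s = p := by
    by_contra! hc
    have hle : ∀ s, (α s * r s) * dotProduct G p ≤ (α s * r s) * dotProduct G (m s) := fun s => by
      rcases hGp (m s) (hm s) with h | h
      · exact mul_le_mul_of_nonneg_left h.le (hβ s)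
      · rw [h]
    have hGsum : dotProduct G p = ∑ s, (α s * r s) * dotProduct G (m s) := by
      conv_lhs => rw [hp1]
      simp only [dotProduct_sum, dotProduct_smul, smul_eq_mul]
    obtain ⟨s, hspos⟩ : ∃ s, 0 < α s * r s := by
      by_contra! hc'
      have : p = 0 := by
        rw [hp1]
        exact Finset.sum_eq_zero fun s _ => by
          rw [le_antisymm (hc' s) (hβ s), zero_smul]
      rw [this, dotProduct_zero] at hG
      exact lt_irrefl _ hG
    have hlt : ∑ s, (α s * r s) * dotProduct G p < ∑ s, (α s * r s) * dotProduct G (m s) := by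
      refine Finset.sum_lt_sum (fun s _ => hle s) ⟨s, Finset.mem_univ s, ?_⟩
      exact mul_lt_mul_of_pos_left ((hGp (m s) (hm s)).resolve_right (hc s hspos)) hspos
    rw [← hGsum, ← Finset.sum_mul] at hlt
    nlinarith
  have hrs : 0 < r s := lt_of_le_of_ne (hr0 s) fun h => by rw [← h, mul_zero] at hs1; exact hs1.false
  obtain ⟨v, hv, k, hk, e⟩ := exists_ray_of_mem hf hS hτ s.2
  refine ⟨v, hv, k / r s, div_pos (by exact_mod_cast hk) hrs, ?_⟩
  have := hsm s
  rw [hs2, e, lat_smul] at this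
  rw [div_eq_inv_mul, ← smul_smul, this, smul_smul, inv_mul_cancel₀ hrs.ne', one_smul]

theorem mem_convexHull_exposed {n : ℕ} {T : Set (Fin n → ℝ)} {p G : Fin n → ℝ}
    (h : ∀ m ∈ T, dotProduct G p < dotProduct G m ∨ m = p) :
    ∀ m ∈ convexHull ℝ T, dotProduct G p < dotProduct G m ∨ m = p := by
  refine fun m hm => convexHull_min (t := {m | dotProduct G p < dotProduct G m ∨ m = p}) h ?_ hm
  intro x hx y hy s t hs ht hst
  by_cases hxy : x = p ∧ y = p
  · right
    rw [hxy.1, hxy.2, ← add_smul, hst, one_smul]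
  have hx' : dotProduct G p ≤ dotProduct G x := hx.elim (fun h => h.le) fun h => h ▸ le_rfl
  have hy' : dotProduct G p ≤ dotProduct G y := hy.elim (fun h => h.le) fun h => h ▸ le_rfl
  rcases hs.eq_or_lt with rfl | hs
  · simp only [zero_add] at hst; subst hst; simpa using hy
  rcases ht.eq_or_lt with rfl | ht
  · simp only [add_zero] at hst; subst hst; simpa using hx
  left
  rw [dotProduct_add, dotProduct_smul, dotProduct_smul, smul_eq_mul, smul_eq_mul]
  have e : dotProduct G p = s * dotProduct G p + t * dotProduct G p := by rw [← add_mul, hst, one_mul]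
  rw [e]
  rcases hx with hx | hx
  · exact add_lt_add_of_lt_of_le (mul_lt_mul_of_pos_left hx hs) (mul_le_mul_of_nonneg_left hy' ht.le)
  · exact add_lt_add_of_le_of_lt (mul_le_mul_of_nonneg_left hx' hs.le)
      (mul_lt_mul_of_pos_left (hy.resolve_right fun h => hxy ⟨hx, h⟩) ht)

/-! ### The lattice points of the polytope of the dual -/

/-- The lattice points of the simplex `{x ≥ 0, ∑_{k ≤ n} a_k x_k ≤ a_n}`. -/
def cornerPoints {n : ℕ} (a : Fin (n + 1) → ℕ) : Set (Fin n → ℤ) :=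
  {x | (∀ k, 0 ≤ x k) ∧ ∑ k, (a k.castSucc : ℤ) * x k ≤ secondLast a}

section

variable {n : ℕ} {a : Fin (n + 1) → ℕ}

theorem le_secondLast (hm : Monotone a) (k : Fin n) : a k.castSucc ≤ secondLast a := by
  refine hm (Fin.le_def.2 ?_)
  have := k.2
  simp only [Fin.val_castSucc]
  omega

theorem dot_vertexVec (x : Fin n → ℤ) (i : Fin (n + 1)) :
    dotProduct x (vertexVec a i) = (∑ k, if i = k.castSucc then (∑ j, (a j : ℤ)) * x k else 0) -
      ∑ k, (a k.castSucc : ℤ) * x k := by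
  simp only [vertexVec, dotProduct, mul_sub, Finset.sum_sub_distrib]
  congr 1
  · exact Finset.sum_congr rfl fun k _ => by split_ifs <;> ring
  · exact Finset.sum_congr rfl fun k _ => by ring

theorem dot_vertexVec_castSucc (x : Fin n → ℤ) (k : Fin n) :
    dotProduct x (vertexVec a k.castSucc) = (∑ j, (a j : ℤ)) * x k -
      ∑ k, (a k.castSucc : ℤ) * x k := by
  rw [dot_vertexVec]
  simp [Fin.castSucc_inj]

theorem dot_vertexVec_last (x : Fin n → ℤ) :
    dotProduct x (vertexVec a (Fin.last n)) = - ∑ k, (a k.castSucc : ℤ) * x k := by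
  rw [dot_vertexVec]
  have : ∀ k : Fin n, ¬ Fin.last n = k.castSucc := fun k => (Fin.castSucc_lt_last k).ne'
  simp [this]

theorem lat_mem_polytope_dual (hn : 0 < n) (ha : ∀ i, 0 < a i) (hm : Monotone a)
    (x : Fin n → ℤ) : lat x ∈ (projectiveFraming a).dual.polytope ↔
      ∀ i, -(maxOthers a i : ℤ) ≤ dotProduct x (vertexVec a i) := by
  rw [FramedFan.polytope, rays_dual_projectiveFraming hn ha]
  simp only [Set.mem_ofPred_eq, Set.forall_mem_range]
  refine forall_congr' fun i => ?_
  have hd : (0 : ℤ) < gcdOthers a i := by exact_mod_cast gcdOthers_pos hn ha i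
  rw [lat_dotProduct, ← Int.cast_neg, Int.cast_le, ← gcdOthers_mul_coeff_dual hn ha hm,
    ← gcdOthers_smul_dualRay, dotProduct_smul, smul_eq_mul, ← mul_neg,
    mul_le_mul_iff_right₀ hd]

/-- The lattice points of the polytope of the dual are the corner points and `-𝟏`. -/
theorem lat_mem_polytope_dual_iff (hn : 0 < n) (ha : ∀ i, 0 < a i) (hm : Monotone a)
    (x : Fin n → ℤ) : lat x ∈ (projectiveFraming a).dual.polytope ↔
      x ∈ insert (projRay (Fin.last n)) (cornerPoints a) := by
  rw [lat_mem_polytope_dual hn ha hm, Fin.forall_fin_succ', dot_vertexVec_last]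
  simp only [dot_vertexVec_castSucc]
  have hM : ∀ k : Fin n, maxOthers a k.castSucc = a (Fin.last n) := fun k => by
    rw [maxOthers, if_neg (Fin.castSucc_lt_last k).ne]
  have hM' : maxOthers a (Fin.last n) = secondLast a := by rw [maxOthers, if_pos rfl]
  simp only [hM, hM']
  have hA : ∑ j, (a j : ℤ) = ∑ k : Fin n, (a k.castSucc : ℤ) + a (Fin.last n) :=
    Fin.sum_univ_castSucc _
  have hl : (0 : ℤ) < a (Fin.last n) := by exact_mod_cast ha _
  have hak : ∀ k : Fin n, (0 : ℤ) < a k.castSucc := fun k => by exact_mod_cast ha _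
  have hB : (0 : ℤ) ≤ ∑ k : Fin n, (a k.castSucc : ℤ) :=
    Finset.sum_nonneg fun k _ => (hak k).le
  set B : ℤ := ∑ k : Fin n, (a k.castSucc : ℤ) with hBdef
  rw [hA]
  set s : ℤ := ∑ k, (a k.castSucc : ℤ) * x k with hs
  set l : ℤ := (a (Fin.last n) : ℤ) with hldef
  have hsl : (secondLast a : ℤ) ≤ l := by
    rw [hldef, Nat.cast_le]
    exact hm (Fin.le_last _)
  constructor
  · rintro ⟨h1, h2⟩
    by_cases hx : ∀ k, 0 ≤ x k
    · exact Or.inr ⟨hx, by rw [← hs]; linarith⟩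
    · left
      push Not at hx
      obtain ⟨k, hk⟩ := hx
      have h3 := h1 k
      have h4 : s ≤ -B := by nlinarith
      -- the weighted sum of the inequalities bounds `s` from below as well
      have h5 : B * (s - l) ≤ (B + l) * s := by
        have : ∑ k : Fin n, (a k.castSucc : ℤ) * (s - l) ≤ ∑ k, (a k.castSucc : ℤ) * ((B + l) * x k) :=
          Finset.sum_le_sum fun k _ =>
            mul_le_mul_of_nonneg_left (by linarith [h1 k]) (hak k).le
        rw [← Finset.sum_mul, ← hBdef] at this
        refine this.trans_eq ?_
        rw [hs, Finset.mul_sum]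
        exact Finset.sum_congr rfl fun k _ => by ring
      have h6 : -B ≤ s := by nlinarith
      have hsB : s = -B := le_antisymm h4 h6
      have h7 : ∀ k, 0 ≤ x k + 1 := fun k => by
        have := h1 k
        by_contra! hc
        have h9 : x k ≤ -2 := by omega
        nlinarith
      have h8 : ∑ k, (a k.castSucc : ℤ) * (x k + 1) = 0 := by
        simp only [mul_add, Finset.sum_add_distrib, mul_one]
        rw [← hs, ← hBdef]; linarith
      rw [Finset.sum_eq_zero_iff_of_nonneg fun k _ => mul_nonneg (hak k).le (h7 k)] at h8
      rw [projRay_last]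
      ext k
      have := h8 k (Finset.mem_univ k)
      rw [mul_eq_zero] at this
      have := this.resolve_left (hak k).ne'
      omega
  · rintro (rfl | ⟨hx, h⟩)
    · have hsB : s = -B := by
        rw [hs, hBdef, projRay_last]
        simp
      rw [projRay_last, hsB]
      refine ⟨fun k => by linarith, ?_⟩
      have : (0 : ℤ) ≤ secondLast a := by positivity
      linarith
    · rw [← hs] at h
      refine ⟨fun k => ?_, by linarith⟩
      have : 0 ≤ (B + l) * x k := mul_nonneg (by linarith) (hx k)
      linarith

theorem projRay_castSucc_mem_cornerPoints (hm : Monotone a) (k : Fin n) :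
    projRay k.castSucc ∈ cornerPoints a := by
  refine ⟨fun j => ?_, ?_⟩
  · rw [projRay_castSucc]
    by_cases h : j = k
    · subst h; simp
    · simp [h]
  · simp only [projRay_castSucc]
    simpa [Pi.single_apply] using le_secondLast hm k

theorem integerPart_polytope_dual (hn : 0 < n) (ha : ∀ i, 0 < a i) (hm : Monotone a) :
    integerPart (projectiveFraming a).dual.polytope =
      convexHull ℝ (lat '' insert (projRay (Fin.last n)) (cornerPoints a)) := by
  unfold integerPart
  congr 1
  ext x
  constructor
  · rintro ⟨h1, v, rfl⟩
    exact ⟨v, (lat_mem_polytope_dual_iff hn ha hm v).1 h1, rfl⟩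
  · rintro ⟨v, hv, rfl⟩
    exact ⟨(lat_mem_polytope_dual_iff hn ha hm v).2 hv, v, rfl⟩

theorem zero_mem_interior_dual (hm : Monotone a) :
    0 ∈ interior (convexHull ℝ (lat '' insert (projRay (Fin.last n)) (cornerPoints a))) := by
  refine interior_mono (convexHull_mono ?_) (simplexSystem_projRay (n := n)).zero_mem_interior
  rintro _ ⟨i, rfl⟩
  refine Fin.lastCases ?_ (fun k => ?_) i
  · exact ⟨_, Or.inl rfl, rfl⟩
  · exact ⟨_, Or.inr (projRay_castSucc_mem_cornerPoints hm k), rfl⟩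

theorem fan_dual_dual (hn : 0 < n) (ha : ∀ i, 0 < a i) (hm : Monotone a) :
    (projectiveFraming a).dual.dual.fan =
      fanOver (convexHull ℝ (lat '' insert (projRay (Fin.last n)) (cornerPoints a))) := by
  have h := integerPart_polytope_dual hn ha hm
  conv_lhs => rw [FramedFan.dual]
  rw [FramedFan.framingPolytope_eq, h]
  rw [h]
  exact zero_mem_interior_dual hm

/-! ### Condition (a) -/

/-- The largest multiple of `e_k` among the corner points. -/
def cornerLength {n : ℕ} (a : Fin (n + 1) → ℕ) (k : Fin n) : ℕ := secondLast a / a k.castSucc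

theorem cornerLength_pos (ha : ∀ i, 0 < a i) (hm : Monotone a) (k : Fin n) :
    0 < cornerLength a k := Nat.div_pos (le_secondLast hm k) (ha _)

theorem le_cornerLength (ha : ∀ i, 0 < a i) {x : Fin n → ℤ} (hx : x ∈ cornerPoints a)
    (k : Fin n) : x k ≤ cornerLength a k := by
  have hk : (0 : ℤ) < a k.castSucc := by exact_mod_cast ha _
  have h1 : (a k.castSucc : ℤ) * x k ≤ ∑ k, (a k.castSucc : ℤ) * x k :=
    Finset.single_le_sum (f := fun k : Fin n => (a k.castSucc : ℤ) * x k)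
      (fun j _ => mul_nonneg (by positivity) (hx.1 j)) (Finset.mem_univ k)
  rw [cornerLength]
  push_cast
  rw [Int.le_ediv_iff_mul_le hk, mul_comm]
  exact h1.trans hx.2

theorem cornerLength_smul_mem (k : Fin n) :
    (cornerLength a k : ℤ) • projRay k.castSucc ∈ cornerPoints a := by
  rw [projRay_castSucc]
  refine ⟨fun j => ?_, ?_⟩
  · by_cases h : j = k
    · subst h; simp
    · simp [h]
  · have : (a k.castSucc : ℤ) * cornerLength a k ≤ secondLast a := by
      exact_mod_cast Nat.mul_div_le _ _
    simpa [Pi.single_apply] using this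

/-- The corner points lie in the simplex with vertices `0` and `⌊a_n / a_k⌋ e_k`. -/
def CornerCondition {n : ℕ} (a : Fin (n + 1) → ℕ) : Prop :=
  ∀ x ∈ cornerPoints a, ∑ k, (x k : ℝ) / cornerLength a k ≤ 1

theorem sum_smul_mem_of_zero_mem {ι : Type*} [Fintype ι] {C : Set (Fin n → ℝ)} (hC : Convex ℝ C)
    (h0 : 0 ∈ C) {t : ι → ℝ} {p : ι → Fin n → ℝ} (ht : ∀ i, 0 ≤ t i) (hsum : ∑ i, t i ≤ 1)
    (hp : ∀ i, p i ∈ C) : ∑ i, t i • p i ∈ C := by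
  have := hC.sum_mem (t := Finset.univ) (w := fun o : Option ι => o.elim (1 - ∑ i, t i) t)
    (z := fun o : Option ι => o.elim 0 p) ?_ ?_ ?_
  · simpa [Fintype.sum_option] using this
  · rintro (_ | i) -
    · simpa using hsum
    · exact ht i
  · simp [Fintype.sum_option]
  · rintro (_ | i) -
    · exact h0
    · exact hp i

theorem mem_cornerSimplex {c : Fin n → ℝ} (hc : ∀ i, 0 < c i) (x : Fin n → ℝ) :
    x ∈ convexHull ℝ (insert 0 (Set.range fun i => (Pi.single i (c i) : Fin n → ℝ))) ↔
      (∀ i, 0 ≤ x i) ∧ ∑ i, x i / c i ≤ 1 := by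
  constructor
  · intro hx
    refine convexHull_min (t := {x | (∀ i, 0 ≤ x i) ∧ ∑ i, x i / c i ≤ 1}) ?_ ?_ hx
    · rintro _ (rfl | ⟨i, rfl⟩)
      · simp
      · refine ⟨fun j => ?_, ?_⟩
        · by_cases h : j = i
          · subst h; simpa using (hc j).le
          · simp [h]
        · rw [Finset.sum_eq_single i]
          · simp [(hc i).ne']
          · intro j _ h; simp [h]
          · simp
    · rintro x ⟨h1, h2⟩ y ⟨h3, h4⟩ s t hs ht hst
      refine ⟨fun i => add_nonneg (mul_nonneg hs (h1 i)) (mul_nonneg ht (h3 i)), ?_⟩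
      have : ∑ i, (s • x + t • y) i / c i = s * ∑ i, x i / c i + t * ∑ i, y i / c i := by
        simp only [Pi.add_apply, Pi.smul_apply, smul_eq_mul, add_div, Finset.sum_add_distrib,
          Finset.mul_sum, mul_div_assoc]
      rw [this]
      nlinarith
  · rintro ⟨h1, h2⟩
    have := sum_smul_mem_of_zero_mem
      (convex_convexHull ℝ (insert 0 (Set.range fun i => (Pi.single i (c i) : Fin n → ℝ))))
      (subset_convexHull ℝ _ (Or.inl rfl)) (t := fun i => x i / c i)
      (p := fun i => Pi.single i (c i)) (fun i => div_nonneg (h1 i) (hc i).le) h2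
      (fun i => subset_convexHull ℝ _ (Or.inr ⟨i, rfl⟩))
    convert this using 1
    ext j
    simp [Pi.single_apply, (hc j).ne']

/-- Condition (a) lists the `a_i` in the opposite order, so it is the corner condition up to a reversal
of the coordinates. -/
theorem conditionA_iff (ha : ∀ i, 0 < a i) (hm : Monotone a) :
    ConditionA a ↔ CornerCondition a := by
  have hs : (0 : ℝ) < secondLast a := by exact_mod_cast ha _
  have hfl : ∀ i : Fin n, ((⌊(secondLast a : ℝ) / (a i.rev.castSucc : ℝ)⌋ : ℤ) : ℝ) =
      cornerLength a i.rev := by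
    intro i
    rw [Int.floor_div_natCast, Int.floor_natCast, cornerLength]
    norm_cast
  have hpos1 : ∀ i : Fin n, 0 < (secondLast a : ℝ) / (a i.rev.castSucc : ℝ) := fun i =>
    div_pos hs (by exact_mod_cast ha _)
  have hpos2 : ∀ i : Fin n, (0 : ℝ) < cornerLength a i.rev := fun i => by
    exact_mod_cast cornerLength_pos ha hm _
  -- reversing the coordinates identifies the lattice points of the polytope with corner points
  have hlat : ∀ y : Fin n → ℤ, lat y ∈ nablaPrime a ↔ (fun k => y k.rev) ∈ cornerPoints a := by
    intro y
    rw [nablaPrime, mem_cornerSimplex hpos1, cornerPoints, Set.mem_ofPred_eq]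
    refine and_congr ?_ ?_
    · rw [← Fin.revPerm.forall_congr_right]
      refine forall_congr' fun i => ?_
      simp [lat]
    · have : ∑ i, lat y i / ((secondLast a : ℝ) / (a i.rev.castSucc : ℝ)) =
          (∑ k : Fin n, ((a k.castSucc : ℤ) * y k.rev : ℤ)) / (secondLast a : ℝ) := by
        rw [← Equiv.sum_comp Fin.revPerm, Int.cast_sum, Finset.sum_div]
        refine Finset.sum_congr rfl fun k _ => ?_
        simp only [Fin.revPerm_apply, Fin.rev_rev, lat]
        push_cast
        have : (a k.castSucc : ℝ) ≠ 0 := by exact_mod_cast (ha _).ne'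
        field_simp
      rw [this, div_le_one hs]
      exact_mod_cast Iff.rfl
  have hrhs : ∀ y : Fin n → ℝ, y ∈ convexHull ℝ (insert 0 (Set.range fun i : Fin n =>
      (Pi.single i ((cornerLength a i.rev : ℕ) : ℝ) : Fin n → ℝ))) ↔
      (∀ k : Fin n, 0 ≤ y k.rev) ∧ ∑ k : Fin n, y k.rev / cornerLength a k ≤ 1 := by
    intro y
    rw [mem_cornerSimplex hpos2]
    refine and_congr ?_ ?_
    · rw [← Fin.revPerm.forall_congr_right]
      rfl
    · rw [← Equiv.sum_comp Fin.revPerm]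
      simp
  unfold ConditionA
  simp only [hfl]
  constructor
  · intro h x hx
    have h1 : lat (fun k => x k.rev) ∈ nablaPrime a := by
      rw [hlat]; simpa using hx
    have h2 := subset_convexHull ℝ (nablaPrime a ∩ Set.range lat) ⟨h1, _, rfl⟩
    rw [h, hrhs] at h2
    simpa [lat] using h2.2
  · intro h
    apply Set.Subset.antisymm
    · refine convexHull_min ?_ (convex_convexHull ℝ _)
      rintro _ ⟨h1, y, rfl⟩
      rw [hlat] at h1
      rw [hrhs]
      exact ⟨fun k => by simpa [lat] using h1.1 k, h _ h1⟩
    · refine convexHull_mono ?_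
      rintro _ (rfl | ⟨i, rfl⟩)
      · refine ⟨subset_convexHull ℝ _ (Or.inl rfl), 0, lat_zero⟩
      · have e : (Pi.single i ((cornerLength a i.rev : ℕ) : ℝ) : Fin n → ℝ) =
            lat (Pi.single i (cornerLength a i.rev : ℤ)) := by
          ext j
          by_cases hj : j = i
          · subst hj; simp [lat]
          · simp [lat, hj]
        rw [show (fun i : Fin n => (Pi.single i ((cornerLength a i.rev : ℕ) : ℝ) : Fin n → ℝ)) i = _
          from e]
        refine ⟨?_, _, rfl⟩
        rw [hlat]
        convert cornerLength_smul_mem (a := a) i.rev using 1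
        rw [projRay_castSucc]
        ext k
        by_cases hk : k = i.rev
        · subst hk; simp
        · have : k.rev ≠ i := fun hc => hk (by rw [← hc, Fin.rev_rev])
          simp [hk, this]

/-! ### The double dual -/

/-- Under the corner condition the framing polytope of the dual is a simplex whose vertices lie on the
rays of the fan of projective space. -/
theorem fan_dual_dual_of_cornerCondition (hn : 0 < n) (ha : ∀ i, 0 < a i) (hm : Monotone a)
    (h : CornerCondition a) :
    (projectiveFraming a).dual.dual.fan = (projectiveFraming a).fan := by
  set c : Fin (n + 1) → ℝ := Fin.lastCases (motive := fun _ => ℝ) 1 (fun k => cornerLength a k)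
    with hc
  have hcl : c (Fin.last n) = 1 := by simp [hc]
  have hcs : ∀ k : Fin n, c k.castSucc = cornerLength a k := fun k => by simp [hc]
  have hcpos : ∀ i, 0 < c i := by
    refine Fin.lastCases (by rw [hcl]; exact one_pos) fun k => ?_
    rw [hcs]; exact_mod_cast cornerLength_pos ha hm k
  have hS := (simplexSystem_projRay (n := n)).smul hcpos
  have e : convexHull ℝ (lat '' insert (projRay (Fin.last n)) (cornerPoints a)) =
      convexHull ℝ (Set.range fun i => c i • lat (projRay i)) := by
    apply Set.Subset.antisymm
    · refine convexHull_min ?_ (convex_convexHull ℝ _)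
      rintro _ ⟨x, rfl | hx, rfl⟩
      · exact subset_convexHull ℝ _ ⟨Fin.last n, by simp only [hcl, one_smul]⟩
      · have := sum_smul_mem_of_zero_mem
          (convex_convexHull ℝ (Set.range fun i => c i • lat (projRay i)))
          (interior_subset hS.zero_mem_interior) (t := fun k => (x k : ℝ) / cornerLength a k)
          (p := fun k => c k.castSucc • lat (projRay k.castSucc))
          (fun k => div_nonneg (by exact_mod_cast hx.1 k) (by positivity)) (h x hx)
          (fun k => subset_convexHull ℝ _ ⟨k.castSucc, rfl⟩)
        convert this using 1
        ext j
        have hj : (cornerLength a j : ℝ) ≠ 0 := by exact_mod_cast (cornerLength_pos ha hm j).ne'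
        simp [hcs, lat_projRay_castSucc, Pi.single_apply, hj]
        rfl
    · refine convexHull_mono ?_
      rintro _ ⟨i, rfl⟩
      refine Fin.lastCases ?_ (fun k => ?_) i
      · exact ⟨_, Or.inl rfl, by simp only [hcl, one_smul]⟩
      · refine ⟨_, Or.inr (cornerLength_smul_mem k), ?_⟩
        simp only [hcs, lat_smul, Int.cast_natCast]
  rw [fan_dual_dual hn ha hm, e, hS.fanOver_convexHull hn, simplexFan_smul _ hcpos]
  rfl

theorem finite_rays_dual (hn : 0 < n) (ha : ∀ i, 0 < a i) :
    (rays (projectiveFraming a).dual.fan).Finite := by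
  rw [rays_dual_projectiveFraming hn ha]
  exact Set.finite_range _

theorem dot_dualRay_le (hn : 0 < n) (ha : ∀ i, 0 < a i) (i j : Fin (n + 1)) :
    -(a i : ℤ) ≤ dotProduct (dualRay a j) (projRay i) := by
  have hd : (0 : ℤ) < gcdOthers a j := by exact_mod_cast gcdOthers_pos hn ha j
  have h1 := gcdOthers_mul_dot_dualRay a j i
  rw [dotProduct_comm] at h1
  have h2 : (0 : ℤ) ≤ if j = i then ∑ k, (a k : ℤ) else 0 := by
    split_ifs
    · positivity
    · exact le_rfl
  have h3 : (0 : ℤ) < a i := by exact_mod_cast ha i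
  nlinarith

theorem coeff_dual_dual_le (hn : 0 < n) (ha : ∀ i, 0 < a i) (i : Fin (n + 1)) :
    (projectiveFraming a).dual.dual.coeff (projRay i) ≤ a i := by
  refine FramedFan.coeff_dual_le (by exact_mod_cast ha i) fun v hv => ?_
  rw [rays_dual_projectiveFraming hn ha] at hv
  obtain ⟨j, rfl⟩ := hv
  linarith [dot_dualRay_le hn ha i j]

/-- The double dual recovers the coefficient `a_i` iff some `d_j`, `j ≠ i`, is `1`. -/
theorem coeff_dual_dual_eq_iff (hn : 0 < n) (ha : ∀ i, 0 < a i) (i : Fin (n + 1)) :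
    (projectiveFraming a).dual.dual.coeff (projRay i) = a i ↔ ∃ j, j ≠ i ∧ gcdOthers a j = 1 := by
  constructor
  · intro h
    by_contra! hc
    have : Nontrivial (Fin (n + 1)) := Fin.nontrivial_iff_two_le.2 (by omega)
    obtain ⟨j₀, hj₀⟩ := exists_ne i
    have h2 : ∀ j, j ≠ i → 2 ≤ gcdOthers a j := fun j hj => by
      have := gcdOthers_pos hn ha j
      have := hc j hj
      omega
    have h3 : 2 ≤ a i := (h2 j₀ hj₀).trans (Nat.le_of_dvd (ha i) (gcdOthers_dvd a hj₀.symm))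
    have h4 : (projectiveFraming a).dual.dual.coeff (projRay i) ≤ (a i : ℤ) - 1 := by
      refine FramedFan.coeff_dual_le (by omega) fun v hv => ?_
      rw [rays_dual_projectiveFraming hn ha] at hv
      obtain ⟨j, rfl⟩ := hv
      have h5 := gcdOthers_mul_dot_dualRay a j i
      rw [dotProduct_comm] at h5
      by_cases hj : j = i
      · rw [if_pos hj] at h5
        have hle : (a i : ℤ) ≤ ∑ k, (a k : ℤ) :=
          Finset.single_le_sum (f := fun k => (a k : ℤ)) (fun _ _ => by positivity)
            (Finset.mem_univ i)
        have hd : (0 : ℤ) < gcdOthers a j := by exact_mod_cast gcdOthers_pos hn ha j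
        have : 0 ≤ dotProduct (dualRay a j) (projRay i) :=
          nonneg_of_mul_nonneg_right (by rw [h5]; linarith) hd
        omega
      · rw [if_neg hj] at h5
        have h6 : (2 : ℤ) ≤ gcdOthers a j := by exact_mod_cast h2 j hj
        have h7 : (2 : ℤ) ≤ a i := by exact_mod_cast h3
        by_contra! hlt
        have h8 : dotProduct (dualRay a j) (projRay i) ≤ -(a i : ℤ) := by omega
        nlinarith
    omega
  · rintro ⟨j, hj, hd⟩
    refine le_antisymm (coeff_dual_dual_le hn ha i) ?_
    have h1 := ((FramedFan.coeff_dual_mem (finite_rays_dual hn ha) (projRay i)).2 (dualRay a j)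
      (by rw [rays_dual_projectiveFraming hn ha]; exact ⟨j, rfl⟩))
    have h2 := gcdOthers_mul_dot_dualRay a j i
    rw [dotProduct_comm, hd, if_neg hj] at h2
    push_cast at h2
    linarith

theorem conditionB_iff : ConditionB a ↔ ∀ i, ∃ j, j ≠ i ∧ gcdOthers a j = 1 := by
  constructor
  · rintro ⟨j, k, hjk, hj, hk⟩ i
    by_cases h : j = i
    · exact ⟨k, fun hc => hjk (h.trans hc.symm), hk⟩
    · exact ⟨j, h, hj⟩
  · intro h
    obtain ⟨j, -, hj⟩ := h 0
    obtain ⟨k, hk, hk'⟩ := h j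
    exact ⟨j, k, hk.symm, hj, hk'⟩

/-! ### Calibrated processes -/

theorem isToricIso_refl {F : Set (Set (Fin n → ℝ))} (h : {0} ∈ F) :
    IsToricIso (Equiv.refl (ToricVariety F)) :=
  ⟨⟨fun _ => Iff.rfl, fun _ _ _ => Iff.rfl⟩, h, h, MonoidHom.id _, fun _ => rfl⟩

theorem zero_mem_simplexFan (w : Fin (n + 1) → Fin n → ℝ) : {0} ∈ simplexFan w :=
  ⟨∅, Set.empty_ne_univ, by rw [Set.image_empty, cone_empty]⟩

/-- Under the two conditions the double dual is the original framed variety, so that no refinement is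
needed and the identity is the required isomorphism. -/
theorem isCalibrated_of_conditions (hn : 0 < n) (ha : ∀ i, 0 < a i) (hm : Monotone a)
    (hA : CornerCondition a) (hB : ConditionB a) : (projectiveFraming a).IsCalibrated := by
  have hF := fan_dual_dual_of_cornerCondition hn ha hm hA
  have hSF : (projectiveFraming a).fan ∈ SF (rays (projectiveFraming a).fan) :=
    ⟨simplexSystem_projRay.isFan, simplexSystem_projRay.isCompleteFan,
      simplexSystem_projRay.isSimplicialFan, rfl⟩
  have hR : Refines (projectiveFraming a).fan (projectiveFraming a).fan :=
    fun τ hτ => ⟨τ, hτ, subset_rfl⟩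
  refine ⟨_, hSF, (projectiveFraming a).fan, by rw [hF]; exact hSF, hR, by rw [hF]; exact hR,
    Equiv.refl _, isToricIso_refl (zero_mem_simplexFan _), ?_⟩
  have hid : (fun D : Set (ToricVariety (projectiveFraming a).fan) =>
      (Equiv.refl (ToricVariety (projectiveFraming a).fan)) ⁻¹' D) = id := rfl
  rw [hid, Finsupp.mapDomain_id]
  refine finsum_congr fun v => ?_
  obtain ⟨i, hi⟩ : v.1 ∈ Set.range (projRay : Fin (n + 1) → _) := by
    rw [← rays_projectiveFraming hn a]; exact v.2
  rw [← hi, coeff_projectiveFraming hn,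
    (coeff_dual_dual_eq_iff hn ha i).2 ((conditionB_iff).1 hB i)]

/-- The functional that exposes the corner point on the `k`-th axis. -/
theorem exposed_corner (hn : 0 < n) (ha : ∀ i, 0 < a i) (k : Fin n) :
    ∃ G : Fin n → ℝ, dotProduct G (lat ((cornerLength a k : ℤ) • projRay k.castSucc)) =
      -(n * cornerLength a k) ∧ ∀ m ∈ lat '' insert (projRay (Fin.last n)) (cornerPoints a),
      dotProduct G (lat ((cornerLength a k : ℤ) • projRay k.castSucc)) < dotProduct G m ∨
        m = lat ((cornerLength a k : ℤ) • projRay k.castSucc) := by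
  obtain ⟨f, hf⟩ : ∃ f : ℤ, f = (cornerLength a k : ℕ) := ⟨_, rfl⟩
  -- on corner points `G` is `(f + 1) ∑_{j ≠ k} x_j - n x_k`, which is least at `f e_k`; the multiple
  -- `f + 1` keeps the value at `-𝟏` above `-n f`
  let G : Fin n → ℤ := fun j => (f + 1) - if j = k then f + 1 + n else 0
  have hG : ∀ x : Fin n → ℤ, dotProduct G x = (f + 1) * ∑ j, x j - (f + 1 + n) * x k := by
    intro x
    simp only [G, dotProduct, sub_mul, Finset.sum_sub_distrib, Finset.mul_sum, ite_mul, zero_mul]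
    simp
  have hn' : (1 : ℤ) ≤ n := by exact_mod_cast hn
  have hf0 : 0 ≤ f := by omega
  rw [← hf]
  have hGp : dotProduct G (f • projRay k.castSucc) = -(n * f) := by
    rw [hG, projRay_castSucc]
    simp only [Pi.smul_apply, smul_eq_mul, ← Finset.mul_sum, Fintype.sum_pi_single',
      Pi.single_eq_same]
    ring
  refine ⟨lat G, ?_, ?_⟩
  · rw [lat_dotProduct, hGp]
    push_cast
    rw [hf, Int.cast_natCast]
  · rintro _ ⟨x, hx, rfl⟩
    simp only [lat_dotProduct, hGp, Int.cast_lt, lat_injective.eq_iff]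
    rcases hx with rfl | hx
    · left
      rw [hG, projRay_last]
      simp
      nlinarith
    · have hxk := le_cornerLength ha hx k
      rw [← hf] at hxk
      have hsum : ∑ j, x j = x k + ∑ j ∈ Finset.univ.erase k, x j :=
        (Finset.add_sum_erase _ _ (Finset.mem_univ k)).symm
      have hT : 0 ≤ ∑ j ∈ Finset.univ.erase k, x j := Finset.sum_nonneg fun j _ => hx.1 j
      rw [hG, hsum]
      rcases hT.eq_or_lt with hT | hT
      · rw [← hT]
        rcases hxk.eq_or_lt with h | h
        · right
          symm at hT
          rw [Finset.sum_eq_zero_iff_of_nonneg fun j _ => hx.1 j] at hT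
          rw [projRay_castSucc]
          ext j
          by_cases hj : j = k
          · subst hj; simp [h]
          · simp [hj, hT j (Finset.mem_erase.2 ⟨hj, Finset.mem_univ j⟩)]
        · left; nlinarith
      · left; nlinarith

/-- The functional that exposes the lattice point `-𝟏`. -/
theorem exposed_last (hn : 0 < n) :
    ∃ G : Fin n → ℝ, dotProduct G (lat (projRay (Fin.last n))) = -n ∧
      ∀ m ∈ lat '' insert (projRay (Fin.last n)) (cornerPoints a),
      dotProduct G (lat (projRay (Fin.last n))) < dotProduct G m ∨
        m = lat (projRay (Fin.last n)) := by
  have e : dotProduct (fun _ => (1 : ℝ)) (lat (projRay (Fin.last n))) = -(n : ℝ) := by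
    rw [lat_projRay_last]; simp [dotProduct]
  refine ⟨fun _ => 1, e, ?_⟩
  rintro _ ⟨x, rfl | hx, rfl⟩
  · exact Or.inr rfl
  · left
    rw [e]
    have h1 : (0 : ℝ) ≤ dotProduct (fun _ => (1 : ℝ)) (lat x) := by
      simp only [dotProduct, one_mul]
      exact Finset.sum_nonneg fun j _ => by
        have := hx.1 j
        simp only [lat]; exact_mod_cast this
    have h2 : (0 : ℝ) < n := by exact_mod_cast hn
    linarith

/-- The points `-𝟏` and `⌊a_n / a_k⌋ e_k` are exposed points of the framing polytope of the dual, so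
they generate rays of every complete simplicial refinement. -/
theorem range_projRay_subset_rays (hn : 0 < n) (ha : ∀ i, 0 < a i) (hm : Monotone a)
    {Ξ : Set (Set (Fin n → ℝ))} (hf : IsFan Ξ) (hc : IsCompleteFan Ξ) (hs : IsSimplicialFan Ξ)
    (hr : Refines Ξ (projectiveFraming a).dual.dual.fan) : Set.range projRay ⊆ rays Ξ := by
  rw [fan_dual_dual hn ha hm] at hr
  have h0 := zero_mem_interior_dual hm
  have hn' : (0 : ℝ) < n := by exact_mod_cast hn
  rintro _ ⟨i, rfl⟩
  refine Fin.lastCases ?_ (fun k => ?_) i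
  · obtain ⟨G, h1, h2⟩ := exposed_last (a := a) hn
    obtain ⟨v, hv, r, hr', e⟩ := exists_ray_of_exposed h0 hf hc hs hr (by rw [h1]; linarith)
      (mem_convexHull_exposed h2) (subset_convexHull ℝ _ ⟨_, Or.inl rfl, rfl⟩)
    rwa [(isPrimitive_projRay hn _).eq_of_smul hv.1 hr'.le e]
  · obtain ⟨G, h1, h2⟩ := exposed_corner hn ha k
    have hpos : (0 : ℝ) < cornerLength a k := by exact_mod_cast cornerLength_pos ha hm k
    obtain ⟨v, hv, r, hr', e⟩ := exists_ray_of_exposed h0 hf hc hs hr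
      (by rw [h1]; have := mul_pos hn' hpos; linarith)
      (mem_convexHull_exposed h2)
      (subset_convexHull ℝ _ ⟨_, Or.inr (cornerLength_smul_mem k), rfl⟩)
    rw [lat_smul, Int.cast_natCast] at e
    have e' : lat (projRay k.castSucc) = ((cornerLength a k : ℝ)⁻¹ * r) • lat v := by
      rw [← smul_smul, ← e, smul_smul, inv_mul_cancel₀ hpos.ne', one_smul]
    rwa [(isPrimitive_projRay hn _).eq_of_smul hv.1 (by positivity) e']

/-- If some complete simplicial refinement of the fan of the double dual has only the rays of
projective space, then the corner points span a simplex with their axes. -/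
theorem cornerCondition_of_rays (hn : 0 < n) (ha : ∀ i, 0 < a i) (hm : Monotone a)
    {Ξ : Set (Set (Fin n → ℝ))} (hf : IsFan Ξ) (hc : IsCompleteFan Ξ) (hs : IsSimplicialFan Ξ)
    (hr : Refines Ξ (projectiveFraming a).dual.dual.fan) (hrays : rays Ξ = Set.range projRay) :
    CornerCondition a := by
  rw [fan_dual_dual hn ha hm] at hr
  intro x hx
  obtain ⟨τ, hτ, hxτ, u, h1, h2⟩ :=
    exists_cone_over_facet (zero_mem_interior_dual hm) hc hr (lat x)
  have hcone : τ ⊆ cone ((fun i => lat (projRay i)) '' {i | lat (projRay i) ∈ τ}) := by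
    obtain ⟨S, hS, rfl⟩ := hs τ hτ
    refine Submodule.span_le.2 ?_
    rintro _ ⟨s, hsS, rfl⟩
    obtain ⟨v, hv, k, hk, e⟩ := exists_ray_of_mem hf hS hτ hsS
    rw [hrays] at hv
    obtain ⟨i, rfl⟩ := hv
    have hk' : (0 : ℝ) < k := by exact_mod_cast hk
    rw [e, lat_smul]
    refine smul_mem_cone hk'.le (subset_cone _ ⟨i, ?_, rfl⟩)
    have h3 : lat s ∈ cone (lat '' S) := subset_cone _ ⟨s, hsS, rfl⟩
    have h4 := smul_mem_cone (inv_pos.2 hk').le h3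
    rw [e, lat_smul, smul_smul, inv_mul_cancel₀ hk'.ne', one_smul] at h4
    exact h4
  obtain ⟨α, hα, hα0, hxα⟩ := (mem_cone_image _ _ _).1 (hcone hxτ)
  -- the coordinate bound on the polytope limits how far a facet reaches along each axis
  have hbound : ∀ m ∈ convexHull ℝ (lat '' insert (projRay (Fin.last n)) (cornerPoints a)),
      ∀ k, m k ≤ cornerLength a k := by
    intro m hm' k
    refine convexHull_min (t := {m : Fin n → ℝ | m k ≤ cornerLength a k}) ?_ ?_ hm'
    · rintro _ ⟨y, rfl | hy, rfl⟩
      · rw [lat_projRay_last]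
        have : (0 : ℝ) ≤ cornerLength a k := by positivity
        simp only [Set.mem_ofPred_eq]; linarith
      · have := le_cornerLength ha hy k
        simp only [Set.mem_ofPred_eq, lat]
        exact_mod_cast this
    · exact convex_halfSpace_le ⟨fun _ _ => rfl, fun _ _ => rfl⟩ _
  have hnormal : ∀ i, lat (projRay i) ∈ τ → dotProduct u (lat (projRay i)) ≤ 0 ∧
      ∀ k : Fin n, i = k.castSucc →
        dotProduct u (lat (projRay i)) ≤ -(cornerLength a k : ℝ)⁻¹ := by
    intro i hi
    obtain ⟨m, hm', r, hr0, e, hum⟩ := h2 _ hi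
    rw [e, dotProduct_smul, hum, smul_eq_mul]
    refine ⟨by linarith, ?_⟩
    rintro k rfl
    have h3 : 1 = r * m k := by
      have := congrFun e k
      simpa [lat_projRay_castSucc] using this
    have h4 : (0 : ℝ) < cornerLength a k := by exact_mod_cast cornerLength_pos ha hm k
    have h5 : 1 ≤ r * cornerLength a k := by
      rw [h3]; exact mul_le_mul_of_nonneg_left (hbound m hm' k) hr0
    have h6 : (cornerLength a k : ℝ)⁻¹ ≤ r := by
      rw [inv_eq_one_div, div_le_iff₀ h4]; exact h5
    linarith
  have hx1 : lat x ∈ convexHull ℝ (lat '' insert (projRay (Fin.last n)) (cornerPoints a)) :=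
    subset_convexHull ℝ _ ⟨x, Or.inr hx, rfl⟩
  have hux := h1 _ hx1
  rw [hxα, dotProduct_sum, Fin.sum_univ_castSucc] at hux
  simp only [dotProduct_smul, smul_eq_mul] at hux
  have hterm : ∀ i, α i = 0 ∨ lat (projRay i) ∈ τ := fun i => by
    by_cases h : lat (projRay i) ∈ τ
    · exact Or.inr h
    · exact Or.inl (hα0 i h)
  have hlast : α (Fin.last n) * dotProduct u (lat (projRay (Fin.last n))) ≤ 0 := by
    rcases hterm (Fin.last n) with h | h
    · rw [h, zero_mul]
    · exact mul_nonpos_of_nonneg_of_nonpos (hα _) (hnormal _ h).1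
  have hk : ∀ k : Fin n, α k.castSucc * dotProduct u (lat (projRay k.castSucc)) ≤
      -((x k : ℝ) / cornerLength a k) := by
    intro k
    have h4 : (0 : ℝ) < cornerLength a k := by exact_mod_cast cornerLength_pos ha hm k
    have hxk : (x k : ℝ) ≤ α k.castSucc := by
      have := congrFun hxα k
      rw [sum_projRay_smul] at this
      simp only [lat] at this
      rw [this]
      linarith [hα (Fin.last n)]
    have h5 : (x k : ℝ) / cornerLength a k ≤ α k.castSucc * (cornerLength a k : ℝ)⁻¹ := by
      rw [div_eq_mul_inv]
      exact mul_le_mul_of_nonneg_right hxk (inv_pos.2 h4).le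
    rcases hterm k.castSucc with h | h
    · rw [h, zero_mul]
      rw [h, zero_mul] at h5
      linarith
    · have := mul_le_mul_of_nonneg_left ((hnormal _ h).2 k rfl) (hα k.castSucc)
      linarith
  have hsum := Finset.sum_le_sum fun k (_ : k ∈ Finset.univ) => hk k
  rw [Finset.sum_neg_distrib] at hsum
  linarith

/-- The isomorphism matches the components of the two divisors, with their coefficients. Comparing the
numbers of components shows that the second refinement has only the rays of projective space, and
comparing the sums of the coefficients turns the inequalities `c_i ≤ a_i` into equalities. -/
theorem conditions_of_isCalibrated (hn : 0 < n) (ha : ∀ i, 0 < a i) (hm : Monotone a)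
    (h : (projectiveFraming a).IsCalibrated) : CornerCondition a ∧ ConditionB a := by
  obtain ⟨Ξ, ⟨f1, -, f3, f4⟩, Ξ', ⟨g1, g2, g3, g4⟩, -, hr, f, -, hdiv⟩ := h
  rw [rays_projectiveFraming hn] at f4
  have hsub := range_projRay_subset_rays hn ha hm g1 g2 g3 hr
  have := (finite_rays f1.finite).fintype
  have := (finite_rays g1.finite).fintype
  have hpos' := fun l => (FramedFan.coeff_dual_mem (finite_rays_dual hn ha) l).1
  obtain ⟨hcard, hsum⟩ := card_rays_eq_and_sum_coeff_eq f3 g3 (fun v hv => by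
      rw [f4] at hv
      obtain ⟨i, rfl⟩ := hv
      rw [coeff_projectiveFraming hn]
      exact_mod_cast (ha i).ne') (fun v _ => (hpos' v).ne') f hdiv
  have hrays : rays Ξ' = Set.range projRay := by
    symm
    refine Set.eq_of_subset_of_ncard_le hsub ?_ (finite_rays g1.finite)
    rw [← f4, ← Nat.card_coe_set_eq, ← Nat.card_coe_set_eq, Nat.card_eq_fintype_card,
      Nat.card_eq_fintype_card, hcard]
  refine ⟨cornerCondition_of_rays hn ha hm g1 g2 g3 hr hrays, ?_⟩
  have key : ∀ (F : Set (Set (Fin n → ℝ))) [Fintype (rays F)] (c : (Fin n → ℤ) → ℤ),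
      rays F = Set.range projRay → ∑ v : rays F, c v.1 = ∑ i, c (projRay i) := by
    intro F _ c hF
    refine (Fintype.sum_bijective (fun i => (⟨projRay i, hF ▸ ⟨i, rfl⟩⟩ : rays F)) ⟨?_, ?_⟩ _ _
      fun _ => rfl).symm
    · intro i j hij
      exact projRay_injective hn (congrArg Subtype.val hij)
    · rintro ⟨v, hv⟩
      have hv' := hv
      rw [hF] at hv'
      obtain ⟨i, rfl⟩ := hv'
      exact ⟨i, rfl⟩
  rw [key Ξ _ f4, key Ξ' _ hrays] at hsum
  simp only [coeff_projectiveFraming hn] at hsum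
  rw [conditionB_iff]
  intro i
  rw [← coeff_dual_dual_eq_iff hn ha]
  exact (Finset.sum_eq_sum_iff_of_le fun i _ => coeff_dual_dual_le hn ha i).1 hsum.symm i
    (Finset.mem_univ i)

theorem isCalibrated_iff (hn : 0 < n) (ha : ∀ i, 0 < a i) (hm : Monotone a) :
    (projectiveFraming a).IsCalibrated ↔ ConditionA a ∧ ConditionB a := by
  rw [conditionA_iff ha hm]
  exact ⟨conditions_of_isCalibrated hn ha hm, fun h => isCalibrated_of_conditions hn ha hm h.1 h.2⟩

end

/-! ### Hermite normal forms with a left inverse -/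

theorem upperTriangular_det {l : ℕ} {H : Matrix (Fin l) (Fin l) ℤ} (h : ∀ i j, j < i → H i j = 0) :
    H.det = ∏ i, H i i :=
  Matrix.det_of_isUpperTriangular fun i j hij => h i j hij

/-- A Hermite normal form whose rows generate the lattice consists of an identity matrix and zero
rows. -/
theorem IsHermiteNormalForm.eq_one {k l : ℕ} {H : Matrix (Fin k) (Fin l) ℤ}
    (h : IsHermiteNormalForm H) {C : Matrix (Fin l) (Fin k) ℤ} (hC : C * H = 1) (i : Fin k)
    (j : Fin l) : H i j = if i.1 = j.1 then 1 else 0 := by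
  obtain ⟨r, p, hrk, hp, hpiv, hzero⟩ := h
  -- the `r` nonzero rows generate a lattice of rank `l`
  let H' : Matrix (Fin r) (Fin l) ℤ := fun i j => H ⟨i.1, i.2.trans_le hrk⟩ j
  let C' : Matrix (Fin l) (Fin r) ℤ := fun i j => C i ⟨j.1, j.2.trans_le hrk⟩
  have hC' : C' * H' = 1 := by
    rw [← hC]
    ext a b
    rw [Matrix.mul_apply, Matrix.mul_apply]
    have hinj : Function.Injective (fun i : Fin r => (⟨i.1, i.2.trans_le hrk⟩ : Fin k)) := by
      intro x y hxy
      simpa [Fin.ext_iff] using hxy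
    rw [← Finset.sum_image (s := Finset.univ)
      (g := fun i : Fin r => (⟨i.1, i.2.trans_le hrk⟩ : Fin k)) (f := fun x => C a x * H x b)
      (hinj.injOn)]
    refine Finset.sum_subset (Finset.subset_univ _) fun x _ hx => ?_
    have : r ≤ x.1 := by
      by_contra! hc
      exact hx (Finset.mem_image.2 ⟨⟨x.1, hc⟩, Finset.mem_univ _, rfl⟩)
    rw [hzero x this, mul_zero]
  have hlr : l ≤ r := by
    have hinj : Function.Injective H'.mulVecLin := by
      intro x y hxy
      have := congrArg C'.mulVec hxy
      simpa [Matrix.mulVec_mulVec, hC'] using this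
    simpa using LinearMap.finrank_le_finrank_of_injective hinj
  have hmono : StrictMono (fun i : Fin r => p ⟨i.1, i.2.trans_le hrk⟩) := fun x y hxy =>
    hp _ _ (Fin.mk_lt_mk.2 hxy) y.2
  have hrl : r = l := le_antisymm (by simpa using Fintype.card_le_of_injective _ hmono.injective) hlr
  subst hrl
  have hpid : ∀ i : Fin r, p ⟨i.1, i.2.trans_le hrk⟩ = i := fun i =>
    le_antisymm (hmono.apply_le) (hmono.le_apply)
  have htri : ∀ i j : Fin r, j < i → H' i j = 0 := fun i j hij =>
    (hpiv ⟨i.1, i.2.trans_le hrk⟩ i.2).2.1 j (by rw [hpid]; exact hij)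
  have hdet : C'.det * ∏ i, H' i i = 1 := by
    rw [← upperTriangular_det htri, ← Matrix.det_mul, hC', Matrix.det_one]
  have hdiag : ∀ i, H' i i = 1 := by
    intro i
    have h1 : H' i i ∣ 1 := by
      rw [← hdet]
      exact (Finset.dvd_prod_of_mem _ (Finset.mem_univ i)).mul_left _
    have h2 : 0 < H' i i := by
      have := (hpiv ⟨i.1, i.2.trans_le hrk⟩ i.2).1
      rwa [hpid] at this
    exact le_antisymm (Int.le_of_dvd one_pos h1) h2
  by_cases hi : i.1 < r
  · have e : H i j = H' ⟨i.1, hi⟩ j := rfl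
    rcases lt_trichotomy j ⟨i.1, hi⟩ with hlt | heq | hgt
    · rw [e, htri _ _ hlt, if_neg]
      exact fun hc => hlt.ne (Fin.ext hc.symm)
    · rw [heq, if_pos rfl]
      exact hdiag ⟨i.1, hi⟩
    · have h1 := (hpiv ⟨j.1, j.2.trans_le hrk⟩ j.2).2.2 i hgt
      rw [hpid] at h1
      have h2 := hdiag j
      have h3 : H' j j = H ⟨j.1, j.2.trans_le hrk⟩ j := rfl
      rw [if_neg fun hc => hgt.ne (Fin.ext hc)]
      omega
  · rw [hzero i (not_lt.1 hi), if_neg]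
    have := j.2
    omega

theorem isHermiteNormalForm_of_eq_one {k l : ℕ} {H : Matrix (Fin k) (Fin l) ℤ} (hlk : l ≤ k)
    (p : Fin k → Fin l) (hp : ∀ i, i.1 < l → (p i).1 = i.1)
    (h : ∀ i j, H i j = if i.1 = j.1 then 1 else 0) : IsHermiteNormalForm H := by
  refine ⟨l, p, hlk, fun i i' hi hi' => ?_, fun i hi => ⟨?_, fun j hj => ?_, fun i' hi' => ?_⟩,
    fun i hi j => ?_⟩
  · rw [Fin.lt_def, hp i' hi', hp i (lt_trans hi hi')]
    exact hi
  · rw [h, if_pos (hp i hi).symm]; exact one_pos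
  · have := hp i hi
    have hj' : j.1 < (p i).1 := hj
    rw [h, if_neg (by omega)]
  · have := hp i hi
    have hi'' : i'.1 < i.1 := hi'
    rw [h, h, if_neg (by omega), if_pos (by omega)]
    exact ⟨le_rfl, one_pos⟩
  · have := j.2
    rw [h, if_neg (by omega)]

/-! ### The output of the algorithm -/

/-- The index of the `k`-th of the last `s` of `m` rows. -/
def lowerIndex {m s : ℕ} (hs : s ≤ m) (k : Fin s) : Fin m := ⟨m - s + k.1, by omega⟩

theorem lowerIndex_injective {m s : ℕ} (hs : s ≤ m) : Function.Injective (lowerIndex hs) := by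
  intro x y hxy
  have := congrArg Fin.val hxy
  simp only [lowerIndex] at this
  exact Fin.ext (by omega)

theorem exists_lowerIndex {m s : ℕ} (hs : s ≤ m) {i : Fin m} (hi : m - s ≤ i.1) :
    ∃ k, lowerIndex hs k = i :=
  ⟨⟨i.1 - (m - s), by have := i.2; omega⟩, Fin.ext (by simp only [lowerIndex]; omega)⟩

theorem lowerIndex_succ {n s : ℕ} (hs : s ≤ n) (k : Fin s) :
    (lowerIndex hs k).succ = lowerIndex (hs.trans n.le_succ) k :=
  Fin.ext (by simp only [lowerIndex, Fin.val_succ]; omega)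

@[to_additive]
theorem prod_eq_prod_lowerIndex {M : Type*} [CommMonoid M] {m s : ℕ} (hs : s ≤ m) {f : Fin m → M}
    (hf : ∀ i, i.1 < m - s → f i = 1) : ∏ i, f i = ∏ k, f (lowerIndex hs k) := by
  rw [← Finset.prod_image (s := Finset.univ) (g := lowerIndex hs) (f := f)
    (lowerIndex_injective hs).injOn]
  refine (Finset.prod_subset (Finset.subset_univ _) fun i _ hi => hf i ?_).symm
  by_contra! hc
  obtain ⟨k, hk⟩ := exists_lowerIndex hs hc
  exact hi (Finset.mem_image.2 ⟨k, Finset.mem_univ _, hk⟩)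

/-- The diagonal entries of the switching matrix. -/
def switchingEntry (n : ℕ) {s : ℕ} (τ : Fin s → ℕ+) (i : Fin n) : ℤ := switchingMatrix n τ i i

theorem switchingMatrix_eq (n : ℕ) {s : ℕ} (τ : Fin s → ℕ+) :
    switchingMatrix n τ = Matrix.diagonal (switchingEntry n τ) := by
  ext i j
  by_cases h : i = j
  · subst h; rw [Matrix.diagonal_apply_eq]; rfl
  · rw [Matrix.diagonal_apply_ne _ h, switchingMatrix, Matrix.diagonal_apply_ne _ h]

theorem switchingEntry_of_lt {n s : ℕ} (τ : Fin s → ℕ+) {i : Fin n} (hi : i.1 < n - s) :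
    switchingEntry n τ i = 1 := by
  rw [switchingEntry, switchingMatrix, Matrix.diagonal_apply_eq, dif_neg]
  omega

theorem switchingEntry_lowerIndex {n s : ℕ} (hs : s ≤ n) (τ : Fin s → ℕ+) (k : Fin s) :
    switchingEntry n τ (lowerIndex hs k) = (τ k : ℕ) := by
  have h1 : n - s ≤ (lowerIndex hs k).1 ∧ (lowerIndex hs k).1 - (n - s) < s := by
    simp only [lowerIndex]; omega
  rw [switchingEntry, switchingMatrix, Matrix.diagonal_apply_eq, dif_pos h1]
  congr 3
  exact Fin.ext (by simp only [lowerIndex]; omega)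

/-- What a run of the algorithm amounts to: a basis of the lattice of characters, the rows of `U`,
in which the row lattice of `Λ` is spanned by multiples of all but the first row. The inverse `E`
of `U` has first column `q`, and the rows of `γ` as last columns. -/
structure AdaptedBasis {n s : ℕ} (Λ : Fin (n + 1) → Fin n → ℤ) (q : Fin (n + 1) → ℕ)
    (τ : Fin s → ℕ+) (γ : Matrix (Fin s) (Fin (n + 1)) ℤ)
    (U E : Matrix (Fin (n + 1)) (Fin (n + 1)) ℤ) : Prop where
  le : s ≤ n
  mul_inv : U * E = 1
  inv_mul : E * U = 1
  first_col : ∀ j, E j 0 = q j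
  last_cols : ∀ k j, E j (lowerIndex (le.trans n.le_succ) k) = γ k j
  transform : ∃ A : Matrix (Fin n) (Fin n) ℤ, IsUnit A ∧ ∀ i j,
    ∑ k, A i k * Λ j k = switchingEntry n τ i * U i.succ j

theorem IsTorsionMatrix.exists_adaptedBasis {n s : ℕ} {Λ : Fin (n + 1) → Fin n → ℤ}
    {q : Fin (n + 1) → ℕ} {τ : Fin s → ℕ+} {γ : Matrix (Fin s) (Fin (n + 1)) ℤ}
    (h : IsTorsionMatrix (Matrix.of Λ).transpose q τ γ) :
    ∃ U E, AdaptedBasis Λ q τ γ U E := by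
  obtain ⟨-, -, hs, L, A, u, U, W, G, U_G, ⟨-, hA, hAL⟩, ⟨hU, hUu, hUq⟩, ⟨hW, hWH⟩, hG,
    ⟨hUG, hUGH⟩, hγ⟩ := h
  have hs' : s ≤ n + 1 := hs.trans n.le_succ
  obtain ⟨⟨U, E, hUE, hEU⟩, rfl⟩ := hUu
  obtain ⟨⟨W, Z, hWZ, hZW⟩, rfl⟩ := hW
  obtain ⟨⟨V, Y, hVY, hYV⟩, rfl⟩ := hUG
  simp only at *
  have hUE' : ∀ i j, ∑ l, U i l * E l j = if i = j then 1 else 0 := fun i j => by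
    rw [← Matrix.mul_apply, hUE, Matrix.one_apply]
  have hEU' : ∀ i j, ∑ l, E i l * U l j = if i = j then 1 else 0 := fun i j => by
    rw [← Matrix.mul_apply, hEU, Matrix.one_apply]
  let up : Fin (n + 1 - s) → Fin (n + 1) := fun i => ⟨i.1, by omega⟩
  -- the first normal form: `W` is dual to the upper rows of `U`
  have hWU : ∀ (i : Fin (n + 1)) (j : Fin (n + 1 - s)),
      ∑ l, W i l * U (up j) l = if i.1 = j.1 then 1 else 0 := by
    intro i j
    have hC : (Matrix.of (fun (i : Fin (n + 1 - s)) l => E l (up i)) * Z) *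
        (W * (upperRows (n + 1 - s) (by omega) U).transpose) = 1 := by
      rw [Matrix.mul_assoc, ← Matrix.mul_assoc Z, hZW, Matrix.one_mul]
      ext i j
      rw [Matrix.mul_apply, Matrix.one_apply]
      have := hUE' (up j) (up i)
      simp only [Matrix.of_apply, Matrix.transpose_apply, upperRows]
      rw [show (∑ x, E x (up i) * U ⟨j.1, _⟩ x) = ∑ l, U (up j) l * E l (up i) from
        Finset.sum_congr rfl fun x _ => mul_comm _ _, this]
      simp only [up, Fin.ext_iff, eq_comm]
    have := hWH.eq_one hC i j
    rw [Matrix.mul_apply] at this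
    exact this
  -- hence `G` is unimodular
  let X : Matrix (Fin (n + 1)) (Fin (n + 1)) ℤ := Z.transpose * E
  have hX : (U * W.transpose) * X = 1 := by
    simp only [X]
    rw [Matrix.mul_assoc, ← Matrix.mul_assoc W.transpose, ← Matrix.transpose_mul, hZW,
      Matrix.transpose_one, Matrix.one_mul, hUE]
  have hUW : ∀ i j, (U * W.transpose) i j = ∑ l, W j l * U i l := fun i j => by
    rw [Matrix.mul_apply]
    exact Finset.sum_congr rfl fun l _ => by rw [Matrix.transpose_apply, mul_comm]
  have hXup : ∀ i j : Fin (n + 1), i.1 < n + 1 - s → X i j = if i = j then 1 else 0 := by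
    intro i j hi
    have h1 := congrFun (congrFun hX i) j
    rw [Matrix.mul_apply, Matrix.one_apply] at h1
    rw [← h1, Finset.sum_eq_single i]
    · rw [hUW, show i = up ⟨i.1, hi⟩ from rfl, hWU]; simp [up]
    · intro l _ hl
      rw [hUW, show i = up ⟨i.1, hi⟩ from rfl, hWU, if_neg, zero_mul]
      exact fun hc => hl (Fin.ext hc)
    · simp
  have hGij : ∀ i j : Fin s, G i j = ∑ l, W (lowerIndex hs' j) l * U (lowerIndex hs' i) l := by
    intro i j
    rw [hG, Matrix.mul_apply]
    refine Finset.sum_congr rfl fun l _ => ?_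
    rw [mul_comm]
    have : U (lowerIndex hs' i) l = L (lowerIndex hs i) l := by
      rw [← lowerIndex_succ hs, hU]; rfl
    rw [this]
    rfl
  have hGX : (Matrix.of fun i j : Fin s => X (lowerIndex hs' j) (lowerIndex hs' i)) *
      G.transpose = 1 := by
    ext i j
    have h1 := congrFun (congrFun hX (lowerIndex hs' j)) (lowerIndex hs' i)
    rw [Matrix.mul_apply, Matrix.one_apply, sum_eq_sum_lowerIndex hs'] at h1
    · rw [Matrix.mul_apply, Matrix.one_apply]
      simp only [Matrix.of_apply, Matrix.transpose_apply, hGij]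
      simp only [hUW] at h1
      simp only [(lowerIndex_injective hs').eq_iff] at h1
      simp only [eq_comm (a := i) (b := j)]
      rw [← h1]
      exact Finset.sum_congr rfl fun l _ => mul_comm _ _
    · intro l hl
      rw [hXup l _ hl, if_neg, mul_zero]
      intro hc
      rw [hc] at hl
      simp only [lowerIndex] at hl
      omega
  have hVG : ∀ i j : Fin s, (V * G.transpose) i j = if i = j then 1 else 0 := by
    intro i j
    have hC : ((Matrix.of fun i j : Fin s => X (lowerIndex hs' j) (lowerIndex hs' i)) * Y) *
        (V * G.transpose) = 1 := by
      rw [Matrix.mul_assoc, ← Matrix.mul_assoc Y, hYV, Matrix.one_mul, hGX]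
    rw [hUGH.eq_one hC]
    simp only [Fin.ext_iff]
  have hγU : ∀ (k : Fin s) (i : Fin (n + 1)),
      ∑ l, γ k l * U i l = if i = lowerIndex hs' k then 1 else 0 := by
    intro k i
    have h1 : ∑ l, γ k l * U i l = ∑ r, V k r * ∑ l, W (lowerIndex hs' r) l * U i l := by
      simp only [hγ, Matrix.mul_apply, Finset.sum_mul, Finset.mul_sum]
      rw [Finset.sum_comm]
      exact Finset.sum_congr rfl fun r _ => Finset.sum_congr rfl fun l _ => by
        rw [mul_assoc]; rfl
    rw [h1]
    by_cases hi : i.1 < n + 1 - s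
    · rw [if_neg]
      · refine Finset.sum_eq_zero fun r _ => ?_
        rw [show i = up ⟨i.1, hi⟩ from rfl, hWU, if_neg, mul_zero]
        simp only [lowerIndex]; omega
      · intro hc
        rw [hc] at hi
        simp only [lowerIndex] at hi
        omega
    · obtain ⟨j, rfl⟩ := exists_lowerIndex hs' (not_lt.1 hi)
      have h2 := hVG k j
      rw [Matrix.mul_apply] at h2
      simp only [Matrix.transpose_apply, hGij] at h2
      rw [h2]
      simp only [(lowerIndex_injective hs').eq_iff, eq_comm]
  refine ⟨U, E, hs, hUE, hEU, fun j => ?_, fun k j => ?_, A, hA, fun i j => ?_⟩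
  · have h1 := congrArg E.mulVec hUq
    rw [Matrix.mulVec_mulVec, hEU, Matrix.one_mulVec] at h1
    have := congrFun h1 j
    simpa using this.symm
  · have h1 : U.mulVec (γ k) = Pi.single (lowerIndex hs' k) 1 := by
      ext i
      rw [Pi.single_apply, ← hγU]
      simp only [Matrix.mulVec, dotProduct]
      exact Finset.sum_congr rfl fun l _ => mul_comm _ _
    have h2 := congrArg E.mulVec h1
    rw [Matrix.mulVec_mulVec, hEU, Matrix.one_mulVec] at h2
    have := congrFun h2 j
    simpa using this.symm
  · have h1 := congrFun (congrFun hAL i) j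
    rw [switchingMatrix_eq, Matrix.diagonal_mul, Matrix.mul_apply] at h1
    have h2 : U i.succ j = L i j := by rw [hU]; rfl
    rw [h2, ← h1]
    rfl

namespace AdaptedBasis

variable {n s : ℕ} {Λ : Fin (n + 1) → Fin n → ℤ} {q : Fin (n + 1) → ℕ}
  {τ : Fin s → ℕ+} {γ : Matrix (Fin s) (Fin (n + 1)) ℤ}
  {U E : Matrix (Fin (n + 1)) (Fin (n + 1)) ℤ}

theorem sum_mul_inv (h : AdaptedBasis Λ q τ γ U E) (i j : Fin (n + 1)) :
    ∑ l, U i l * E l j = if i = j then 1 else 0 := by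
  rw [← Matrix.mul_apply, h.mul_inv, Matrix.one_apply]

theorem sum_inv_mul (h : AdaptedBasis Λ q τ γ U E) (i j : Fin (n + 1)) :
    ∑ l, E i l * U l j = if i = j then 1 else 0 := by
  rw [← Matrix.mul_apply, h.inv_mul, Matrix.one_apply]

/-- The row lattice of `Λ` is cut out by the weights and by congruences modulo the `τ_k`. -/
theorem mem_rowLattice_iff (h : AdaptedBasis Λ q τ γ U E) (m : Fin (n + 1) → ℤ) :
    (∃ u : Fin n → ℤ, ∀ j, m j = dotProduct u (Λ j)) ↔
      ∑ j, (q j : ℤ) * m j = 0 ∧ ∀ k, ((τ k : ℕ) : ℤ) ∣ ∑ j, γ k j * m j := by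
  obtain ⟨A, ⟨⟨A, A', hA1, hA2⟩, rfl⟩, hAΛ⟩ := h.transform
  simp only at hAΛ
  have hs' : s ≤ n + 1 := h.le.trans n.le_succ
  constructor
  · rintro ⟨u, hu⟩
    -- express `m` in the rows of `U`
    let v : Fin n → ℤ := Matrix.vecMul u A'
    have huv : ∀ k, u k = ∑ i, v i * A i k := fun k => by
      have : Matrix.vecMul v A = u := by
        simp only [v]
        rw [Matrix.vecMul_vecMul, hA2, Matrix.vecMul_one]
      rw [← congrFun this k]; rfl
    have hm : ∀ j, m j = ∑ i, (v i * switchingEntry n τ i) * U i.succ j := by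
      intro j
      rw [hu, dotProduct]
      simp only [huv, Finset.sum_mul, mul_assoc]
      rw [Finset.sum_comm]
      simp only [← Finset.mul_sum, hAΛ]
    have hsum : ∀ r, ∑ j, m j * E j r = ∑ i, (v i * switchingEntry n τ i) *
        if i.succ = r then 1 else 0 := by
      intro r
      simp only [hm, Finset.sum_mul, mul_assoc]
      rw [Finset.sum_comm]
      simp only [← Finset.mul_sum, h.sum_mul_inv]
    constructor
    · have h0 := hsum 0
      simp only [h.first_col, Fin.succ_ne_zero, if_false, mul_zero, Finset.sum_const_zero] at h0
      rw [← h0]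
      exact Finset.sum_congr rfl fun j _ => mul_comm _ _
    · intro k
      have h0 := hsum (lowerIndex h.le k).succ
      have hγ : ∀ j, E j (lowerIndex h.le k).succ = γ k j := fun j => by
        rw [lowerIndex_succ]; exact h.last_cols k j
      simp only [hγ, Fin.succ_inj, mul_ite, mul_one, mul_zero,
        Finset.sum_ite_eq', Finset.mem_univ, if_true, switchingEntry_lowerIndex] at h0
      rw [show ∑ j, γ k j * m j = ∑ j, m j * γ k j from
        Finset.sum_congr rfl fun j _ => mul_comm _ _, h0]
      exact dvd_mul_left _ _
  · rintro ⟨h0, hk⟩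
    let y : Fin (n + 1) → ℤ := fun i => ∑ j, m j * E j i
    have hy0 : y 0 = 0 := by
      simp only [y, h.first_col]
      rw [← h0]
      exact Finset.sum_congr rfl fun j _ => mul_comm _ _
    have hm : ∀ j, m j = ∑ i : Fin n, y i.succ * U i.succ j := by
      intro j
      have h1 : ∑ i, y i * U i j = m j := by
        simp only [y, Finset.sum_mul, mul_assoc]
        rw [Finset.sum_comm]
        simp only [← Finset.mul_sum, h.sum_inv_mul]
        simp
      rw [← h1, Fin.sum_univ_succ, hy0, zero_mul, zero_add]
    have hdvd : ∀ i : Fin n, ∃ v, y i.succ = v * switchingEntry n τ i := by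
      intro i
      by_cases hi : i.1 < n - s
      · exact ⟨y i.succ, by rw [switchingEntry_of_lt τ hi, mul_one]⟩
      · obtain ⟨k, rfl⟩ := exists_lowerIndex h.le (not_lt.1 hi)
        obtain ⟨v, hv⟩ := hk k
        refine ⟨v, ?_⟩
        rw [switchingEntry_lowerIndex, mul_comm, ← hv]
        simp only [y, lowerIndex_succ h.le, h.last_cols]
        exact Finset.sum_congr rfl fun j _ => mul_comm _ _
    choose v hv using hdvd
    refine ⟨fun k => ∑ i, v i * A i k, fun j => ?_⟩
    rw [hm, dotProduct]
    simp only [Finset.sum_mul, mul_assoc]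
    rw [Finset.sum_comm]
    simp only [← Finset.mul_sum, hAΛ, hv, mul_assoc]

theorem weights_dot_eq_zero (h : AdaptedBasis Λ q τ γ U E) (u : Fin n → ℤ) :
    ∑ j, (q j : ℤ) * dotProduct u (Λ j) = 0 :=
  ((h.mem_rowLattice_iff fun j => dotProduct u (Λ j)).1 ⟨u, fun _ => rfl⟩).1

theorem dvd_sum_mul_dot (h : AdaptedBasis Λ q τ γ U E) (u : Fin n → ℤ) (k : Fin s) :
    ((τ k : ℕ) : ℤ) ∣ ∑ j, γ k j * dotProduct u (Λ j) :=
  ((h.mem_rowLattice_iff fun j => dotProduct u (Λ j)).1 ⟨u, fun _ => rfl⟩).2 k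

end AdaptedBasis

theorem prod_zpow_eq_zpow_sum {G ι : Type*} [CommGroup G] (z : G) (f : ι → ℤ) (s : Finset ι) :
    z ^ ∑ j ∈ s, f j = ∏ j ∈ s, z ^ f j := by
  classical
  induction s using Finset.induction_on with
  | empty => simp
  | insert a s ha ih => rw [Finset.prod_insert ha, Finset.sum_insert ha, zpow_add, ih]

theorem exists_stdAddChar_eq {N : ℕ} [NeZero N] {z : ℂ} (hz : z ^ N = 1) :
    ∃ e : ZMod N, ZMod.stdAddChar e = z := by
  have hz0 : z ≠ 0 := by
    rintro rfl
    rw [zero_pow (NeZero.ne N)] at hz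
    exact zero_ne_one hz
  obtain ⟨i, -, hi⟩ := (Complex.mem_rootsOfUnity N (Units.mk0 z hz0)).1 (by
    rw [mem_rootsOfUnity]; ext; simpa using hz)
  refine ⟨(i : ℤ), ?_⟩
  rw [ZMod.stdAddChar_coe]
  simp only [Units.val_mk0] at hi
  rw [← hi]
  congr 1
  push_cast
  ring

theorem torsionCoeff_eq_prod_zpow {m s : ℕ} {τ : Fin s → ℕ+} (γ : Matrix (Fin s) (Fin m) ℤ)
    (ε : ∀ k, ZMod (τ k)) (j : Fin m) :
    torsionCoeff γ ε j = ∏ k, (ZMod.stdAddChar (ε k) : ℂ) ^ (γ k j) := by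
  unfold torsionCoeff
  refine Finset.prod_congr rfl fun k _ => ?_
  rw [← AddChar.map_zsmul_eq_zpow, zsmul_eq_mul]

namespace AdaptedBasis

variable {n s : ℕ} {Λ : Fin (n + 1) → Fin n → ℤ} {q : Fin (n + 1) → ℕ}
  {τ : Fin s → ℕ+} {γ : Matrix (Fin s) (Fin (n + 1)) ℤ}
  {U E : Matrix (Fin (n + 1)) (Fin (n + 1)) ℤ}

/-- The kernel of the map of tori defined by `Λ` is generated by the weighted action of `ℂ^*` and
the torsion group. -/
theorem exists_of_kernel (h : AdaptedBasis Λ q τ γ U E) (t : Fin (n + 1) → ℂˣ)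
    (ht : ∀ u : Fin n → ℤ, ∏ j, t j ^ dotProduct u (Λ j) = 1) :
    ∃ (y : ℂˣ) (ε : ∀ k, ZMod (τ k)), ∀ j, (t j : ℂ) = (y : ℂ) ^ q j * torsionCoeff γ ε j := by
  obtain ⟨A, -, hAΛ⟩ := h.transform
  have hs' : s ≤ n + 1 := h.le.trans n.le_succ
  let ω : Fin (n + 1) → ℂˣ := fun i => ∏ j, t j ^ U i j
  have hω : ∀ i : Fin n, ω i.succ ^ switchingEntry n τ i = 1 := by
    intro i
    rw [← ht (A i)]
    simp only [ω, ← Finset.prod_zpow, ← zpow_mul, dotProduct, hAΛ]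
    exact Finset.prod_congr rfl fun j _ => by rw [mul_comm]
  have hε : ∀ k, ∃ e : ZMod (τ k), ZMod.stdAddChar e = (ω (lowerIndex hs' k) : ℂ) := by
    intro k
    refine exists_stdAddChar_eq ?_
    have h1 := hω (lowerIndex h.le k)
    rw [switchingEntry_lowerIndex, lowerIndex_succ h.le, zpow_natCast] at h1
    rw [← Units.val_pow_eq_pow_val, h1, Units.val_one]
  choose ε hε using hε
  refine ⟨ω 0, ε, fun j => ?_⟩
  have h1 : t j = ∏ i, ω i ^ E j i := by
    simp only [ω, ← Finset.prod_zpow, ← zpow_mul]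
    rw [Finset.prod_comm]
    have : ∀ y, ∏ x, t y ^ (U x y * E j x) = t y ^ (if j = y then 1 else 0 : ℤ) := by
      intro y
      rw [← h.sum_inv_mul j y, prod_zpow_eq_zpow_sum]
      exact Finset.prod_congr rfl fun x _ => by rw [mul_comm]
    simp only [this]
    simp
  rw [torsionCoeff_eq_prod_zpow]
  simp only [hε, ← h.last_cols]
  rw [h1, Fin.prod_univ_succ, prod_eq_prod_lowerIndex h.le]
  · rw [h.first_col, zpow_natCast]
    push_cast
    simp only [lowerIndex_succ h.le]
  · intro i hi
    have := hω i
    rw [switchingEntry_of_lt τ hi, zpow_one] at this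
    rw [this, one_zpow]

theorem prod_zpow_eq_one (h : AdaptedBasis Λ q τ γ U E) {y : ℂ} (hy : y ≠ 0)
    (ε : ∀ k, ZMod (τ k)) (u : Fin n → ℤ) :
    ∏ j, (y ^ q j * torsionCoeff γ ε j) ^ dotProduct u (Λ j) = 1 := by
  simp only [mul_zpow, Finset.prod_mul_distrib, torsionCoeff_eq_prod_zpow, ← zpow_natCast,
    ← zpow_mul, ← Finset.prod_zpow]
  have hprod : ∀ (z : ℂ), z ≠ 0 → ∀ f : Fin (n + 1) → ℤ, ∏ j, z ^ f j = z ^ ∑ j, f j := by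
    intro z hz f
    induction (Finset.univ : Finset (Fin (n + 1))) using Finset.induction_on with
    | empty => simp
    | insert a s ha ih => rw [Finset.prod_insert ha, Finset.sum_insert ha, ih, zpow_add₀ hz]
  rw [hprod y hy, h.weights_dot_eq_zero, zpow_zero, one_mul, Finset.prod_comm]
  refine Finset.prod_eq_one fun k _ => ?_
  have hz : (ZMod.stdAddChar (ε k) : ℂ) ≠ 0 := by
    intro hc
    have := AddChar.map_add_eq_mul (ZMod.stdAddChar (N := τ k)) (ε k) (-(ε k))
    rw [hc, zero_mul, add_neg_cancel, AddChar.map_zero_eq_one] at this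
    exact one_ne_zero this
  rw [hprod _ hz]
  obtain ⟨c, hc⟩ := h.dvd_sum_mul_dot u k
  rw [hc, ← AddChar.map_zsmul_eq_zpow, zsmul_eq_mul]
  push_cast
  simp

end AdaptedBasis

/-! ### The order of the group -/

/-- With `A = ∑ a_i`, the columns of the matrix are `A e_j - a`: a rank one perturbation of a scalar
matrix. -/
theorem det_vertexVec {n : ℕ} {a : Fin (n + 1) → ℕ} (ha : ∀ i, 0 < a i) (hn : 0 < n) :
    (Matrix.of fun k j : Fin n => vertexVec a j.castSucc k).det =
      (∑ i, (a i : ℤ)) ^ (n - 1) * a (Fin.last n) := by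
  have hA : (0 : ℚ) < ∑ i, (a i : ℚ) :=
    Finset.sum_pos (fun i _ => by exact_mod_cast ha i) Finset.univ_nonempty
  set A : ℚ := ∑ i, (a i : ℚ) with hAdef
  have h1 : ((Matrix.of fun k j : Fin n => vertexVec a j.castSucc k).map (Int.castRingHom ℚ)) =
      A • (1 + Matrix.replicateCol Unit (fun k : Fin n => -(a k.castSucc : ℚ) / A) *
        Matrix.replicateRow Unit (fun _ : Fin n => (1 : ℚ))) := by
    ext k j
    simp only [Matrix.map_apply, Matrix.of_apply, vertexVec, Matrix.smul_apply, Matrix.add_apply,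
      Matrix.one_apply, Matrix.mul_apply, Fin.castSucc_inj]
    simp
    by_cases h : j = k
    · subst h
      simp only [if_pos]
      rw [← hAdef]
      field_simp
      ring
    · simp [h, Ne.symm h]
      field_simp
  have h2 : ((Matrix.of fun k j : Fin n => vertexVec a j.castSucc k).det : ℚ) =
      A ^ (n - 1) * a (Fin.last n) := by
    have h3 := RingHom.map_det (Int.castRingHom ℚ)
      (Matrix.of fun k j : Fin n => vertexVec a j.castSucc k)
    rw [RingHom.mapMatrix_apply, h1, Matrix.det_smul,
      Matrix.det_one_add_replicateCol_mul_replicateRow, Fintype.card_fin] at h3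
    rw [eq_intCast] at h3
    rw [h3]
    have h4 : dotProduct (fun _ : Fin n => (1 : ℚ)) (fun k : Fin n => -(a k.castSucc : ℚ) / A) =
        -(A - a (Fin.last n)) / A := by
      simp only [dotProduct, one_mul]
      rw [← Finset.sum_div, Finset.sum_neg_distrib, hAdef, Fin.sum_univ_castSucc]
      ring
    rw [h4]
    obtain ⟨k, rfl⟩ : ∃ k, n = k + 1 := ⟨n - 1, by omega⟩
    rw [Nat.add_sub_cancel, pow_succ]
    field_simp
    ring
  have h5 : A = ((∑ i, (a i : ℤ) : ℤ) : ℚ) := by push_cast; rfl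
  rw [h5] at h2
  exact_mod_cast h2

theorem det_dualRay {n : ℕ} {a : Fin (n + 1) → ℕ} (ha : ∀ i, 0 < a i) (hn : 0 < n)
    (hg : Finset.univ.gcd a = 1) : (Matrix.of fun k j : Fin n => dualRay a j.castSucc k).det =
      (∑ i, (a i : ℤ)) ^ (n - 1) * reducedWeights a (Fin.last n) := by
  have h1 := det_vertexVec ha hn
  have h2 : (Matrix.of fun k j : Fin n => vertexVec a j.castSucc k) =
      (Matrix.of fun k j : Fin n => dualRay a j.castSucc k) *
        Matrix.diagonal fun j : Fin n => (gcdOthers a j.castSucc : ℤ) := by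
    ext k j
    rw [Matrix.mul_diagonal, Matrix.of_apply, Matrix.of_apply, ← gcdOthers_smul_dualRay]
    simp [mul_comm]
  rw [h2, Matrix.det_mul, Matrix.det_diagonal] at h1
  have h3 := reducedWeights_mul_prod hg (Fin.last n)
  rw [Fin.prod_univ_castSucc, ← mul_assoc] at h3
  have h4 := Nat.eq_of_mul_eq_mul_right (gcdOthers_pos hn ha _) h3
  have h5 : (a (Fin.last n) : ℤ) =
      reducedWeights a (Fin.last n) * ∏ j : Fin n, (gcdOthers a j.castSucc : ℤ) := by
    exact_mod_cast h4.symm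
  rw [h5, ← mul_assoc] at h1
  refine mul_right_cancel₀ (Finset.prod_ne_zero_iff.2 fun j _ => ?_) h1
  exact_mod_cast (gcdOthers_pos hn ha _).ne'

/-- Up to unimodular matrices, `Λ` is the matrix formed by all rows of `U` but the first, multiplied by
`diag(1, …, 1, τ_1, …, τ_s)`. As the maximal minors of those rows of `U` are the weights up to sign, a
minor of `Λ` determines the product of the `τ_k`. -/
theorem AdaptedBasis.prod_torsion {n s : ℕ} {a : Fin (n + 1) → ℕ} (ha : ∀ i, 0 < a i)
    (hn : 0 < n) (hg : Finset.univ.gcd a = 1) {τ : Fin s → ℕ+}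
    {γ : Matrix (Fin s) (Fin (n + 1)) ℤ} {U E : Matrix (Fin (n + 1)) (Fin (n + 1)) ℤ}
    (h : AdaptedBasis (dualRay a) (reducedWeights a) τ γ U E) :
    ∏ k, (τ k : ℕ) = (∑ i, a i) ^ (n - 1) := by
  obtain ⟨A, hA, hAΛ⟩ := h.transform
  have hq := reducedWeights_pos ha (Fin.last n)
  -- compare the minors that omit the last column
  have h1 : A * (Matrix.of fun k j : Fin n => dualRay a j.castSucc k) =
      Matrix.diagonal (switchingEntry n τ) *
        U.submatrix (Fin.succAbove 0) (Fin.succAbove (Fin.last n)) := by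
    ext i j
    rw [Matrix.diagonal_mul, Matrix.mul_apply]
    simp only [Matrix.of_apply, Matrix.submatrix_apply, Fin.succAbove_zero, Fin.succAbove_last]
    exact hAΛ i j.castSucc
  have h2 := congrArg (fun M => M.det.natAbs) h1
  simp only [Matrix.det_mul, Matrix.det_diagonal, Int.natAbs_mul, det_dualRay ha hn hg] at h2
  have hAu : A.det.natAbs = 1 := Int.isUnit_iff_natAbs_eq.1 ((Matrix.isUnit_iff_isUnit_det _).1 hA)
  have hUu : U.det.natAbs = 1 := by
    refine Int.isUnit_iff_natAbs_eq.1 (IsUnit.of_mul_eq_one E.det ?_)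
    rw [← Matrix.det_mul, h.mul_inv, Matrix.det_one]
  have h3 : (U.submatrix (Fin.succAbove 0) (Fin.succAbove (Fin.last n))).det.natAbs =
      reducedWeights a (Fin.last n) := by
    have h4 := Matrix.adjugate_fin_succ_eq_det_submatrix U (Fin.last n) 0
    have h5 : U.adjugate = U.det • E := by
      have : U.adjugate * (U * E) = U.det • E := by
        rw [← Matrix.mul_assoc, Matrix.adjugate_mul, Matrix.smul_mul, Matrix.one_mul]
      rwa [h.mul_inv, Matrix.mul_one] at this
    rw [h5, Matrix.smul_apply, h.first_col, smul_eq_mul] at h4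
    have h6 := congrArg Int.natAbs h4
    rw [Int.natAbs_mul, Int.natAbs_mul, hUu, Int.natAbs_pow] at h6
    simpa using h6.symm
  have h7 : (∏ i, switchingEntry n τ i).natAbs = ∏ k, (τ k : ℕ) := by
    rw [prod_eq_prod_lowerIndex h.le fun i hi => switchingEntry_of_lt τ hi]
    simp only [switchingEntry_lowerIndex]
    rw [← Nat.cast_prod, Int.natAbs_natCast]
  rw [hAu, h3, h7, one_mul, Int.natAbs_natCast, Int.natAbs_pow] at h2
  have h8 : (∑ i, (a i : ℤ)).natAbs = ∑ i, a i := by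
    rw [← Nat.cast_sum, Int.natAbs_natCast]
  rw [h8] at h2
  exact (Nat.eq_of_mul_eq_mul_right hq h2).symm

/-! ### Smith normal form with divisibility -/

section Smith

variable {M N : Type} [AddCommGroup M] [AddCommGroup N]

/-- A functional `φ` all of whose values are multiples of `φ y` splits off the vector `y`. -/
theorem exists_sub_smul_mem_ker {φ : M →ₗ[ℤ] ℤ} {y : M} (hd : ∀ z, φ y ∣ φ z) (z : M) :
    ∃ c : ℤ, z + c • y ∈ LinearMap.ker φ := by
  obtain ⟨k, hk⟩ := hd z
  refine ⟨-k, ?_⟩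
  rw [LinearMap.mem_ker, map_add, map_smul, hk, smul_eq_mul]
  ring

theorem eq_zero_of_smul_add_mem_ker {φ : M →ₗ[ℤ] ℤ} {y : M} (hy : φ y ≠ 0) (c : ℤ) (x : M)
    (hx : x ∈ LinearMap.ker φ) (h : c • y + x = 0) : c = 0 := by
  have h1 := congrArg φ h
  rw [map_add, map_smul, LinearMap.mem_ker.1 hx, add_zero, map_zero, smul_eq_mul] at h1
  exact (mul_eq_zero.1 h1).resolve_right hy

theorem finrank_ker_add_one [Module.Free ℤ M] [Module.Finite ℤ M] {φ : M →ₗ[ℤ] ℤ} {y : M}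
    (hy : φ y ≠ 0) (hd : ∀ z, φ y ∣ φ z) :
    Module.finrank ℤ (LinearMap.ker φ) + 1 = Module.finrank ℤ M := by
  have b := Module.Basis.mkFinCons y (Module.finBasis ℤ (LinearMap.ker φ))
    (eq_zero_of_smul_add_mem_ker hy) (exists_sub_smul_mem_ker hd)
  rw [Module.finrank_eq_card_basis b, Fintype.card_fin]

/-- Smith normal form with divisibility, for an injective map of free modules of equal rank. The first
invariant factor `d` is the least positive value of a functional on the image; it divides all such
values, so that the map splits off multiplication by `d`. -/
theorem exists_smith_bases (n : ℕ) : ∀ (M N : Type) [AddCommGroup M] [AddCommGroup N]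
    [Module.Free ℤ M] [Module.Finite ℤ M] [Module.Free ℤ N] [Module.Finite ℤ N]
    (f : M →ₗ[ℤ] N) (_ : Function.Injective f) (_ : Module.finrank ℤ M = n)
    (_ : Module.finrank ℤ N = n),
    ∃ (b : Module.Basis (Fin n) ℤ M) (c : Module.Basis (Fin n) ℤ N) (β : Fin n → ℕ),
      (∀ i, 0 < β i) ∧ (∀ i, f (b i) = (β i : ℤ) • c i) ∧ ∀ i j, i ≤ j → β i ∣ β j := by
  induction n with
  | zero =>
    intro M N _ _ _ _ _ _ f _ hM hN
    exact ⟨Module.finBasisOfFinrankEq ℤ M hM, Module.finBasisOfFinrankEq ℤ N hN, fun _ => 1,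
      fun i => i.elim0, fun i => i.elim0, fun i => i.elim0⟩
  | succ n ih =>
    intro M N _ _ _ _ _ _ f hf hM hN
    -- `d` is the least positive value of a functional on the image of `f`
    have hex : ∃ d : ℕ, 0 < d ∧ ∃ (φ : N →ₗ[ℤ] ℤ) (y : M), φ (f y) = d := by
      let b := Module.finBasisOfFinrankEq ℤ M hM
      let c := Module.finBasisOfFinrankEq ℤ N hN
      have h0 : f (b 0) ≠ 0 := fun hc => b.ne_zero 0 (hf (by rw [hc, map_zero]))
      obtain ⟨j, hj⟩ : ∃ j, c.coord j (f (b 0)) ≠ 0 := by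
        by_contra! hc
        exact h0 (c.ext_elem fun j => by simpa using hc j)
      rcases lt_or_gt_of_ne hj with h | h
      · exact ⟨(c.coord j (f (b 0))).natAbs, Int.natAbs_pos.2 hj, -c.coord j, b 0, by
          rw [LinearMap.neg_apply]; omega⟩
      · exact ⟨(c.coord j (f (b 0))).natAbs, Int.natAbs_pos.2 hj, c.coord j, b 0, by omega⟩
    classical
    obtain ⟨hd0, φ, y, hφy⟩ := Nat.find_spec hex
    set d := Nat.find hex with hd
    have hdpos : (0 : ℤ) < d := by exact_mod_cast hd0
    have hmin : ∀ (ψ : N →ₗ[ℤ] ℤ) (x : M), 0 < ψ (f x) → (d : ℤ) ≤ ψ (f x) := by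
      intro ψ x hx
      have := Nat.find_min' hex (m := (ψ (f x)).toNat) ⟨by omega, ψ, x, by omega⟩
      omega
    have hmod : ∀ (ψ : N →ₗ[ℤ] ℤ) (x : M), (d : ℤ) ∣ ψ (f x) ∨
        ∃ r, 0 < r ∧ r < (d : ℤ) ∧ r = ψ (f x) - ψ (f x) / d * d := by
      intro ψ x
      have h1 := Int.emod_add_mul_ediv (ψ (f x)) d
      have h2 := Int.emod_nonneg (ψ (f x)) hdpos.ne'
      have h3 := Int.emod_lt_of_pos (ψ (f x)) hdpos
      rcases h2.eq_or_lt with h | h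
      · exact Or.inl (Int.dvd_of_emod_eq_zero h.symm)
      · exact Or.inr ⟨_, h, h3, by linarith⟩
    have hdvd₁ : ∀ (ψ : N →ₗ[ℤ] ℤ) (_ : ψ (f y) = d) (x : M), (d : ℤ) ∣ ψ (f x) := by
      intro ψ hψ x
      refine (hmod ψ x).resolve_right ?_
      rintro ⟨r, h1, h2, h3⟩
      have h4 : ψ (f (x - (ψ (f x) / d) • y)) = r := by
        rw [map_sub, map_smul, map_sub, map_smul, hψ, smul_eq_mul, h3]
      have := hmin ψ (x - (ψ (f x) / d) • y) (by rw [h4]; exact h1)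
      rw [h4] at this
      omega
    have hdvd₂ : ∀ ψ : N →ₗ[ℤ] ℤ, (d : ℤ) ∣ ψ (f y) := by
      intro ψ
      refine (hmod ψ y).resolve_right ?_
      rintro ⟨r, h1, h2, h3⟩
      have h4 : (ψ - (ψ (f y) / d) • φ) (f y) = r := by
        rw [LinearMap.sub_apply, LinearMap.smul_apply, hφy, smul_eq_mul, h3]
      have := hmin (ψ - (ψ (f y) / d) • φ) y (by rw [h4]; exact h1)
      rw [h4] at this
      omega
    obtain ⟨c₀, hc₀⟩ : ∃ c₀, f y = (d : ℤ) • c₀ := by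
      let c := Module.finBasisOfFinrankEq ℤ N hN
      choose k hk using fun i => hdvd₂ (c.coord i)
      refine ⟨∑ i, k i • c i, c.ext_elem fun i => ?_⟩
      have := hk i
      rw [Module.Basis.coord_apply] at this
      rw [this, map_smul, Finsupp.smul_apply, Module.Basis.repr_sum_self, smul_eq_mul]
    have hφc : φ c₀ = 1 := by
      rw [hc₀, map_smul, smul_eq_mul] at hφy
      exact mul_left_cancel₀ hdpos.ne' (by rw [hφy, mul_one])
    -- `d` divides all values of functionals on the image
    have hdvd : ∀ (ψ : N →ₗ[ℤ] ℤ) (x : M), φ (f x) = 0 → (d : ℤ) ∣ ψ (f x) := by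
      intro ψ x hx
      have h1 := hdvd₁ (ψ - ψ c₀ • φ + φ) (by
        simp only [LinearMap.add_apply, LinearMap.sub_apply, LinearMap.smul_apply, hc₀, map_smul,
          hφc, smul_eq_mul]
        ring) x
      simpa [hx] using h1
    have hy : (φ ∘ₗ f) y ≠ 0 := by
      rw [LinearMap.comp_apply, hφy]; exact hdpos.ne'
    have hyd : ∀ z, (φ ∘ₗ f) y ∣ (φ ∘ₗ f) z := fun z => by
      rw [LinearMap.comp_apply, hφy]; exact hdvd₁ φ hφy z
    have hc1 : φ c₀ ≠ 0 := by rw [hφc]; exact one_ne_zero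
    have hcd : ∀ z, φ c₀ ∣ φ z := fun z => by rw [hφc]; exact one_dvd _
    let f' : LinearMap.ker (φ ∘ₗ f) →ₗ[ℤ] LinearMap.ker φ :=
      f.restrict fun x hx => by simpa using hx
    have hf' : Function.Injective f' := fun x x' h => Subtype.ext (hf (congrArg Subtype.val h))
    have h1 := finrank_ker_add_one hy hyd
    have h2 := finrank_ker_add_one hc1 hcd
    obtain ⟨b, c, β, hβ, hbc, hdiv⟩ := ih _ _ f' hf' (by omega) (by omega)
    have hdβ : ∀ i, d ∣ β i := by
      intro i
      have hsplit : ∀ z, φ (z - φ z • c₀) = 0 := fun z => by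
        rw [map_sub, map_smul, hφc, smul_eq_mul, mul_one, sub_self]
      let π : N →ₗ[ℤ] LinearMap.ker φ :=
        (LinearMap.id - φ.smulRight c₀).codRestrict _ fun z => by
          rw [LinearMap.mem_ker]; exact hsplit z
      have h3 := hdvd (c.coord i ∘ₗ π) (b i).1 (LinearMap.mem_ker.1 (b i).2)
      have h4 : π (f (b i).1) = f' (b i) := by
        have h5 : φ (f (b i).1) = 0 := LinearMap.mem_ker.1 (b i).2
        refine Subtype.ext ?_
        change f (b i).1 - φ (f (b i).1) • c₀ = f (b i).1
        rw [h5, zero_smul, sub_zero]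
      rw [LinearMap.comp_apply, h4, hbc, map_smul, Module.Basis.coord_apply,
        Module.Basis.repr_self, Finsupp.single_eq_same, smul_eq_mul, mul_one] at h3
      exact_mod_cast h3
    refine ⟨Module.Basis.mkFinCons y b (eq_zero_of_smul_add_mem_ker hy)
      (exists_sub_smul_mem_ker hyd), Module.Basis.mkFinCons c₀ c (eq_zero_of_smul_add_mem_ker hc1)
      (exists_sub_smul_mem_ker hcd), Fin.cons d β, ?_, ?_, ?_⟩
    · exact Fin.cases hd0 hβ
    · refine Fin.cases ?_ fun i => ?_
      · simpa using hc₀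
      · have h3 : f (b i).1 = ((β i : ℤ) • c i : LinearMap.ker φ).1 := congrArg Subtype.val (hbc i)
        simpa using h3
    · refine Fin.cases (fun j _ => ?_) fun i => Fin.cases (fun h => ?_) fun j h => ?_
      · refine Fin.cases ?_ (fun j => ?_) j
        · exact dvd_rfl
        · simpa using hdβ j
      · exact absurd h (by simp)
      · simpa using hdiv i j (by simpa using h)

end Smith

/-- The algorithm can be run: adapted bases of `ℤⁿ` and of the lattice orthogonal to `q` provide
all the matrices. -/
theorem exists_isTorsionMatrix {n : ℕ} {Λ : Fin (n + 1) → Fin n → ℤ} {q : Fin (n + 1) → ℕ}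
    (hΛ : ∀ u : Fin n → ℤ, (∀ j, dotProduct u (Λ j) = 0) → u = 0)
    (hq : ∀ u : Fin n → ℤ, ∑ j, (q j : ℤ) * dotProduct u (Λ j) = 0)
    {u : Fin (n + 1) → ℤ} (hu : ∑ j, (q j : ℤ) * u j = 1) :
    ∃ (s : ℕ) (τ : Fin s → ℕ+) (γ : Matrix (Fin s) (Fin (n + 1)) ℤ),
      IsTorsionMatrix (Matrix.of Λ).transpose q τ γ := by
  let qm : (Fin (n + 1) → ℤ) →ₗ[ℤ] ℤ := Fintype.linearCombination ℤ (fun j => (q j : ℤ))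
  have hqm : ∀ m, qm m = ∑ j, (q j : ℤ) * m j := fun m => by
    rw [Fintype.linearCombination_apply]
    exact Finset.sum_congr rfl fun j _ => by rw [smul_eq_mul, mul_comm]
  have hqu : qm u = 1 := by rw [hqm, hu]
  have hq0 : qm u ≠ 0 := by rw [hqu]; exact one_ne_zero
  have hqd : ∀ z, qm u ∣ qm z := fun z => by rw [hqu]; exact one_dvd _
  let f : (Fin n → ℤ) →ₗ[ℤ] LinearMap.ker qm :=
    ((Matrix.of Λ).mulVecLin).codRestrict _ fun v => by
      rw [LinearMap.mem_ker, hqm, ← hq v]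
      exact Finset.sum_congr rfl fun j _ => congrArg (fun x => (q j : ℤ) * x) (dotProduct_comm (Λ j) v)
  have hf : ∀ v j, (f v).1 j = dotProduct v (Λ j) := fun v j => dotProduct_comm (Λ j) v
  have hfi : Function.Injective f := by
    refine (injective_iff_map_eq_zero f).2 fun v hv => hΛ v fun j => ?_
    rw [← hf, hv]; rfl
  have hfr := finrank_ker_add_one hq0 hqd
  rw [Module.finrank_fin_fun] at hfr
  obtain ⟨b, c, β, hβ, hbc, hdiv⟩ := exists_smith_bases n _ _ f hfi (Module.finrank_fin_fun ℤ)
    (by omega)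
  let C := Module.Basis.mkFinCons u c (eq_zero_of_smul_add_mem_ker hq0)
    (exists_sub_smul_mem_ker hqd)
  let L : Matrix (Fin n) (Fin (n + 1)) ℤ := fun i => (c i).1
  let A : Matrix (Fin n) (Fin n) ℤ := fun i => b i
  let U : Matrix (Fin (n + 1)) (Fin (n + 1)) ℤ := Matrix.of (Fin.cons u L)
  have hA : IsUnit A := by
    have : A = ((Pi.basisFun ℤ (Fin n)).toMatrix b).transpose := by
      ext i j
      rw [Matrix.transpose_apply, Module.Basis.toMatrix_apply, Pi.basisFun_repr]
    rw [this, Matrix.isUnit_transpose]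
    let _ := (Pi.basisFun ℤ (Fin n)).invertibleToMatrix b
    exact isUnit_of_invertible _
  have hU : IsUnit U := by
    have : U = ((Pi.basisFun ℤ (Fin (n + 1))).toMatrix C).transpose := by
      ext i j
      rw [Matrix.transpose_apply, Module.Basis.toMatrix_apply, Pi.basisFun_repr,
        Module.Basis.coe_mkFinCons]
      rfl
    rw [this, Matrix.isUnit_transpose]
    let _ := (Pi.basisFun ℤ (Fin (n + 1))).invertibleToMatrix C
    exact isUnit_of_invertible _
  obtain ⟨⟨U', E, hUE, hEU⟩, hU'⟩ := id hU
  obtain rfl : U' = U := hU'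
  have hUE' : ∀ i j, ∑ l, U i l * E l j = if i = j then 1 else 0 := fun i j => by
    rw [← Matrix.mul_apply, hUE, Matrix.one_apply]
  have hE : IsUnit E := ⟨⟨E, U, hEU, hUE⟩, rfl⟩
  have hUL : ∀ i j, U i.succ j = L i j := fun i j => rfl
  have hcq : ∀ i, ∑ j, L i j * (q j : ℤ) = 0 := fun i => by
    rw [← LinearMap.mem_ker.1 (c i).2, hqm]
    exact Finset.sum_congr rfl fun j _ => mul_comm _ _
  -- the trivial invariant factors come first
  classical
  have hex : ∃ t, ∀ i : Fin n, t ≤ i.1 → β i ≠ 1 := ⟨n, fun i hi => absurd i.2 (not_lt.2 hi)⟩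
  obtain ⟨t, ht, htmin⟩ : ∃ t, (∀ i : Fin n, t ≤ i.1 → β i ≠ 1) ∧ ∀ i : Fin n, i.1 < t → β i = 1 := by
    refine ⟨Nat.find hex, Nat.find_spec hex, fun i hi => ?_⟩
    have := Nat.find_min hex hi
    push Not at this
    obtain ⟨j, hij, hj⟩ := this
    exact Nat.dvd_one.1 (hj ▸ hdiv i j hij)
  have hs : n - t ≤ n := Nat.sub_le _ _
  let τ : Fin (n - t) → ℕ+ := fun k => ⟨β (lowerIndex hs k), hβ _⟩
  have hτ : ∀ i, switchingEntry n τ i = β i := by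
    intro i
    by_cases hi : i.1 < n - (n - t)
    · rw [switchingEntry_of_lt τ hi, htmin i (by omega), Nat.cast_one]
    · obtain ⟨k, rfl⟩ := exists_lowerIndex hs (not_lt.1 hi)
      rw [switchingEntry_lowerIndex]
      rfl
  have hs' : n - t ≤ n + 1 := by omega
  refine ⟨n - t, τ, lowerRows (n - t) hs' E.transpose, fun k => ?_, fun k l hkl => ?_, hs, L, A, u,
    U, E.transpose, 1, 1, ⟨⟨?_, ?_⟩, hA, ?_⟩, ⟨rfl, hU, ?_⟩,
    ⟨(Matrix.isUnit_transpose E).2 hE, ?_⟩, ?_, ⟨isUnit_one, ?_⟩, ?_⟩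
  · have h1 : (τ k : ℕ) ≠ 1 := ht _ (by simp only [lowerIndex]; omega)
    have h2 : 0 < (τ k : ℕ) := (τ k).pos
    rw [← PNat.coe_lt_coe, PNat.one_coe]
    omega
  · refine hdiv _ _ ?_
    rw [Fin.le_def] at hkl ⊢
    simp only [lowerIndex]
    omega
  · rw [Submodule.eq_top_iff']
    intro v
    have hv : v = ∑ j, (∑ i : Fin n, E j i.succ * v i) • L.col j := by
      ext k
      rw [Finset.sum_apply]
      simp only [Pi.smul_apply, smul_eq_mul, Matrix.col_apply, Finset.sum_mul]
      rw [Finset.sum_comm]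
      have : ∀ i : Fin n, ∑ j, E j i.succ * v i * L k j = v i * if k = i then 1 else 0 := by
        intro i
        have h1 := hUE' k.succ i.succ
        simp only [Fin.succ_inj] at h1
        rw [← h1, Finset.mul_sum]
        exact Finset.sum_congr rfl fun j _ => by rw [hUL]; ring
      simp [this]
    rw [hv]
    exact Submodule.sum_mem _ fun j _ => Submodule.smul_mem _ _ (Submodule.subset_span ⟨j, rfl⟩)
  · ext i
    exact hcq i
  · ext i j
    rw [switchingMatrix_eq, Matrix.diagonal_mul, hτ, Matrix.mul_apply]
    have h1 := congrFun (congrArg Subtype.val (hbc i)) j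
    rw [hf] at h1
    exact h1
  · ext i
    refine Fin.cases ?_ (fun i => ?_) i
    · rw [Pi.single_eq_same, ← hu, Matrix.mulVec, dotProduct]
      exact Finset.sum_congr rfl fun j _ => mul_comm _ _
    · rw [Pi.single_eq_of_ne (Fin.succ_ne_zero i)]
      exact hcq i
  · refine isHermiteNormalForm_of_eq_one (by omega) (fun i => ⟨min i.1 (n - (n - t)), by omega⟩)
      (fun i hi => ?_) fun i j => ?_
    · simp only
      omega
    · rw [Matrix.mul_apply]
      have h1 := hUE' ⟨j.1, by omega⟩ i
      simp only [Fin.ext_iff] at h1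
      simp only [eq_comm (a := i.1)]
      rw [← h1]
      exact Finset.sum_congr rfl fun l _ => mul_comm _ _
  · ext i j
    rw [Matrix.mul_apply]
    have h1 := hUE' (lowerIndex hs i).succ (lowerIndex hs' j)
    rw [lowerIndex_succ] at h1
    simp only [(lowerIndex_injective hs').eq_iff] at h1
    rw [Matrix.one_apply, ← h1, ← lowerIndex_succ hs]
    exact Finset.sum_congr rfl fun l _ => rfl
  · refine isHermiteNormalForm_of_eq_one le_rfl id (fun _ _ => rfl) fun i j => ?_
    rw [Matrix.one_mul, Matrix.transpose_one, Matrix.one_apply]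
    simp only [Fin.ext_iff]
  · rw [Matrix.one_mul]

theorem SimplexSystem.eq_zero_of_dot {n : ℕ} {w : Fin (n + 1) → Fin n → ℝ} {q : Fin (n + 1) → ℝ}
    (h : SimplexSystem w q) {u : Fin n → ℝ} (hu : ∀ i, dotProduct u (w i) = 0) : u = 0 := by
  obtain ⟨c, hc⟩ := h.exists_coords u
  have : dotProduct u u = 0 := by
    nth_rw 2 [hc]
    rw [dotProduct_sum]
    exact Finset.sum_eq_zero fun i _ => by rw [dotProduct_smul, hu, smul_zero]
  exact dotProduct_self_eq_zero.1 this

theorem SimplexSystem.sum_mul_dot {n : ℕ} {w : Fin (n + 1) → Fin n → ℝ} {q : Fin (n + 1) → ℝ}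
    (h : SimplexSystem w q) (u : Fin n → ℝ) : ∑ i, q i * dotProduct u (w i) = 0 := by
  have h1 := congrArg (dotProduct u) h.rel
  rw [dotProduct_zero, dotProduct_sum] at h1
  rw [← h1]
  exact Finset.sum_congr rfl fun i _ => by rw [dotProduct_smul, smul_eq_mul]

theorem exists_isTorsionMatrix_dualRay {n : ℕ} {a : Fin (n + 1) → ℕ} (hn : 0 < n)
    (ha : ∀ i, 0 < a i) (hg : Finset.univ.gcd a = 1) :
    ∃ (s : ℕ) (τ : Fin s → ℕ+) (γ : Matrix (Fin s) (Fin (n + 1)) ℤ),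
      IsTorsionMatrix (Matrix.of (dualRay a)).transpose (reducedWeights a) τ γ := by
  have h := simplexSystem_dualRay hn ha hg
  obtain ⟨u, hu⟩ := Finset.gcd_eq_sum_mul Finset.univ fun i => (reducedWeights a i : ℤ)
  have hu1 : Finset.univ.gcd (fun i => (reducedWeights a i : ℤ)) = 1 := by
    have h1 : Finset.univ.gcd (fun i => (reducedWeights a i : ℤ)) ∣ 1 := by
      have h2 := gcd_reducedWeights hg
      have h3 : (Finset.univ.gcd fun i => (reducedWeights a i : ℤ)).natAbs ∣ 1 := by
        refine dvd_trans ?_ h2.dvd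
        refine Finset.dvd_gcd fun i _ => ?_
        rw [← Int.natCast_dvd_natCast, Int.natAbs_dvd]
        exact Finset.gcd_dvd (Finset.mem_univ i)
      exact Int.natAbs_dvd_natAbs.1 h3
    rw [← Finset.normalize_gcd, normalize_eq_one]
    exact isUnit_of_dvd_one h1
  rw [hu1] at hu
  refine exists_isTorsionMatrix (fun v hv => ?_) (fun v => ?_) (u := u) ?_
  · have := h.eq_zero_of_dot (u := lat v) fun j => by rw [lat_dotProduct, hv j, Int.cast_zero]
    funext i
    have h1 := congrFun this i
    simpa [lat] using h1
  · have h1 := h.sum_mul_dot (lat v)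
    simp only [lat_dotProduct] at h1
    exact_mod_cast h1
  · rw [hu]

/-! ### Homogeneous coordinates on the toric variety of a simplex -/

/-- Homomorphisms to `ℂ^*` extend along homomorphisms of abelian groups, as `ℂ^*` is divisible. -/
theorem exists_addMonoidHom_extension {M N : Type} [AddCommGroup M] [AddCommGroup N] (f : M →+ N)
    (g : M →+ Additive ℂˣ) (hfg : ∀ u, f u = 0 → g u = 0) :
    ∃ h : N →+ Additive ℂˣ, ∀ u, h (f u) = g u := by
  let _ : DivisibleBy (Additive ℂˣ) ℤ := divisibleByOfSMulRightSurj (Additive ℂˣ) ℤ (by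
    intro k hk x
    obtain ⟨z, hz⟩ := IsAlgClosed.exists_pow_nat_eq ((x.toMul : ℂˣ) : ℂ) (Int.natAbs_pos.2 hk)
    have hz0 : z ≠ 0 := by
      rintro rfl
      rw [zero_pow (Int.natAbs_pos.2 hk).ne'] at hz
      exact x.toMul.ne_zero hz.symm
    have h1 : (Units.mk0 z hz0) ^ k.natAbs = x.toMul := Units.ext (by simpa using hz)
    rcases Int.natAbs_eq k with h | h
    · refine ⟨Additive.ofMul (Units.mk0 z hz0), ?_⟩
      change k • Additive.ofMul (Units.mk0 z hz0) = x
      rw [h, ← ofMul_zpow, zpow_natCast, h1, ofMul_toMul]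
    · refine ⟨Additive.ofMul (Units.mk0 z hz0)⁻¹, ?_⟩
      change k • Additive.ofMul (Units.mk0 z hz0)⁻¹ = x
      rw [h, ← ofMul_zpow, zpow_neg, inv_zpow, inv_inv, zpow_natCast, h1, ofMul_toMul])
  let f' : M ⧸ f.ker →+ N := QuotientAddGroup.kerLift f
  let g' : M ⧸ f.ker →+ Additive ℂˣ := QuotientAddGroup.lift f.ker g fun u hu => hfg u hu
  obtain ⟨h, hh⟩ := (Module.Baer.of_divisible (A := Additive ℂˣ)).extension_property_addMonoidHom
    f' (QuotientAddGroup.kerLift_injective f) g'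
  exact ⟨h, fun u => DFunLike.congr_fun hh (QuotientAddGroup.mk u)⟩

theorem toMul_eq_prod_zpow {m : ℕ} (h : (Fin m → ℤ) →+ Additive ℂˣ) (v : Fin m → ℤ) :
    (h v).toMul = ∏ j, (h (Pi.single j 1)).toMul ^ v j := by
  have h1 : v = ∑ j, v j • (Pi.single j 1 : Fin m → ℤ) := by
    ext k
    simp [Finset.sum_apply, Pi.single_apply]
  nth_rw 1 [h1]
  rw [map_sum, toMul_sum]
  exact Finset.prod_congr rfl fun j _ => by rw [map_zsmul, toMul_zsmul]

theorem mem_dualMonoid_iff {n : ℕ} {Λ : Fin (n + 1) → Fin n → ℤ} {σ : Set (Fin n → ℝ)}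
    (hσ : σ ∈ simplexFan fun i => lat (Λ i)) {u : Fin n → ℤ} :
    u ∈ dualMonoid σ ↔ ∀ j, lat (Λ j) ∈ σ → 0 ≤ dotProduct u (Λ j) := by
  constructor
  · intro h j hj
    have := h _ hj
    rw [lat_dotProduct] at this
    exact_mod_cast this
  · obtain ⟨I, -, rfl⟩ := hσ
    intro h
    rw [← Set.image_image (g := lat) (f := Λ), mem_dualMonoid_cone]
    rintro _ ⟨j, hj, rfl⟩
    exact h j (subset_cone _ ⟨j, hj, rfl⟩)

theorem SimplexSystem.exists_notMem {n : ℕ} {w : Fin (n + 1) → Fin n → ℝ} {q : Fin (n + 1) → ℝ}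
    (hS : SimplexSystem w q) (hn : 0 < n) {σ : Set (Fin n → ℝ)} (hσ : σ ∈ simplexFan w) :
    ∃ i, w i ∉ σ := by
  obtain ⟨I, hI, rfl⟩ := hσ
  obtain ⟨i, hi⟩ := (Set.ne_univ_iff_exists_notMem I).1 hI
  exact ⟨i, fun hc => hi (hS.mem_of_mem_cone hn hI hc)⟩

/-- Homogeneous coordinates `z` of a point of a chart: the character `χ^u` takes the value
`∏ z_j ^ ⟨u, Λ_j⟩`, where only the coordinates of the rays of the cone may vanish. -/
def IsLift {n : ℕ} (Λ : Fin (n + 1) → Fin n → ℤ) {σ : Set (Fin n → ℝ)} (z : Fin (n + 1) → ℂ)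
    (x : AffinePoints σ) : Prop :=
  (∀ j, z j = 0 → lat (Λ j) ∈ σ) ∧ ∀ u : dualMonoid σ, x.eval u = ∏ j, z j ^ dotProduct u.1 (Λ j)

/-- Any vector whose vanishing coordinates belong to rays of the cone gives a point of the chart. -/
theorem exists_point {n : ℕ} {Λ : Fin (n + 1) → Fin n → ℤ} {σ : Set (Fin n → ℝ)}
    (hσ : σ ∈ simplexFan fun i => lat (Λ i)) {z : Fin (n + 1) → ℂ}
    (hz : ∀ j, z j = 0 → lat (Λ j) ∈ σ) : ∃ x : AffinePoints σ, IsLift Λ z x := by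
  refine ⟨show Multiplicative (dualMonoid σ) →* ℂ from
    { toFun := fun u => ∏ j, z j ^ dotProduct (Multiplicative.toAdd u).1 (Λ j)
      map_one' := by simp
      map_mul' := ?_ }, hz, fun u => rfl⟩
  intro u v
  rw [← Finset.prod_mul_distrib]
  refine Finset.prod_congr rfl fun j _ => ?_
  have e : dotProduct (Multiplicative.toAdd (u * v)).1 (Λ j) =
      dotProduct (Multiplicative.toAdd u).1 (Λ j) + dotProduct (Multiplicative.toAdd v).1 (Λ j) :=
    add_dotProduct _ _ _
  rw [e]
  by_cases h : z j = 0
  · have h1 := (mem_dualMonoid_iff hσ).1 (Multiplicative.toAdd u).2 j (hz j h)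
    have h2 := (mem_dualMonoid_iff hσ).1 (Multiplicative.toAdd v).2 j (hz j h)
    obtain ⟨a, ha⟩ := Int.eq_ofNat_of_zero_le h1
    obtain ⟨b, hb⟩ := Int.eq_ofNat_of_zero_le h2
    rw [ha, hb, ← Nat.cast_add, zpow_natCast, zpow_natCast, zpow_natCast, pow_add]
  · exact zpow_add₀ h _ _

theorem IsLift.of_face {n : ℕ} {Λ : Fin (n + 1) → Fin n → ℤ} {F : Set (Set (Fin n → ℝ))}
    {z : Fin (n + 1) → ℂ} {p p' : (σ : F) × AffinePoints σ.1} (hp : Patch F p p')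
    (hz : IsLift Λ z p.2) : IsLift Λ z p'.2 := by
  have hsub : p.1.1 ⊆ p'.1.1 := by
    obtain ⟨⟨u, -, h⟩, -⟩ := hp
    rw [h]
    exact fun v hv => hv.1
  refine ⟨fun j hj => hsub (hz.1 j hj), fun u => ?_⟩
  rw [← hp.2 u.1 (fun v hv => u.2 v (hsub hv)) u.2, hz.2]

theorem IsLift.ne_zero {n : ℕ} {Λ : Fin (n + 1) → Fin n → ℤ} {q : Fin (n + 1) → ℝ}
    (hS : SimplexSystem (fun i => lat (Λ i)) q) (hn : 0 < n) {σ : Set (Fin n → ℝ)}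
    (hσ : σ ∈ simplexFan fun i => lat (Λ i)) {z : Fin (n + 1) → ℂ}
    {x : AffinePoints σ} (hx : IsLift Λ z x) : z ≠ 0 := by
  rintro rfl
  obtain ⟨i, hi⟩ := hS.exists_notMem hn hσ
  exact hi (hx.1 i rfl)

namespace AdaptedBasis

variable {n s : ℕ} {Λ : Fin (n + 1) → Fin n → ℤ} {q : Fin (n + 1) → ℕ}
  {τ : Fin s → ℕ+} {γ : Matrix (Fin s) (Fin (n + 1)) ℤ}
  {U E : Matrix (Fin (n + 1)) (Fin (n + 1)) ℤ}

/-- Off the ray `i`, there are characters that are positive on one ray and vanish on the others. -/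
theorem exists_coordinate_characters (h : AdaptedBasis Λ q τ γ U E) (hq : ∀ i, 0 < q i)
    (i : Fin (n + 1)) : ∃ (D : ℤ) (v : Fin (n + 1) → Fin n → ℤ), 0 < D ∧ v i = 0 ∧
      ∀ j, j ≠ i → ∀ l, l ≠ i → dotProduct (v j) (Λ l) = if l = j then D else 0 := by
  classical
  have key : ∀ j, ∃ v : Fin n → ℤ, (j = i → v = 0) ∧ (j ≠ i → ∀ l, l ≠ i →
      dotProduct v (Λ l) = if l = j then (∏ k, ((τ k : ℕ) : ℤ)) * q i else 0) := by
    intro j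
    by_cases hji : j = i
    · exact ⟨0, fun _ => rfl, fun hc => absurd hji hc⟩
    obtain ⟨v, hv⟩ := (h.mem_rowLattice_iff fun l =>
      (∏ k, ((τ k : ℕ) : ℤ)) * (if l = j then (q i : ℤ) else if l = i then -(q j : ℤ) else 0)).2 (by
        constructor
        · rw [← Finset.add_sum_erase _ _ (Finset.mem_univ j),
            ← Finset.add_sum_erase _ _ (Finset.mem_erase.2 ⟨Ne.symm hji, Finset.mem_univ i⟩),
            Finset.sum_eq_zero]
          · simp only [if_true, if_neg (Ne.symm hji)]
            ring
          · intro l hl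
            rw [if_neg (Finset.ne_of_mem_erase (Finset.mem_of_mem_erase hl)),
              if_neg (Finset.ne_of_mem_erase hl), mul_zero, mul_zero]
        · intro k
          refine Finset.dvd_sum fun l _ => Dvd.dvd.mul_left (Dvd.dvd.mul_right ?_ _) _
          exact Finset.dvd_prod_of_mem (fun k => ((τ k : ℕ) : ℤ)) (Finset.mem_univ k))
    refine ⟨v, fun hc => absurd hc hji, fun _ l hl => ?_⟩
    rw [← hv, if_neg hl, mul_ite, mul_zero]
  choose v hv0 hv using key
  refine ⟨(∏ k, ((τ k : ℕ) : ℤ)) * q i, v, ?_, hv0 i rfl, fun j hj l hl => hv j hj l hl⟩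
  refine mul_pos (Finset.prod_pos fun k _ => ?_) (by exact_mod_cast hq i)
  exact_mod_cast (τ k).pos

/-- For a point `x` of a chart, characters of the chart that vanish on the rays of a set `Z` (those
of the divisors through `x`), and that measure the other rays of the cone. -/
theorem exists_orbit_data (h : AdaptedBasis Λ q τ γ U E)
    (hS : SimplexSystem (fun i => lat (Λ i)) (fun i => (q i : ℝ))) (hn : 0 < n)
    {σ : Set (Fin n → ℝ)} (hσ : σ ∈ simplexFan fun i => lat (Λ i)) (x : AffinePoints σ) :
    ∃ (Z : Set (Fin (n + 1))) (w : dualMonoid σ), (∀ j ∈ Z, lat (Λ j) ∈ σ) ∧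
      (∀ j ∈ Z, dotProduct w.1 (Λ j) = 0) ∧ x.eval w ≠ 0 ∧
      (∀ j, j ∉ Z → lat (Λ j) ∈ σ → 0 < dotProduct w.1 (Λ j)) ∧
      (∀ u : dualMonoid σ, ∀ j ∈ Z, 0 < dotProduct u.1 (Λ j) → x.eval u = 0) ∧
      ∀ z, IsLift Λ z x → ∀ j, z j = 0 ↔ j ∈ Z := by
  classical
  obtain ⟨i, hi⟩ := hS.exists_notMem hn hσ
  have hq : ∀ i, 0 < q i := fun i => by exact_mod_cast hS.pos i
  obtain ⟨D, v, hD, hvi, hv⟩ := h.exists_coordinate_characters hq i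
  have hmem := fun {u : Fin n → ℤ} => mem_dualMonoid_iff (u := u) hσ
  have hne : ∀ {j}, lat (Λ j) ∈ σ → j ≠ i := fun hj hc => hi (hc ▸ hj)
  have hvσ : ∀ j, v j ∈ dualMonoid σ := by
    intro j
    by_cases hj : j = i
    · rw [hj, hvi]; exact zero_mem _
    · refine hmem.2 fun l hl => ?_
      rw [hv j hj l (hne hl)]
      split_ifs
      exacts [hD.le, le_rfl]
  have hZ : ∀ j, x.eval ⟨v j, hvσ j⟩ = 0 → lat (Λ j) ∈ σ := by
    intro j hj
    by_contra hc
    have hneg : -v j ∈ dualMonoid σ := by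
      by_cases hji : j = i
      · rw [hji, hvi, neg_zero]; exact zero_mem _
      · refine hmem.2 fun l hl => ?_
        rw [neg_dotProduct, hv j hji l (hne hl), if_neg, neg_zero]
        rintro rfl
        exact hc hl
    have h1 := AffinePoints.eval_add ⟨v j, hvσ j⟩ ⟨-v j, hneg⟩ x
    have h0 : (⟨v j, hvσ j⟩ + ⟨-v j, hneg⟩ : dualMonoid σ) = 0 := Subtype.ext (add_neg_cancel _)
    rw [h0, AffinePoints.eval_zero, hj, zero_mul] at h1
    exact one_ne_zero h1
  let w : dualMonoid σ := ∑ j ∈ Finset.univ.filter (fun j => x.eval ⟨v j, hvσ j⟩ ≠ 0),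
    (⟨v j, hvσ j⟩ : dualMonoid σ)
  have hw : ∀ l, l ≠ i → dotProduct w.1 (Λ l) = if x.eval ⟨v l, hvσ l⟩ ≠ 0 then D else 0 := by
    intro l hl
    have h1 : w.1 = ∑ j ∈ Finset.univ.filter (fun j => x.eval ⟨v j, hvσ j⟩ ≠ 0), v j := by
      simp only [w, AddSubmonoid.coe_finsetSum]
    have h2 : ∀ j, dotProduct (v j) (Λ l) = if j = l then D else 0 := by
      intro j
      by_cases hj : j = i
      · rw [hj, hvi, zero_dotProduct, if_neg (Ne.symm hl)]
      · rw [hv j hj l hl]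
        simp only [eq_comm]
    rw [h1, sum_dotProduct]
    simp only [h2, Finset.sum_ite_eq', Finset.mem_filter, Finset.mem_univ, true_and]
  refine ⟨{j | x.eval ⟨v j, hvσ j⟩ = 0}, w, hZ, fun j hj => ?_, ?_, fun j hj hjσ => ?_,
    fun u j hj hu => ?_, fun z hz j => ?_⟩
  · exact (hw j (hne (hZ j hj))).trans (if_neg (not_not.2 hj))
  · rw [AffinePoints.eval_sum]
    exact Finset.prod_ne_zero_iff.2 fun j hj => (Finset.mem_filter.1 hj).2
  · exact hD.trans_eq ((hw j (hne hjσ)).trans (if_pos hj)).symm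
  · -- a multiple of `u` dominates `v j`
    have hjσ := hZ j hj
    have h1 : D.toNat • u.1 - v j ∈ dualMonoid σ := by
      refine hmem.2 fun l hl => ?_
      rw [sub_dotProduct, smul_dotProduct, hv j (hne hjσ) l (hne hl), nsmul_eq_mul]
      have h3 : ((D.toNat : ℕ) : ℤ) = D := Int.toNat_of_nonneg hD.le
      have h4 := hmem.1 u.2 l hl
      rw [h3]
      split_ifs with hlj
      · rw [hlj]; nlinarith
      · nlinarith
    have h2 := AffinePoints.eval_add ⟨v j, hvσ j⟩ ⟨_, h1⟩ x
    have h0 : (⟨v j, hvσ j⟩ + ⟨_, h1⟩ : dualMonoid σ) = D.toNat • u :=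
      Subtype.ext (add_sub_cancel _ _)
    rw [h0, AffinePoints.eval_nsmul, show x.eval ⟨v j, hvσ j⟩ = 0 from hj, zero_mul] at h2
    exact pow_eq_zero_iff (by omega) |>.1 h2
  · have hzi : z i ≠ 0 := fun hc => hi (hz.1 i hc)
    by_cases hj : lat (Λ j) ∈ σ
    · rw [Set.mem_ofPred_eq, hz.2]
      have hji := hne hj
      rw [Finset.prod_eq_zero_iff]
      constructor
      · intro h0
        refine ⟨j, Finset.mem_univ j, ?_⟩
        simp only
        rw [hv j hji j hji, if_pos rfl, h0, zero_zpow _ hD.ne']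
      · rintro ⟨l, -, hl⟩
        have hl' := eq_zero_of_zpow_eq_zero hl
        have hli : l ≠ i := fun hc => hzi (hc ▸ hl')
        simp only [hv j hji l hli] at hl
        split_ifs at hl with hlj
        · exact hlj ▸ hl'
        · simp at hl
    · exact ⟨fun h0 => absurd (hz.1 j h0) hj, fun h0 => absurd (hZ j h0) hj⟩

end AdaptedBasis

/-- The characters that vanish on the rays of a set `Z`. -/
def orthogonalCharacters {n : ℕ} (Λ : Fin (n + 1) → Fin n → ℤ) (Z : Set (Fin (n + 1))) :
    AddSubgroup (Fin n → ℤ) where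
  carrier := {u | ∀ j ∈ Z, dotProduct u (Λ j) = 0}
  zero_mem' := fun j _ => zero_dotProduct _
  add_mem' := fun hu hv j hj => by rw [add_dotProduct, hu j hj, hv j hj, add_zero]
  neg_mem' := fun hu j hj => by rw [neg_dotProduct, hu j hj, neg_zero]

/-- The multiple of a positive character needed to move `u` into the dual cone. -/
def shiftBound {n : ℕ} (Λ : Fin (n + 1) → Fin n → ℤ) (u : Fin n → ℤ) : ℕ :=
  ∑ j, (dotProduct u (Λ j)).natAbs

theorem add_shiftBound_smul_mem {n : ℕ} {Λ : Fin (n + 1) → Fin n → ℤ} {σ : Set (Fin n → ℝ)}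
    (hσ : σ ∈ simplexFan fun i => lat (Λ i)) {Z : Set (Fin (n + 1))} {w : dualMonoid σ}
    (hw : ∀ j, j ∉ Z → lat (Λ j) ∈ σ → 0 < dotProduct w.1 (Λ j)) {u : Fin n → ℤ}
    (hu : u ∈ orthogonalCharacters Λ Z) : u + shiftBound Λ u • w.1 ∈ dualMonoid σ := by
  refine (mem_dualMonoid_iff hσ).2 fun j hj => ?_
  rw [add_dotProduct, smul_dotProduct, nsmul_eq_mul]
  by_cases hjZ : j ∈ Z
  · rw [hu j hjZ, zero_add]
    exact mul_nonneg (Int.natCast_nonneg _) ((mem_dualMonoid_iff hσ).1 w.2 j hj)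
  · have h1 := hw j hjZ hj
    have h2 : (dotProduct u (Λ j)).natAbs ≤ shiftBound Λ u :=
      Finset.single_le_sum (f := fun j => (dotProduct u (Λ j)).natAbs)
        (fun _ _ => Nat.zero_le _) (Finset.mem_univ j)
    have h3 : -dotProduct u (Λ j) ≤ (shiftBound Λ u : ℤ) := by omega
    nlinarith

namespace AdaptedBasis

variable {n s : ℕ} {Λ : Fin (n + 1) → Fin n → ℤ} {q : Fin (n + 1) → ℕ}
  {τ : Fin s → ℕ+} {γ : Matrix (Fin s) (Fin (n + 1)) ℤ}
  {U E : Matrix (Fin (n + 1)) (Fin (n + 1)) ℤ}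

/-- Every point of a chart has homogeneous coordinates: the values of the characters that are invertible
at the point extend to a character of the torus of `ℂ^{n+1}`, as `ℂ^*` is divisible. -/
theorem exists_isLift (h : AdaptedBasis Λ q τ γ U E)
    (hS : SimplexSystem (fun i => lat (Λ i)) (fun i => (q i : ℝ))) (hn : 0 < n)
    {σ : Set (Fin n → ℝ)} (hσ : σ ∈ simplexFan fun i => lat (Λ i)) (x : AffinePoints σ) :
    ∃ z, IsLift Λ z x := by
  classical
  obtain ⟨Z, w, hZσ, hwZ, hxw, hwpos, hxZ, -⟩ := h.exists_orbit_data hS hn hσ x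
  let H := orthogonalCharacters Λ Z
  let sh : H → dualMonoid σ := fun u => ⟨_, add_shiftBound_smul_mem hσ hwpos u.2⟩
  have hshne : ∀ u : H, x.eval (sh u) ≠ 0 := by
    intro u hc
    have h1 := AffinePoints.eval_add (sh u) (sh (-u)) x
    have h0 : sh u + sh (-u) = (shiftBound Λ u.1 + shiftBound Λ (-u).1) • w := by
      refine Subtype.ext ?_
      change u.1 + shiftBound Λ u.1 • w.1 + (-u.1 + shiftBound Λ (-u).1 • w.1) =
        (shiftBound Λ u.1 + shiftBound Λ (-u).1) • w.1
      rw [add_smul]; abel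
    rw [h0, AffinePoints.eval_nsmul, hc, zero_mul] at h1
    exact pow_ne_zero _ hxw h1
  -- the character of the lattice `H` by which `x` acts
  let g : H →+ Additive ℂˣ :=
    { toFun := fun u => Additive.ofMul (Units.mk0 (x.eval (sh u)) (hshne u) *
        (Units.mk0 (x.eval w) hxw ^ shiftBound Λ u.1)⁻¹)
      map_zero' := by
        have h1 : shiftBound Λ (0 : H).1 = 0 := by simp [shiftBound]
        have h2 : sh 0 = 0 := Subtype.ext (by
          change (0 : Fin n → ℤ) + shiftBound Λ (0 : H).1 • w.1 = 0
          rw [h1, zero_smul, add_zero])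
        rw [h1, ← ofMul_one]
        congr 1
        ext
        simp [h2, AffinePoints.eval_zero]
      map_add' := fun u u' => by
        rw [← ofMul_mul]
        congr 1
        have e : sh (u + u') + (shiftBound Λ u.1 + shiftBound Λ u'.1) • w =
            sh u + sh u' + shiftBound Λ (u + u').1 • w := by
          refine Subtype.ext ?_
          change u.1 + u'.1 + shiftBound Λ (u + u').1 • w.1 +
            (shiftBound Λ u.1 + shiftBound Λ u'.1) • w.1 =
            u.1 + shiftBound Λ u.1 • w.1 + (u'.1 + shiftBound Λ u'.1 • w.1) +
              shiftBound Λ (u + u').1 • w.1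
          rw [add_smul]; abel
        have e' := congrArg (fun y => x.eval y) e
        simp only [AffinePoints.eval_add, AffinePoints.eval_nsmul, pow_add] at e'
        ext
        simp only [Units.val_mul, Units.val_inv_eq_inv_val, Units.val_pow_eq_pow_val,
          Units.val_mk0]
        field_simp
        linear_combination e' }
  have hg : ∀ u : H, ((g u).toMul : ℂ) * x.eval w ^ shiftBound Λ u.1 = x.eval (sh u) := by
    intro u
    change ((Units.mk0 (x.eval (sh u)) (hshne u) *
        (Units.mk0 (x.eval w) hxw ^ shiftBound Λ u.1)⁻¹ : ℂˣ) : ℂ) * _ = _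
    simp only [Units.val_mul, Units.val_inv_eq_inv_val, Units.val_pow_eq_pow_val, Units.val_mk0]
    field_simp
  let f : H →+ (Fin (n + 1) → ℤ) :=
    { toFun := fun u j => dotProduct u.1 (Λ j)
      map_zero' := by ext j; exact zero_dotProduct _
      map_add' := fun u u' => by ext j; exact add_dotProduct _ _ _ }
  have hfi : ∀ u, f u = 0 → u = 0 := by
    intro u hu
    refine Subtype.ext (lat_injective ?_)
    rw [show lat (0 : H).1 = 0 from lat_zero]
    refine hS.eq_zero_of_dot fun j => ?_
    rw [lat_dotProduct]
    exact_mod_cast congrFun hu j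
  obtain ⟨k, hk⟩ := exists_addMonoidHom_extension f g fun u hu => by rw [hfi u hu, map_zero]
  refine ⟨fun j => if j ∈ Z then 0 else ((k (Pi.single j 1)).toMul : ℂ), fun j hj => ?_,
    fun u => ?_⟩
  · by_contra hc
    have : j ∉ Z := fun h => hc (hZσ j h)
    simp [this] at hj
  · by_cases hu : u.1 ∈ H
    · have h1 := hg ⟨u.1, hu⟩
      have h2 : sh ⟨u.1, hu⟩ = u + shiftBound Λ u.1 • w := rfl
      rw [h2, AffinePoints.eval_add, AffinePoints.eval_nsmul] at h1
      have h3 := mul_right_cancel₀ (pow_ne_zero _ hxw) h1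
      rw [← h3, ← hk, toMul_eq_prod_zpow, Units.coe_prod]
      refine Finset.prod_congr rfl fun j _ => ?_
      rw [Units.val_zpow_eq_zpow_val]
      beta_reduce
      by_cases hj : j ∈ Z
      · rw [if_pos hj, show f ⟨u.1, hu⟩ j = 0 from hu j hj, hu j hj, zpow_zero, zpow_zero]
      · rw [if_neg hj]; rfl
    · obtain ⟨j, hj, hne⟩ : ∃ j ∈ Z, dotProduct u.1 (Λ j) ≠ 0 := by
        by_contra! hc
        exact hu hc
      have hpos := lt_of_le_of_ne ((mem_dualMonoid_iff hσ).1 u.2 j (hZσ j hj)) (Ne.symm hne)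
      rw [hxZ u j hj hpos]
      refine (Finset.prod_eq_zero (Finset.mem_univ j) ?_).symm
      beta_reduce
      rw [if_pos hj, zero_zpow _ hne]

/-- Homogeneous coordinates are unique up to the weighted action of `ℂ^*` and the torsion group. -/
theorem exists_of_isLift (h : AdaptedBasis Λ q τ γ U E)
    (hS : SimplexSystem (fun i => lat (Λ i)) (fun i => (q i : ℝ))) (hn : 0 < n)
    {σ : Set (Fin n → ℝ)} (hσ : σ ∈ simplexFan fun i => lat (Λ i)) {x : AffinePoints σ}
    {z z' : Fin (n + 1) → ℂ} (hz : IsLift Λ z x) (hz' : IsLift Λ z' x) :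
    ∃ (y : ℂˣ) (ε : ∀ k, ZMod (τ k)), ∀ j, z' j = (y : ℂ) ^ q j * torsionCoeff γ ε j * z j := by
  classical
  obtain ⟨Z, w, hZσ, hwZ, hxw, hwpos, hxZ, hzero⟩ := h.exists_orbit_data hS hn hσ x
  have hzz : ∀ j, j ∉ Z → z j ≠ 0 := fun j hj hc => hj ((hzero z hz j).1 hc)
  have hzz' : ∀ j, j ∉ Z → z' j ≠ 0 := fun j hj hc => hj ((hzero z' hz' j).1 hc)
  let r : Fin (n + 1) → ℂˣ := fun j =>
    if hj : j ∈ Z then 1 else Units.mk0 (z' j) (hzz' j hj) / Units.mk0 (z j) (hzz j hj)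
  have hr : ∀ j, z' j = r j * z j := by
    intro j
    by_cases hj : j ∈ Z
    · rw [(hzero z hz j).2 hj, (hzero z' hz' j).2 hj, mul_zero]
    · simp only [r, dif_neg hj, Units.val_div_eq_div_val, Units.val_mk0]
      rw [div_mul_cancel₀ _ (hzz j hj)]
  let P : (Fin n → ℤ) →+ Additive ℂˣ :=
    { toFun := fun u => Additive.ofMul (∏ j, r j ^ dotProduct u (Λ j))
      map_zero' := by simp
      map_add' := fun u u' => by
        simp only [add_dotProduct, zpow_add, Finset.prod_mul_distrib, ofMul_mul] }
  have hP1 : ∀ u : dualMonoid σ, u.1 ∈ orthogonalCharacters Λ Z → P u.1 = 0 := by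
    intro u hu
    have h1 := (hz'.2 u).symm.trans (hz.2 u)
    simp only [hr, mul_zpow, Finset.prod_mul_distrib] at h1
    have h2 : ∏ j, z j ^ dotProduct u.1 (Λ j) ≠ 0 := by
      refine Finset.prod_ne_zero_iff.2 fun j _ => ?_
      by_cases hj : j ∈ Z
      · rw [hu j hj, zpow_zero]; exact one_ne_zero
      · exact zpow_ne_zero _ (hzz j hj)
    have h3 := mul_right_cancel₀ h2 (h1.trans (one_mul _).symm)
    change Additive.ofMul (∏ j, r j ^ dotProduct u.1 (Λ j)) = 0
    rw [ofMul_eq_zero]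
    ext
    push_cast
    exact h3
  have hP : ∀ u ∈ orthogonalCharacters Λ Z, P u = 0 := by
    intro u hu
    have h1 := hP1 ⟨_, add_shiftBound_smul_mem hσ hwpos hu⟩
      (add_mem hu (nsmul_mem (show w.1 ∈ orthogonalCharacters Λ Z from hwZ) _))
    have h2 := hP1 w hwZ
    simp only [map_add, map_nsmul, h2, smul_zero, add_zero] at h1
    exact h1
  -- correct the quotients at the vanishing coordinates
  let f : (Fin n → ℤ) →+ (Fin (n + 1) → ℤ) :=
    { toFun := fun u j => if j ∈ Z then dotProduct u (Λ j) else 0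
      map_zero' := by ext j; simp
      map_add' := fun u u' => by ext j; by_cases hj : j ∈ Z <;> simp [hj] }
  obtain ⟨k, hk⟩ := exists_addMonoidHom_extension f (-P) fun u hu => by
    rw [AddMonoidHom.neg_apply, hP u fun j hj => ?_, neg_zero]
    have := congrFun hu j
    simpa [f, hj] using this
  let t : Fin (n + 1) → ℂˣ := fun j => if j ∈ Z then (k (Pi.single j 1)).toMul else r j
  obtain ⟨y, ε, hy⟩ := h.exists_of_kernel t (by
    intro u
    have h1 := congrArg Additive.toMul (hk u)
    rw [toMul_eq_prod_zpow, AddMonoidHom.neg_apply, toMul_neg] at h1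
    change _ = (∏ j, r j ^ dotProduct u (Λ j))⁻¹ at h1
    have h2 : ∏ j, t j ^ dotProduct u (Λ j) =
        (∏ j, (k (Pi.single j 1)).toMul ^ f u j) * ∏ j, r j ^ dotProduct u (Λ j) := by
      rw [← Finset.prod_mul_distrib]
      refine Finset.prod_congr rfl fun j _ => ?_
      by_cases hj : j ∈ Z
      · simp [t, f, r, hj]
      · simp [t, f, hj]
    rw [h2, h1, inv_mul_cancel])
  refine ⟨y, ε, fun j => ?_⟩
  rw [← hy]
  by_cases hj : j ∈ Z
  · rw [(hzero z hz j).2 hj, (hzero z' hz' j).2 hj, mul_zero]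
  · simp only [t, if_neg hj]
    exact hr j

theorem isLift_smul (h : AdaptedBasis Λ q τ γ U E) {σ : Set (Fin n → ℝ)} {x : AffinePoints σ}
    {z : Fin (n + 1) → ℂ} (hz : IsLift Λ z x) (y : ℂˣ) (ε : ∀ k, ZMod (τ k)) :
    IsLift Λ (fun j => (y : ℂ) ^ q j * torsionCoeff γ ε j * z j) x := by
  refine ⟨fun j hj => hz.1 j ?_, fun u => ?_⟩
  · exact (mul_eq_zero.1 hj).resolve_left
      (mul_ne_zero (pow_ne_zero _ y.ne_zero) (torsionCoeff_ne_zero _ _ _))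
  · rw [hz.2]
    simp only [mul_zpow ((y : ℂ) ^ _ * torsionCoeff γ ε _), Finset.prod_mul_distrib]
    rw [h.prod_zpow_eq_one y.ne_zero, one_mul]

end AdaptedBasis

/-! ### The bijection with the quotient of the weighted projective space -/

theorem WeightedProjectiveSpace.mk_eq_mk_iff {m : ℕ} {q : Fin m → ℕ} {x y : PuncturedSpace m} :
    WeightedProjectiveSpace.mk q x = WeightedProjectiveSpace.mk q y ↔
      ∃ t : ℂˣ, ∀ j, y.1 j = (t : ℂ) ^ q j * x.1 j := by
  have he : Equivalence (fun x y : PuncturedSpace m => ∃ t : ℂˣ, ∀ j, y.1 j = (t : ℂ) ^ q j * x.1 j) :=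
    { refl := fun x => ⟨1, fun j => by simp⟩
      symm := by
        rintro x y ⟨t, ht⟩
        refine ⟨t⁻¹, fun j => ?_⟩
        rw [ht, ← mul_assoc, ← mul_pow, ← Units.val_mul, inv_mul_cancel]
        simp
      trans := by
        rintro x y z ⟨t, ht⟩ ⟨t', ht'⟩
        refine ⟨t' * t, fun j => ?_⟩
        rw [ht', ht, Units.val_mul, mul_pow, mul_assoc] }
  exact Quot.eq.trans he.eqvGen_iff

theorem WPSQuotient.mk_eq_mk_iff {m s : ℕ} {q : Fin m → ℕ} {τ : Fin s → ℕ+}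
    {γ : Matrix (Fin s) (Fin m) ℤ} {x y : PuncturedSpace m} :
    WPSQuotient.mk q τ γ x = WPSQuotient.mk q τ γ y ↔
      ∃ (t : ℂˣ) (ε : ∀ k, ZMod (τ k)), ∀ j,
        y.1 j = (t : ℂ) ^ q j * torsionCoeff γ ε j * x.1 j := by
  let _ := torsionAction q τ γ
  have h1 : WPSQuotient.mk q τ γ x = WPSQuotient.mk q τ γ y ↔
      ∃ ε : ∀ k, ZMod (τ k), WeightedProjectiveSpace.mk q (torsionActVec γ ε x) =
        WeightedProjectiveSpace.mk q y := by
    refine eq_comm.trans ?_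
    refine (Quotient.eq (r := AddAction.orbitRel (∀ k, ZMod (τ k)) (WeightedProjectiveSpace q))).trans ?_
    exact AddAction.orbitRel_apply
  rw [h1, exists_comm]
  refine exists_congr fun ε => ?_
  rw [WeightedProjectiveSpace.mk_eq_mk_iff]
  simp only [torsionActVec, mul_assoc]

theorem WPSQuotient.mk_surjective {m s : ℕ} {q : Fin m → ℕ} {τ : Fin s → ℕ+}
    {γ : Matrix (Fin s) (Fin m) ℤ} : Function.Surjective (WPSQuotient.mk q τ γ) := by
  let _ := torsionAction q τ γ
  rintro ⟨⟨x⟩⟩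
  exact ⟨x, rfl⟩

/-- Every lift is a lift of a point in the chart of the cone of its vanishing coordinates, which is
patched to the given point. -/
theorem IsLift.exists_patch {n : ℕ} {Λ : Fin (n + 1) → Fin n → ℤ} {q : Fin (n + 1) → ℝ}
    (hS : SimplexSystem (fun i => lat (Λ i)) q) (hn : 0 < n)
    {z : Fin (n + 1) → ℂ} (hz0 : z ≠ 0) : ∃ p₀ : (σ : simplexFan fun i => lat (Λ i)) × AffinePoints σ.1,
      IsLift Λ z p₀.2 ∧ ∀ p : (σ : simplexFan fun i => lat (Λ i)) × AffinePoints σ.1,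
        IsLift Λ z p.2 → Patch _ p₀ p := by
  have hJ : {j | z j = 0} ≠ Set.univ := fun hc => hz0 (funext fun j => by
    have : j ∈ {j | z j = 0} := hc ▸ Set.mem_univ j
    exact this)
  have hσ : cone ((fun i => lat (Λ i)) '' {j | z j = 0}) ∈ simplexFan fun i => lat (Λ i) :=
    ⟨_, hJ, rfl⟩
  obtain ⟨x, hx⟩ := exists_point hσ (z := z) fun j hj => subset_cone _ ⟨j, hj, rfl⟩
  refine ⟨⟨⟨_, hσ⟩, x⟩, hx, ?_⟩
  rintro ⟨⟨σ, I, hI, rfl⟩, y⟩ hy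
  refine ⟨(hS.isFace_cone_iff hI).2 ⟨_, fun j hj => hS.mem_of_mem_cone hn hI (hy.1 j hj), rfl⟩,
    fun u hu hu' => ?_⟩
  rw [hx.2, hy.2]

/-- Homogeneous coordinates identify the toric variety with the quotient. -/
theorem AdaptedBasis.exists_equiv {n s : ℕ} {Λ : Fin (n + 1) → Fin n → ℤ} {q : Fin (n + 1) → ℕ}
    {τ : Fin s → ℕ+} {γ : Matrix (Fin s) (Fin (n + 1)) ℤ}
    {U E : Matrix (Fin (n + 1)) (Fin (n + 1)) ℤ} (h : AdaptedBasis Λ q τ γ U E)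
    (hS : SimplexSystem (fun i => lat (Λ i)) (fun i => (q i : ℝ))) (hn : 0 < n) :
    ∃ e : WPSQuotient q τ γ ≃ ToricVariety (simplexFan fun i => lat (Λ i)),
      ∀ σ x (z : PuncturedSpace (n + 1)), IsLift Λ z.1 x →
        e (WPSQuotient.mk q τ γ z) = ToricVariety.chart σ x := by
  choose l hl using fun p : (σ : simplexFan fun i => lat (Λ i)) × AffinePoints σ.1 =>
    h.exists_isLift hS hn p.1.2 p.2
  let lz : (σ : simplexFan fun i => lat (Λ i)) × AffinePoints σ.1 → PuncturedSpace (n + 1) :=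
    fun p => ⟨l p, (hl p).ne_zero hS hn p.1.2⟩
  have hmk : ∀ p (z : PuncturedSpace (n + 1)), IsLift Λ z.1 p.2 →
      WPSQuotient.mk q τ γ (lz p) = WPSQuotient.mk q τ γ z := fun p z hz =>
    WPSQuotient.mk_eq_mk_iff.2 (h.exists_of_isLift hS hn p.1.2 (hl p) hz)
  let g : ToricVariety (simplexFan fun i => lat (Λ i)) → WPSQuotient q τ γ :=
    Quot.lift (fun p => WPSQuotient.mk q τ γ (lz p)) fun p p' hp =>
      (hmk p' (lz p) ((hl p).of_face hp)).symm
  have hg : Function.Bijective g := by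
    constructor
    · rintro ⟨p⟩ ⟨p'⟩ hpp
      obtain ⟨y, ε, hy⟩ := WPSQuotient.mk_eq_mk_iff.1 (show WPSQuotient.mk q τ γ (lz p) =
        WPSQuotient.mk q τ γ (lz p') from hpp)
      have h1 : IsLift Λ (lz p').1 p.2 := by
        rw [show (lz p').1 = _ from funext hy]
        exact h.isLift_smul (hl p) y ε
      obtain ⟨p₀, -, h3⟩ := IsLift.exists_patch hS hn (lz p').2
      exact (Quot.sound (h3 p h1)).symm.trans (Quot.sound (h3 p' (hl p')))
    · intro ξ
      obtain ⟨z, rfl⟩ := WPSQuotient.mk_surjective ξ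
      obtain ⟨p₀, h2, -⟩ := IsLift.exists_patch hS hn z.2
      exact ⟨Quot.mk _ p₀, hmk p₀ z h2⟩
  refine ⟨(Equiv.ofBijective g hg).symm, fun σ x z hz => ?_⟩
  rw [Equiv.symm_apply_eq]
  exact (hmk ⟨σ, x⟩ z hz).symm

/-! ### Open sets and regular functions -/

section OfAlgebra

variable {X : Type} {A : Subalgebra ℂ (X → ℂ)}

theorem isOpen_generateFrom_iff {W : Set X} :
    (TopologicalSpace.generateFrom {W | ∃ p ∈ A, W = {x | p x ≠ 0}}).IsOpen W ↔
      ∀ x ∈ W, ∃ p ∈ A, p x ≠ 0 ∧ ∀ y, p y ≠ 0 → y ∈ W := by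
  constructor
  · intro h
    change TopologicalSpace.GenerateOpen _ W at h
    induction h with
    | basic s hs =>
      obtain ⟨p, hp, rfl⟩ := hs
      exact fun x hx => ⟨p, hp, hx, fun y hy => hy⟩
    | univ => exact fun x _ => ⟨1, one_mem _, one_ne_zero, fun y _ => trivial⟩
    | inter s t _ _ hs ht =>
      rintro x ⟨hxs, hxt⟩
      obtain ⟨p, hp, hpx, hps⟩ := hs x hxs
      obtain ⟨p', hp', hpx', hps'⟩ := ht x hxt
      exact ⟨p * p', mul_mem hp hp', mul_ne_zero hpx hpx', fun y hy =>
        ⟨hps y (left_ne_zero_of_mul hy), hps' y (right_ne_zero_of_mul hy)⟩⟩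
    | sUnion S _ ih =>
      rintro x ⟨s, hs, hx⟩
      obtain ⟨p, hp, hpx, hps⟩ := ih s hs x hx
      exact ⟨p, hp, hpx, fun y hy => ⟨s, hs, hps y hy⟩⟩
  · intro h
    let _ := TopologicalSpace.generateFrom {W | ∃ p ∈ A, W = {x | p x ≠ 0}}
    refine isOpen_iff_forall_mem_open.2 fun x hx => ?_
    obtain ⟨p, hp, hpx, hps⟩ := h x hx
    exact ⟨{x | p x ≠ 0}, hps, TopologicalSpace.isOpen_generateFrom_of_mem ⟨p, hp, rfl⟩, hpx⟩

/-- A function is regular iff it is locally a quotient, on the locus where the denominator does not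
vanish. -/
theorem regular_ofAlgebra_iff {W : Set X} {f : X → ℂ} :
    (SpaceWithFunctions.ofAlgebra A).regular W f ↔
      ∀ x ∈ W, ∃ p ∈ A, ∃ r ∈ A, r x ≠ 0 ∧ ∀ y, r y ≠ 0 → y ∈ W ∧ f y = p y / r y := by
  constructor
  · intro h x hx
    obtain ⟨W', hW', hxW', hsub, p, hp, r, hr, hpr⟩ := h x hx
    obtain ⟨t, ht, htx, hts⟩ := isOpen_generateFrom_iff.1 hW' x hxW'
    refine ⟨p * t, mul_mem hp ht, r * t, mul_mem hr ht, mul_ne_zero (hpr x hxW').1 htx,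
      fun y hy => ?_⟩
    have hty := right_ne_zero_of_mul hy
    have hy' := hts y hty
    refine ⟨hsub hy', ?_⟩
    rw [(hpr y hy').2, Pi.mul_apply, Pi.mul_apply, mul_div_mul_right _ _ hty]
  · intro h x hx
    obtain ⟨p, hp, r, hr, hrx, hpr⟩ := h x hx
    exact ⟨{y | r y ≠ 0}, TopologicalSpace.isOpen_generateFrom_of_mem ⟨r, hr, rfl⟩, hrx,
      fun y hy => (hpr y hy).1, p, hp, r, hr, fun y hy => ⟨hy, (hpr y hy).2⟩⟩

end OfAlgebra

/-- The coordinate algebra of the punctured space consists of the polynomial functions. -/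
theorem mem_coordinateAlgebra_iff {m : ℕ} {p : PuncturedSpace m → ℂ} :
    p ∈ Algebra.adjoin ℂ (Set.range fun (j : Fin m) (x : PuncturedSpace m) => x.1 j) ↔
      ∃ Q : MvPolynomial (Fin m) ℂ, ∀ z, p z = MvPolynomial.eval z.1 Q := by
  rw [Algebra.adjoin_range_eq_range_aeval]
  have key : ∀ (Q : MvPolynomial (Fin m) ℂ) (z : PuncturedSpace m),
      MvPolynomial.aeval (fun (j : Fin m) (x : PuncturedSpace m) => x.1 j) Q z =
        MvPolynomial.eval z.1 Q := by
    intro Q z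
    induction Q using MvPolynomial.induction_on with
    | C a => simp
    | add p q hp hq => simp [hp, hq]
    | mul_X p j hp => simp [hp]
  constructor
  · rintro ⟨Q, rfl⟩
    exact ⟨Q, key Q⟩
  · rintro ⟨Q, hQ⟩
    exact ⟨Q, funext fun z => (key Q z).trans (hQ z).symm⟩

theorem isOpen_puncturedSpace_iff {m : ℕ} {V : Set (PuncturedSpace m)} :
    IsOpen V ↔ ∀ z ∈ V, ∃ Q : MvPolynomial (Fin m) ℂ, MvPolynomial.eval z.1 Q ≠ 0 ∧
      ∀ z' : PuncturedSpace m, MvPolynomial.eval z'.1 Q ≠ 0 → z' ∈ V := by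
  refine isOpen_generateFrom_iff.trans (forall₂_congr fun z _ => ?_)
  constructor
  · rintro ⟨p, hp, h1, h2⟩
    obtain ⟨Q, hQ⟩ := mem_coordinateAlgebra_iff.1 hp
    exact ⟨Q, by rwa [← hQ], fun z' hz' => h2 z' (by rwa [hQ])⟩
  · rintro ⟨Q, h1, h2⟩
    exact ⟨_, mem_coordinateAlgebra_iff.2 ⟨Q, fun _ => rfl⟩, h1, h2⟩

theorem regular_puncturedSpace_iff {m : ℕ} {V : Set (PuncturedSpace m)} {f : PuncturedSpace m → ℂ} :
    SpaceWithFunctions.regular V f ↔ ∀ z ∈ V, ∃ P Q : MvPolynomial (Fin m) ℂ,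
      MvPolynomial.eval z.1 Q ≠ 0 ∧ ∀ z' : PuncturedSpace m, MvPolynomial.eval z'.1 Q ≠ 0 →
        z' ∈ V ∧ f z' = MvPolynomial.eval z'.1 P / MvPolynomial.eval z'.1 Q := by
  refine regular_ofAlgebra_iff.trans (forall₂_congr fun z _ => ?_)
  constructor
  · rintro ⟨p, hp, r, hr, h1, h2⟩
    obtain ⟨P, hP⟩ := mem_coordinateAlgebra_iff.1 hp
    obtain ⟨Q, hQ⟩ := mem_coordinateAlgebra_iff.1 hr
    refine ⟨P, Q, by rwa [← hQ], fun z' hz' => ?_⟩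
    rw [← hP, ← hQ]
    exact h2 z' (by rwa [hQ])
  · rintro ⟨P, Q, h1, h2⟩
    exact ⟨_, mem_coordinateAlgebra_iff.2 ⟨P, fun _ => rfl⟩, _,
      mem_coordinateAlgebra_iff.2 ⟨Q, fun _ => rfl⟩, h1, h2⟩

/-- By the identity principle, a representation of a regular function as a quotient is valid
everywhere. -/
theorem regular_mul_eq {m : ℕ} {V : Set (PuncturedSpace (m + 1))} {f : PuncturedSpace (m + 1) → ℂ}
    (hf : SpaceWithFunctions.regular V f) {P Q : MvPolynomial (Fin (m + 1)) ℂ} (hQ0 : Q ≠ 0)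
    (hPQ : ∀ z : PuncturedSpace (m + 1), MvPolynomial.eval z.1 Q ≠ 0 →
      f z = MvPolynomial.eval z.1 P / MvPolynomial.eval z.1 Q)
    {z : PuncturedSpace (m + 1)} (hz : z ∈ V) :
    f z * MvPolynomial.eval z.1 Q = MvPolynomial.eval z.1 P := by
  obtain ⟨P₁, Q₁, h1, h2⟩ := regular_puncturedSpace_iff.1 hf z hz
  have hQ1 : Q₁ ≠ 0 := by
    rintro rfl
    exact h1 (map_zero _)
  have h3 : (P * Q₁ - P₁ * Q) * (Q * Q₁ * MvPolynomial.X 0) = 0 := by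
    refine MvPolynomial.funext fun y => ?_
    by_cases hy : MvPolynomial.eval y (Q * Q₁ * MvPolynomial.X 0) = 0
    · rw [map_mul, hy, mul_zero, map_zero]
    · rw [map_mul, map_mul, MvPolynomial.eval_X] at hy
      have hy0 := right_ne_zero_of_mul hy
      have hq := left_ne_zero_of_mul (left_ne_zero_of_mul hy)
      have hq1 := right_ne_zero_of_mul (left_ne_zero_of_mul hy)
      have e1 := hPQ ⟨y, fun hc => hy0 (congrFun hc 0)⟩ hq
      have e2 := (h2 ⟨y, fun hc => hy0 (congrFun hc 0)⟩ hq1).2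
      rw [e1, div_eq_div_iff hq hq1] at e2
      simp only at e2
      rw [map_mul, map_sub, map_mul, map_mul, e2, sub_self, zero_mul, map_zero]
  have h4 := sub_eq_zero.1 ((mul_eq_zero.1 h3).resolve_right
    (mul_ne_zero (mul_ne_zero hQ0 hQ1) (MvPolynomial.X_ne_zero 0)))
  have h5 := congrArg (MvPolynomial.eval z.1) h4
  rw [map_mul, map_mul] at h5
  rw [(h2 z h1).2]
  field_simp
  linear_combination -h5

/-- Functions on a chart are, in homogeneous coordinates, quotients of polynomials by monomials in
the coordinates that do not vanish on the chart. -/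
theorem exists_homogeneous_numerator {n : ℕ} {Λ : Fin (n + 1) → Fin n → ℤ} {σ : Set (Fin n → ℝ)}
    (hσ : σ ∈ simplexFan fun i => lat (Λ i)) {T : Finset (Fin (n + 1))}
    (hT : ∀ j, j ∈ T ↔ lat (Λ j) ∉ σ) {P : AffinePoints σ → ℂ}
    (hP : P ∈ Algebra.adjoin ℂ (Set.range (AffinePoints.eval (σ := σ)))) :
    ∃ (k : ℕ) (Q : MvPolynomial (Fin (n + 1)) ℂ), ∀ z x, IsLift Λ z x →
      P x * (∏ j ∈ T, z j) ^ k = MvPolynomial.eval z Q := by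
  classical
  have heval : ∀ z : Fin (n + 1) → ℂ, MvPolynomial.eval z (∏ j ∈ T, MvPolynomial.X j) = ∏ j ∈ T, z j :=
    fun z => by rw [map_prod]; simp
  induction hP using Algebra.adjoin_induction with
  | mem P hP =>
    obtain ⟨u, rfl⟩ := hP
    refine ⟨shiftBound Λ u.1, ∏ j, MvPolynomial.X j ^
      (dotProduct u.1 (Λ j) + if j ∈ T then (shiftBound Λ u.1 : ℤ) else 0).toNat,
      fun z x hz => ?_⟩
    rw [hz.2, map_prod, ← Finset.prod_pow, ← Finset.prod_filter_mul_prod_filter_not _ (· ∈ T),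
      ← Finset.prod_filter_mul_prod_filter_not Finset.univ (· ∈ T)
        (fun j => MvPolynomial.eval z (MvPolynomial.X j ^ _)), mul_right_comm]
    congr 1
    · rw [show Finset.univ.filter (· ∈ T) = T from by ext; simp, ← Finset.prod_mul_distrib]
      refine Finset.prod_congr rfl fun j hj => ?_
      have hzj : z j ≠ 0 := fun hc => (hT j).1 hj (hz.1 j hc)
      have h2 : (dotProduct u.1 (Λ j)).natAbs ≤ shiftBound Λ u.1 :=
        Finset.single_le_sum (f := fun j => (dotProduct u.1 (Λ j)).natAbs)
          (fun _ _ => Nat.zero_le _) (Finset.mem_univ j)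
      rw [if_pos hj, map_pow, MvPolynomial.eval_X, ← zpow_natCast (z j) (shiftBound Λ u.1),
        ← zpow_add₀ hzj, ← zpow_natCast, Int.toNat_of_nonneg (by omega)]
    · refine Finset.prod_congr rfl fun j hj => ?_
      have hj' := (Finset.mem_filter.1 hj).2
      have h3 := (mem_dualMonoid_iff hσ).1 u.2 j (not_not.1 fun hc => hj' ((hT j).2 hc))
      rw [if_neg hj', add_zero, map_pow, MvPolynomial.eval_X, ← zpow_natCast,
        Int.toNat_of_nonneg h3]
  | algebraMap r => exact ⟨0, MvPolynomial.C r, fun z x _ => by simp⟩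
  | add P P' _ _ h1 h2 =>
    obtain ⟨k, Q, hQ⟩ := h1
    obtain ⟨k', Q', hQ'⟩ := h2
    refine ⟨k + k', Q * (∏ j ∈ T, MvPolynomial.X j) ^ k' + Q' * (∏ j ∈ T, MvPolynomial.X j) ^ k,
      fun z x hz => ?_⟩
    rw [map_add, map_mul, map_mul, map_pow, map_pow, heval, ← hQ z x hz, ← hQ' z x hz,
      Pi.add_apply]
    ring
  | mul P P' _ _ h1 h2 =>
    obtain ⟨k, Q, hQ⟩ := h1
    obtain ⟨k', Q', hQ'⟩ := h2
    refine ⟨k + k', Q * Q', fun z x hz => ?_⟩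
    rw [map_mul, ← hQ z x hz, ← hQ' z x hz, Pi.mul_apply]
    ring

/-! ### Semi-invariant polynomials -/

/-- The group `ℂ^* × ⊕ ℤ/τ_k`, whose quotient of the punctured space is `P(q) / G`. -/
abbrev WeightGroup {s : ℕ} (τ : Fin s → ℕ+) : Type := ℂˣ × Multiplicative (∀ k, ZMod (τ k))

/-- The action of the group on the `j`-th coordinate. -/
def coordinateCharacter {m s : ℕ} (q : Fin m → ℕ) (τ : Fin s → ℕ+)
    (γ : Matrix (Fin s) (Fin m) ℤ) (j : Fin m) : WeightGroup τ →* ℂ where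
  toFun t := (t.1 : ℂ) ^ q j * torsionCoeff γ t.2.toAdd j
  map_one' := by simp [torsionCoeff_zero]
  map_mul' t t' := by
    rw [Prod.fst_mul, Prod.snd_mul, toAdd_mul, torsionCoeff_add, Units.val_mul, mul_pow]
    ring

/-- The action of the group on a monomial. -/
def monomialCharacter {m s : ℕ} (q : Fin m → ℕ) (τ : Fin s → ℕ+)
    (γ : Matrix (Fin s) (Fin m) ℤ) (d : Fin m →₀ ℕ) : WeightGroup τ →* ℂ :=
  ∏ j, coordinateCharacter q τ γ j ^ d j

open Classical in
/-- The part of a polynomial on which the group acts by a given character. -/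
def isotypicPart {m s : ℕ} (q : Fin m → ℕ) (τ : Fin s → ℕ+) (γ : Matrix (Fin s) (Fin m) ℤ)
    (Q : MvPolynomial (Fin m) ℂ) (χ : WeightGroup τ →* ℂ) : MvPolynomial (Fin m) ℂ :=
  ∑ d ∈ Q.support with monomialCharacter q τ γ d = χ, MvPolynomial.monomial d (Q.coeff d)

section Isotypic

variable {m s : ℕ} {q : Fin m → ℕ} {τ : Fin s → ℕ+} {γ : Matrix (Fin s) (Fin m) ℤ}

theorem monomialCharacter_apply (d : Fin m →₀ ℕ) (t : WeightGroup τ) :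
    monomialCharacter q τ γ d t = ∏ j, coordinateCharacter q τ γ j t ^ d j := by
  simp [monomialCharacter]

theorem eval_isotypicPart (Q : MvPolynomial (Fin m) ℂ) (χ : WeightGroup τ →* ℂ) (z : Fin m → ℂ)
    [DecidablePred fun d => monomialCharacter q τ γ d = χ] :
    MvPolynomial.eval z (isotypicPart q τ γ Q χ) =
      ∑ d ∈ Q.support with monomialCharacter q τ γ d = χ, Q.coeff d * ∏ j, z j ^ d j := by
  rw [isotypicPart, map_sum]
  refine Finset.sum_congr (by congr) fun d _ => ?_
  rw [MvPolynomial.eval_monomial, Finsupp.prod_fintype _ _ fun j => pow_zero _]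

theorem exists_finset_characters (P Q : MvPolynomial (Fin m) ℂ) :
    ∃ S : Finset (WeightGroup τ →* ℂ), (∀ d ∈ P.support, monomialCharacter q τ γ d ∈ S) ∧
      ∀ d ∈ Q.support, monomialCharacter q τ γ d ∈ S := by
  classical
  exact ⟨P.support.image (monomialCharacter q τ γ) ∪ Q.support.image (monomialCharacter q τ γ),
    fun d hd => Finset.mem_union_left _ (Finset.mem_image_of_mem _ hd),
    fun d hd => Finset.mem_union_right _ (Finset.mem_image_of_mem _ hd)⟩

theorem eval_smul_eq_sum {Q : MvPolynomial (Fin m) ℂ} {S : Finset (WeightGroup τ →* ℂ)}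
    (hS : ∀ d ∈ Q.support, monomialCharacter q τ γ d ∈ S) (t : WeightGroup τ) (z : Fin m → ℂ) :
    MvPolynomial.eval (fun j => coordinateCharacter q τ γ j t * z j) Q =
      ∑ χ ∈ S, MvPolynomial.eval z (isotypicPart q τ γ Q χ) * χ t := by
  classical
  rw [MvPolynomial.eval_eq', ← Finset.sum_fiberwise_of_maps_to hS]
  refine Finset.sum_congr rfl fun χ _ => ?_
  rw [eval_isotypicPart, Finset.sum_mul]
  refine Finset.sum_congr rfl fun d hd => ?_
  rw [← (Finset.mem_filter.1 hd).2, monomialCharacter_apply]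
  simp only [mul_pow, Finset.prod_mul_distrib]
  ring

/-- Distinct characters are linearly independent. -/
theorem eq_of_sum_characters_eq {S : Finset (WeightGroup τ →* ℂ)} {c c' : (WeightGroup τ →* ℂ) → ℂ}
    (h : ∀ t, ∑ χ ∈ S, c χ * χ t = ∑ χ ∈ S, c' χ * χ t) {χ : WeightGroup τ →* ℂ} (hχ : χ ∈ S) :
    c χ = c' χ := by
  have h1 := linearIndependent_iff'.1 (linearIndependent_monoidHom (WeightGroup τ) ℂ) S
    (fun χ => c χ - c' χ) (by
      funext t
      rw [Finset.sum_apply]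
      simp only [Pi.smul_apply, smul_eq_mul, sub_mul, Finset.sum_sub_distrib, h t]
      simp) χ hχ
  exact sub_eq_zero.1 h1

theorem isotypicPart_eq_zero {Q : MvPolynomial (Fin m) ℂ} {χ : WeightGroup τ →* ℂ}
    (h : ∀ d ∈ Q.support, monomialCharacter q τ γ d ≠ χ) : isotypicPart q τ γ Q χ = 0 := by
  classical
  rw [isotypicPart, Finset.sum_eq_zero]
  intro d hd
  exact absurd (Finset.mem_filter.1 hd).2 (h d (Finset.mem_filter.1 hd).1)

/-- Where an isotypic part does not vanish, neither does the polynomial, after moving the point by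
the group. -/
theorem exists_eval_smul_ne_zero {Q : MvPolynomial (Fin m) ℂ} {χ : WeightGroup τ →* ℂ}
    {z : Fin m → ℂ} (hz : MvPolynomial.eval z (isotypicPart q τ γ Q χ) ≠ 0) :
    ∃ t : WeightGroup τ,
      MvPolynomial.eval (fun j => coordinateCharacter q τ γ j t * z j) Q ≠ 0 := by
  obtain ⟨S, hS, -⟩ := exists_finset_characters (q := q) (τ := τ) (γ := γ) Q Q
  by_contra! hc
  have hχ : χ ∈ S := by
    by_contra hχ
    refine hz ?_
    rw [isotypicPart_eq_zero fun d hd h => hχ (by rw [← h]; exact hS d hd), map_zero]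
  refine hz (eq_of_sum_characters_eq (S := S)
    (c := fun χ => MvPolynomial.eval z (isotypicPart q τ γ Q χ)) (c' := fun _ => 0) (fun t => ?_) hχ)
  rw [← eval_smul_eq_sum hS, hc]
  simp

/-- A polynomial that does not vanish at a point has a nonzero isotypic part, containing a monomial
that does not vanish. -/
theorem exists_isotypicPart_ne_zero {Q : MvPolynomial (Fin m) ℂ} {z : Fin m → ℂ}
    (hz : MvPolynomial.eval z Q ≠ 0) : ∃ d : Fin m →₀ ℕ, ∏ j, z j ^ d j ≠ 0 ∧
      MvPolynomial.eval z (isotypicPart q τ γ Q (monomialCharacter q τ γ d)) ≠ 0 := by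
  classical
  obtain ⟨S, hS, -⟩ := exists_finset_characters (q := q) (τ := τ) (γ := γ) Q Q
  have h1 := eval_smul_eq_sum hS 1 z
  simp only [map_one, one_mul, mul_one] at h1
  rw [h1] at hz
  obtain ⟨χ, -, hχ⟩ := Finset.exists_ne_zero_of_sum_ne_zero hz
  have hχ' := hχ
  rw [eval_isotypicPart] at hχ'
  obtain ⟨d, hd, hd'⟩ := Finset.exists_ne_zero_of_sum_ne_zero hχ'
  refine ⟨d, right_ne_zero_of_mul hd', ?_⟩
  rwa [(Finset.mem_filter.1 hd).2]

/-- The exponents of monomials on which the group acts in the same way have the same weight, and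
agree modulo the torsion coefficients. -/
theorem congr_of_monomialCharacter_eq {d d' : Fin m →₀ ℕ}
    (hd : monomialCharacter q τ γ d = monomialCharacter q τ γ d') :
    ∑ j, (q j : ℤ) * ((d j : ℤ) - d' j) = 0 ∧
      ∀ k, ((τ k : ℕ) : ℤ) ∣ ∑ j, γ k j * ((d j : ℤ) - d' j) := by
  classical
  have happ : ∀ t : WeightGroup τ, ∏ j, coordinateCharacter q τ γ j t ^ d j =
      ∏ j, coordinateCharacter q τ γ j t ^ d' j := fun t => by
    rw [← monomialCharacter_apply, ← monomialCharacter_apply, hd]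
  simp only [coordinateCharacter, MonoidHom.coe_mk, OneHom.coe_mk] at happ
  constructor
  · have h1 := happ (Units.mk0 2 two_ne_zero, 1)
    simp only [Units.val_mk0, toAdd_one, torsionCoeff_zero, mul_one, ← pow_mul,
      Finset.prod_pow_eq_pow_sum] at h1
    have h2 : ∑ j, q j * d j = ∑ j, q j * d' j := by
      have h3 : (2 : ℕ) ^ (∑ j, q j * d j) = 2 ^ (∑ j, q j * d' j) := by exact_mod_cast h1
      exact Nat.pow_right_injective le_rfl h3
    simp only [mul_sub, Finset.sum_sub_distrib]
    rw [sub_eq_zero]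
    exact_mod_cast h2
  · intro k
    let ε : ∀ k, ZMod (τ k) := Pi.single k 1
    have h1 := happ (1, Multiplicative.ofAdd ε)
    have h2 : ∀ j, torsionCoeff γ ε j = ZMod.stdAddChar (γ k j : ZMod (τ k)) := by
      intro j
      rw [torsionCoeff, Finset.prod_eq_single k]
      · simp [ε]
      · intro l _ hl
        simp [ε, Pi.single_eq_of_ne hl]
      · simp
    simp only [Units.val_one, one_pow, one_mul, toAdd_ofAdd, h2] at h1
    have h3 : ∀ e : Fin m →₀ ℕ, ∏ j, (ZMod.stdAddChar (γ k j : ZMod (τ k)) : ℂ) ^ e j =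
        ZMod.stdAddChar ((∑ j, γ k j * (e j : ℤ) : ℤ) : ZMod (τ k)) := by
      intro e
      have h4 : ∀ f : Fin m → ZMod (τ k),
          ZMod.stdAddChar (∑ j, f j) = ∏ j, ZMod.stdAddChar (f j) := fun f =>
        map_prod (ZMod.stdAddChar (N := τ k)).toMonoidHom (fun j => Multiplicative.ofAdd (f j)) _
      rw [Int.cast_sum, h4]
      refine Finset.prod_congr rfl fun j _ => ?_
      rw [← AddChar.map_nsmul_eq_pow, nsmul_eq_mul]
      push_cast
      rw [mul_comm]
    rw [h3, h3] at h1
    have h4 := ZMod.injective_stdAddChar h1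
    rw [ZMod.intCast_eq_intCast_iff_dvd_sub] at h4
    have h5 := (dvd_neg.2 h4)
    rw [neg_sub, ← Finset.sum_sub_distrib] at h5
    simpa only [mul_sub] using h5

end Isotypic

namespace AdaptedBasis

variable {n s : ℕ} {Λ : Fin (n + 1) → Fin n → ℤ} {q : Fin (n + 1) → ℕ}
  {τ : Fin s → ℕ+} {γ : Matrix (Fin s) (Fin (n + 1)) ℤ}
  {U E : Matrix (Fin (n + 1)) (Fin (n + 1)) ℤ}

/-- Multiplied by suitable monomials, all the polynomials on which the group acts by a given
character descend to functions on a chart. -/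
theorem exists_descent (h : AdaptedBasis Λ q τ γ U E) (hq : ∀ i, 0 < q i) {σ : Set (Fin n → ℝ)}
    (hσ : σ ∈ simplexFan fun i => lat (Λ i)) {i : Fin (n + 1)} (hi : lat (Λ i) ∉ σ)
    (d₀ : Fin (n + 1) →₀ ℕ) : ∃ N k : ℕ, ∀ Q : MvPolynomial (Fin (n + 1)) ℂ,
      ∃ P ∈ Algebra.adjoin ℂ (Set.range (AffinePoints.eval (σ := σ))), ∀ z x, IsLift Λ z x →
        P x = MvPolynomial.eval z (isotypicPart q τ γ Q (monomialCharacter q τ γ d₀)) *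
          ((∏ j, z j ^ d₀ j) ^ N * (z i ^ k)⁻¹) := by
  classical
  -- `(N + 1) d₀ - k e_i` is a character of the torus
  set T : ℕ := ∏ k, (τ k : ℕ) with hT
  have hTpos : 0 < T := Finset.prod_pos fun k _ => (τ k).pos
  obtain ⟨N, hN⟩ : ∃ N, N + 1 = T * q i := ⟨T * q i - 1, by
    have := Nat.mul_pos hTpos (hq i); omega⟩
  set k : ℕ := T * ∑ j, q j * d₀ j with hk
  have hN' : (N : ℤ) = T * q i - 1 := by
    have : ((N + 1 : ℕ) : ℤ) = (T * q i : ℕ) := by rw [hN]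
    push_cast at this
    linarith
  have hdT : ∀ l, ((τ l : ℕ) : ℤ) ∣ T := fun l => by
    rw [hT]
    exact_mod_cast Finset.dvd_prod_of_mem (fun k => (τ k : ℕ)) (Finset.mem_univ l)
  have hu : ∀ d : Fin (n + 1) →₀ ℕ, ∃ u : Fin n → ℤ,
      monomialCharacter q τ γ d = monomialCharacter q τ γ d₀ → ∀ j,
        (d j : ℤ) + N * d₀ j - (if j = i then (k : ℤ) else 0) = dotProduct u (Λ j) := by
    intro d
    by_cases hd : monomialCharacter q τ γ d = monomialCharacter q τ γ d₀
    · obtain ⟨h1, h2⟩ := congr_of_monomialCharacter_eq hd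
      obtain ⟨u, hu⟩ := (h.mem_rowLattice_iff fun j =>
        (d j : ℤ) + N * d₀ j - (if j = i then (k : ℤ) else 0)).2 (by
          have e : ∀ c : Fin (n + 1) → ℤ,
              ∑ j, c j * ((d j : ℤ) + N * d₀ j - (if j = i then (k : ℤ) else 0)) =
                ∑ j, c j * ((d j : ℤ) - d₀ j) + T * q i * ∑ j, c j * d₀ j - c i * k := by
            intro c
            have e1 : c i * (k : ℤ) = ∑ j, c j * (if j = i then (k : ℤ) else 0) := by simp
            rw [e1, Finset.mul_sum, ← Finset.sum_add_distrib, ← Finset.sum_sub_distrib]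
            refine Finset.sum_congr rfl fun j _ => ?_
            rw [hN']; ring
          constructor
          · rw [e, h1, hk]; push_cast; ring
          · intro l
            rw [e]
            refine dvd_sub (dvd_add (h2 l) ?_) ?_
            · exact ((hdT l).mul_right _).mul_right _
            · rw [hk]; push_cast
              exact ((hdT l).mul_right _).mul_left _)
      exact ⟨u, fun _ => hu⟩
    · exact ⟨0, fun hc => absurd hc hd⟩
  choose u hu using hu
  have hmem : ∀ d, monomialCharacter q τ γ d = monomialCharacter q τ γ d₀ →
      u d ∈ dualMonoid σ := by
    intro d hd
    refine (mem_dualMonoid_iff hσ).2 fun j hj => ?_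
    rw [← hu d hd j, if_neg fun hc : j = i => hi (hc ▸ hj), sub_zero]
    positivity
  refine ⟨N, k, fun Q => ⟨∑ d ∈ Q.support.attach, if hd : monomialCharacter q τ γ d.1 =
    monomialCharacter q τ γ d₀ then Q.coeff d.1 • AffinePoints.eval ⟨u d.1, hmem d.1 hd⟩ else 0,
    Subalgebra.sum_mem _ fun d _ => ?_, fun z x hz => ?_⟩⟩
  · split_ifs
    · exact Subalgebra.smul_mem _ (Algebra.subset_adjoin (Set.mem_range_self _)) _
    · exact Subalgebra.zero_mem _
  · have hzi : z i ≠ 0 := fun hc => hi (hz.1 i hc)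
    rw [eval_isotypicPart, Finset.sum_mul, Finset.sum_filter, Finset.sum_apply,
      ← Finset.sum_attach Q.support]
    refine Finset.sum_congr rfl fun d _ => ?_
    split_ifs with hd
    · rw [Pi.smul_apply, hz.2, smul_eq_mul, mul_assoc]
      congr 1
      have e1 : (z i ^ k)⁻¹ = ∏ j, z j ^ (-(if j = i then (k : ℤ) else 0)) := by
        rw [Finset.prod_eq_single i]
        · rw [if_pos rfl, zpow_neg, zpow_natCast]
        · intro j _ hj
          rw [if_neg hj, neg_zero, zpow_zero]
        · simp
      rw [e1, ← Finset.prod_pow, ← Finset.prod_mul_distrib, ← Finset.prod_mul_distrib]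
      refine Finset.prod_congr rfl fun j _ => ?_
      simp only
      rw [← hu d.1 hd j, ← pow_mul, ← mul_assoc, ← pow_add]
      by_cases hj : j = i
      · rw [hj, if_pos rfl, sub_eq_add_neg, zpow_add₀ hzi, ← zpow_natCast]
        push_cast
        rw [mul_comm (N : ℤ)]
      · rw [if_neg hj, sub_zero, neg_zero, zpow_zero, mul_one, ← zpow_natCast]
        push_cast
        rw [mul_comm (N : ℤ)]
    · rfl

end AdaptedBasis

/-! ### The isomorphism with the quotient of the weighted projective space -/

theorem ToricVariety.regular_iff {n : ℕ} {F : Set (Set (Fin n → ℝ))} {W : Set (ToricVariety F)}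
    {f : ToricVariety F → ℂ} : SpaceWithFunctions.regular W f ↔
      ∀ σ : F, SpaceWithFunctions.regular (ToricVariety.chart σ ⁻¹' W) (f ∘ ToricVariety.chart σ) :=
  Iff.rfl

theorem WPSQuotient.isOpen_iff {m s : ℕ} {q : Fin m → ℕ} {τ : Fin s → ℕ+}
    {γ : Matrix (Fin s) (Fin m) ℤ} {W : Set (WPSQuotient q τ γ)} :
    IsOpen W ↔ IsOpen (WPSQuotient.mk q τ γ ⁻¹' W) := by
  have h1 : IsOpen W ↔ IsOpen (WPSQuotient.proj q τ γ ⁻¹' W) := by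
    refine isOpen_iSup_iff.trans ?_
    exact ⟨fun h => h (), fun h _ => h⟩
  refine h1.trans ?_
  refine isOpen_iSup_iff.trans ?_
  exact ⟨fun h => h (), fun h _ => h⟩

theorem WPSQuotient.regular_iff {m s : ℕ} {q : Fin m → ℕ} {τ : Fin s → ℕ+}
    {γ : Matrix (Fin s) (Fin m) ℤ} {W : Set (WPSQuotient q τ γ)} {f : WPSQuotient q τ γ → ℂ} :
    SpaceWithFunctions.regular W f ↔
      SpaceWithFunctions.regular (WPSQuotient.mk q τ γ ⁻¹' W) (f ∘ WPSQuotient.mk q τ γ) :=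
  ⟨fun h => h () (), fun h _ _ => h⟩

section Coordinates

variable {n s : ℕ} {Λ : Fin (n + 1) → Fin n → ℤ} {q : Fin (n + 1) → ℕ}
  {τ : Fin s → ℕ+} {γ : Matrix (Fin s) (Fin (n + 1)) ℤ}
  {U E : Matrix (Fin (n + 1)) (Fin (n + 1)) ℤ}

/-- A map from the punctured space to the toric variety is given by homogeneous coordinates. -/
def IsCoordinateMap (Λ : Fin (n + 1) → Fin n → ℤ)
    (π : PuncturedSpace (n + 1) → ToricVariety (simplexFan fun i => lat (Λ i))) : Prop :=
  ∀ σ x z, IsLift Λ z.1 x → π z = ToricVariety.chart σ x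

variable {π : PuncturedSpace (n + 1) → ToricVariety (simplexFan fun i => lat (Λ i))}

namespace IsCoordinateMap

theorem exists_chart (hπ : IsCoordinateMap Λ π) (z : PuncturedSpace (n + 1)) :
    ∃ σ x, IsLift Λ z.1 x ∧ π z = ToricVariety.chart σ x := by
  have hJ : {j | z.1 j = 0} ≠ Set.univ := fun hc => z.2 (funext fun j => by
    have : j ∈ {j | z.1 j = 0} := hc ▸ Set.mem_univ j
    exact this)
  have hσ : cone ((fun i => lat (Λ i)) '' {j | z.1 j = 0}) ∈ simplexFan fun i => lat (Λ i) :=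
    ⟨_, hJ, rfl⟩
  obtain ⟨x, hx⟩ := exists_point hσ (z := z.1) fun j hj => subset_cone _ ⟨j, hj, rfl⟩
  exact ⟨⟨_, hσ⟩, x, hx, hπ _ _ _ hx⟩

/-- Near a point of a chart, a function of the chart is a polynomial divided by a monomial that
vanishes only off the chart. -/
theorem exists_numerator (hπ : IsCoordinateMap Λ π) (z : PuncturedSpace (n + 1)) :
    ∃ (σ : simplexFan fun i => lat (Λ i)) (x₀ : AffinePoints σ.1)
      (g : MvPolynomial (Fin (n + 1)) ℂ), π z = ToricVariety.chart σ x₀ ∧ IsLift Λ z.1 x₀ ∧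
      MvPolynomial.eval z.1 g ≠ 0 ∧
      (∀ z' : PuncturedSpace (n + 1), MvPolynomial.eval z'.1 g ≠ 0 →
        ∃ x : AffinePoints σ.1, IsLift Λ z'.1 x) ∧
      ∀ P ∈ Algebra.adjoin ℂ (Set.range (AffinePoints.eval (σ := σ.1))),
        ∃ (k : ℕ) (Q : MvPolynomial (Fin (n + 1)) ℂ), ∀ z' x, IsLift Λ z' x →
          P x * MvPolynomial.eval z' g ^ k = MvPolynomial.eval z' Q := by
  classical
  obtain ⟨σ, x, hx, e⟩ := hπ.exists_chart z
  let T : Finset (Fin (n + 1)) := Finset.univ.filter fun j => lat (Λ j) ∉ σ.1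
  have hT : ∀ j, j ∈ T ↔ lat (Λ j) ∉ σ.1 := fun j => by simp [T]
  have heval : ∀ z : Fin (n + 1) → ℂ,
      MvPolynomial.eval z (∏ j ∈ T, MvPolynomial.X j) = ∏ j ∈ T, z j :=
    fun z => by rw [map_prod]; simp
  refine ⟨σ, x, ∏ j ∈ T, MvPolynomial.X j, e, hx, ?_, fun z' hz' => ?_, fun P hP => ?_⟩
  · rw [heval]
    exact Finset.prod_ne_zero_iff.2 fun j hj hc => (hT j).1 hj (hx.1 j hc)
  · rw [heval] at hz'
    refine exists_point σ.2 fun j hj => ?_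
    by_contra hc
    exact Finset.prod_ne_zero_iff.1 hz' j ((hT j).2 hc) hj
  · simp only [heval]
    exact exists_homogeneous_numerator σ.2 hT hP

theorem isOpen_preimage (hπ : IsCoordinateMap Λ π)
    {W : Set (ToricVariety (simplexFan fun i => lat (Λ i)))} (hW : IsOpen W) :
    IsOpen (π ⁻¹' W) := by
  refine isOpen_puncturedSpace_iff.2 fun z hz => ?_
  obtain ⟨σ, x₀, g, e, hx, hg0, hg, hnum⟩ := hπ.exists_numerator z
  obtain ⟨P, hP, h1, h2⟩ := isOpen_generateFrom_iff.1 (ToricVariety.isOpen_iff.1 hW σ) x₀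
    (show ToricVariety.chart σ x₀ ∈ W from e ▸ hz)
  obtain ⟨k, Q, hQ⟩ := hnum P hP
  refine ⟨Q * g, ?_, fun z' hz' => ?_⟩
  · rw [map_mul, ← hQ _ _ hx]
    exact mul_ne_zero (mul_ne_zero h1 (pow_ne_zero _ hg0)) hg0
  · rw [map_mul] at hz'
    obtain ⟨x', hx'⟩ := hg z' (right_ne_zero_of_mul hz')
    rw [← hQ _ _ hx'] at hz'
    change π z' ∈ W
    rw [hπ σ x' z' hx']
    exact h2 x' (left_ne_zero_of_mul (left_ne_zero_of_mul hz'))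

theorem regular_preimage (hπ : IsCoordinateMap Λ π)
    {W : Set (ToricVariety (simplexFan fun i => lat (Λ i)))}
    {f : ToricVariety (simplexFan fun i => lat (Λ i)) → ℂ}
    (hf : SpaceWithFunctions.regular W f) : SpaceWithFunctions.regular (π ⁻¹' W) (f ∘ π) := by
  refine regular_puncturedSpace_iff.2 fun z hz => ?_
  obtain ⟨σ, x₀, g, e, hx, hg0, hg, hnum⟩ := hπ.exists_numerator z
  obtain ⟨P, hP, R, hR, h1, h2⟩ := regular_ofAlgebra_iff.1 (ToricVariety.regular_iff.1 hf σ) x₀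
    (show ToricVariety.chart σ x₀ ∈ W from e ▸ hz)
  obtain ⟨k, Q, hQ⟩ := hnum P hP
  obtain ⟨l, S, hS⟩ := hnum R hR
  refine ⟨Q * g ^ (l + 1), S * g ^ (k + 1), ?_, fun z' hz' => ?_⟩
  · rw [map_mul, map_pow, ← hS _ _ hx]
    exact mul_ne_zero (mul_ne_zero h1 (pow_ne_zero _ hg0)) (pow_ne_zero _ hg0)
  · rw [map_mul, map_pow] at hz'
    have hg' : MvPolynomial.eval z'.1 g ≠ 0 := fun hc => right_ne_zero_of_mul hz' (by
      rw [hc, zero_pow (Nat.succ_ne_zero _)])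
    obtain ⟨x', hx'⟩ := hg z' hg'
    rw [← hS _ _ hx'] at hz'
    have h3 := h2 x' (left_ne_zero_of_mul (left_ne_zero_of_mul hz'))
    refine ⟨?_, ?_⟩
    · change π z' ∈ W
      rw [hπ σ x' z' hx']
      exact h3.1
    · rw [Function.comp_apply, hπ σ x' z' hx', map_mul, map_mul, map_pow, map_pow, ← hS _ _ hx',
        ← hQ _ _ hx']
      refine h3.2.trans ?_
      have := left_ne_zero_of_mul (left_ne_zero_of_mul hz')
      field_simp
      ring

/-- A polynomial that cuts out a neighbourhood upstairs has an isotypic part that does not vanish at the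
point; multiplied by a monomial it descends to the chart. -/
theorem isOpen_of_preimage (hπ : IsCoordinateMap Λ π) (h : AdaptedBasis Λ q τ γ U E)
    (hS : SimplexSystem (fun i => lat (Λ i)) (fun i => (q i : ℝ))) (hn : 0 < n)
    {W : Set (ToricVariety (simplexFan fun i => lat (Λ i)))} (hW : IsOpen (π ⁻¹' W)) :
    IsOpen W := by
  refine ToricVariety.isOpen_iff.2 fun σ => isOpen_generateFrom_iff.2 fun x hx => ?_
  have hq : ∀ i, 0 < q i := fun i => by exact_mod_cast hS.pos i
  obtain ⟨i, hi⟩ := hS.exists_notMem hn σ.2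
  obtain ⟨z, hz⟩ := h.exists_isLift hS hn σ.2 x
  have hzW : (⟨z, hz.ne_zero hS hn σ.2⟩ : PuncturedSpace (n + 1)) ∈ π ⁻¹' W :=
    (congrArg (· ∈ W) (hπ σ x ⟨z, hz.ne_zero hS hn σ.2⟩ hz)).mpr hx
  obtain ⟨Q, hQ0, hQ⟩ := isOpen_puncturedSpace_iff.1 hW _ hzW
  obtain ⟨d, hd, hdQ⟩ := exists_isotypicPart_ne_zero (q := q) (τ := τ) (γ := γ) hQ0
  obtain ⟨N, k, hNk⟩ := h.exists_descent hq σ.2 hi d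
  obtain ⟨P, hP, hPQ⟩ := hNk Q
  refine ⟨P, hP, ?_, fun y hy => ?_⟩
  · rw [hPQ z x hz]
    exact mul_ne_zero hdQ (mul_ne_zero (pow_ne_zero _ hd)
      (inv_ne_zero (pow_ne_zero _ fun hc => hi (hz.1 i hc))))
  · obtain ⟨z', hz'⟩ := h.exists_isLift hS hn σ.2 y
    rw [hPQ z' y hz'] at hy
    obtain ⟨t, ht⟩ := exists_eval_smul_ne_zero (left_ne_zero_of_mul hy)
    have hlift := h.isLift_smul hz' t.1 t.2.toAdd
    exact (congrArg (· ∈ W) (hπ σ y ⟨_, hlift.ne_zero hS hn σ.2⟩ hlift)).mp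
      (hQ ⟨_, hlift.ne_zero hS hn σ.2⟩ ht)

/-- Upstairs the function is locally `R / Q`. By the identity principle `f Q = R` holds on orbits, and
comparing characters gives `f Q_χ = R_χ` for the isotypic parts, which descend to the chart after
multiplication by a common monomial. -/
theorem regular_of_preimage (hπ : IsCoordinateMap Λ π) (h : AdaptedBasis Λ q τ γ U E)
    (hS : SimplexSystem (fun i => lat (Λ i)) (fun i => (q i : ℝ))) (hn : 0 < n)
    {W : Set (ToricVariety (simplexFan fun i => lat (Λ i)))}
    {f : ToricVariety (simplexFan fun i => lat (Λ i)) → ℂ}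
    (hf : SpaceWithFunctions.regular (π ⁻¹' W) (f ∘ π)) : SpaceWithFunctions.regular W f := by
  refine ToricVariety.regular_iff.2 fun σ => regular_ofAlgebra_iff.2 fun x hx => ?_
  have hq : ∀ i, 0 < q i := fun i => by exact_mod_cast hS.pos i
  obtain ⟨i, hi⟩ := hS.exists_notMem hn σ.2
  obtain ⟨z, hz⟩ := h.exists_isLift hS hn σ.2 x
  have hzW : (⟨z, hz.ne_zero hS hn σ.2⟩ : PuncturedSpace (n + 1)) ∈ π ⁻¹' W :=
    (congrArg (· ∈ W) (hπ σ x ⟨z, hz.ne_zero hS hn σ.2⟩ hz)).mpr hx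
  obtain ⟨R, Q, hQ0, hRQ⟩ := regular_puncturedSpace_iff.1 hf _ hzW
  obtain ⟨d, hd, hdQ⟩ := exists_isotypicPart_ne_zero (q := q) (τ := τ) (γ := γ) hQ0
  obtain ⟨N, k, hNk⟩ := h.exists_descent hq σ.2 hi d
  obtain ⟨P₁, hP1, hPR⟩ := hNk R
  obtain ⟨P₂, hP2, hPQ⟩ := hNk Q
  refine ⟨P₁, hP1, P₂, hP2, ?_, fun y hy => ?_⟩
  · rw [hPQ z x hz]
    exact mul_ne_zero hdQ (mul_ne_zero (pow_ne_zero _ hd)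
      (inv_ne_zero (pow_ne_zero _ fun hc => hi (hz.1 i hc))))
  · obtain ⟨z', hz'⟩ := h.exists_isLift hS hn σ.2 y
    have hy' := hy
    rw [hPQ z' y hz'] at hy'
    have hyQ := left_ne_zero_of_mul hy'
    have hyv := right_ne_zero_of_mul hy'
    obtain ⟨t, ht⟩ := exists_eval_smul_ne_zero hyQ
    have hlift := fun t : WeightGroup τ => h.isLift_smul hz' t.1 t.2.toAdd
    have hpt : ∀ t, π ⟨_, (hlift t).ne_zero hS hn σ.2⟩ = ToricVariety.chart σ y := fun t =>
      hπ σ y ⟨_, (hlift t).ne_zero hS hn σ.2⟩ (hlift t)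
    have hyW : ToricVariety.chart σ y ∈ W :=
      (congrArg (· ∈ W) (hpt t)).mp (hRQ ⟨_, (hlift t).ne_zero hS hn σ.2⟩ ht).1
    refine ⟨hyW, ?_⟩
    -- the relation `f Q = R` holds on the whole orbit, hence for the isotypic parts
    have hQne : Q ≠ 0 := by
      rintro rfl
      exact hQ0 (map_zero _)
    obtain ⟨S, hSR, hSQ⟩ := exists_finset_characters (q := q) (τ := τ) (γ := γ) R Q
    have horb : ∀ t : WeightGroup τ,
        ∑ χ ∈ S, (f (ToricVariety.chart σ y) *
          MvPolynomial.eval z' (isotypicPart q τ γ Q χ)) * χ t =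
        ∑ χ ∈ S, MvPolynomial.eval z' (isotypicPart q τ γ R χ) * χ t := by
      intro t
      have h1 := regular_mul_eq hf hQne (fun z hz => (hRQ z hz).2)
        (z := ⟨_, (hlift t).ne_zero hS hn σ.2⟩) ((congrArg (· ∈ W) (hpt t)).mpr hyW)
      rw [← eval_smul_eq_sum hSR]
      simp only [mul_assoc, ← Finset.mul_sum]
      rw [← eval_smul_eq_sum hSQ]
      exact (congrArg (fun ξ => f ξ * MvPolynomial.eval
        (fun j => coordinateCharacter q τ γ j t * z' j) Q) (hpt t)).symm.trans h1
    have hmem : monomialCharacter q τ γ d ∈ S := by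
      by_contra hc
      refine hyQ ?_
      rw [isotypicPart_eq_zero fun d' hd' e => hc (by rw [← e]; exact hSQ d' hd'), map_zero]
    have key := eq_of_sum_characters_eq
      (c := fun χ => f (ToricVariety.chart σ y) * MvPolynomial.eval z' (isotypicPart q τ γ Q χ))
      (c' := fun χ => MvPolynomial.eval z' (isotypicPart q τ γ R χ)) horb hmem
    rw [eq_div_iff hy, hPQ z' y hz', hPR z' y hz', ← mul_assoc, Function.comp_apply, key]

/-- The torus of the punctured space maps to the torus of the toric variety. -/
theorem apply_torusVec (hπ : IsCoordinateMap Λ π) :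
    ∃ φ : Torus (n + 1) →* Torus n, ∀ t, π (torusVec t) =
      ToricVariety.ofTorus (zero_mem_simplexFan _) (φ t) := by
  let φ : Torus (n + 1) →* Torus n :=
    { toFun := fun t k => ∏ j, t j ^ Λ j k
      map_one' := by ext; simp
      map_mul' := fun t t' => by
        funext k
        simp only [Pi.mul_apply, mul_zpow, Finset.prod_mul_distrib] }
  refine ⟨φ, fun t => hπ _ _ _ ⟨fun j hj => absurd hj (t j).ne_zero, fun u => ?_⟩⟩
  rw [AffinePoints.eval_torusAffine]
  have : ∏ k, (φ t) k ^ u.1 k = ∏ j, t j ^ dotProduct u.1 (Λ j) := by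
    simp only [φ, MonoidHom.coe_mk, OneHom.coe_mk, ← Finset.prod_zpow, ← zpow_mul, dotProduct]
    rw [Finset.prod_comm]
    refine Finset.prod_congr rfl fun j _ => ?_
    rw [prod_zpow_eq_zpow_sum]
    exact Finset.prod_congr rfl fun k _ => by rw [mul_comm]
  rw [this, Units.coe_prod]
  exact Finset.prod_congr rfl fun j _ => Units.val_zpow_eq_zpow_val _ _

end IsCoordinateMap

end Coordinates

/-! ### Coordinate hyperplanes and prime divisors -/

section Divisors

variable {n s : ℕ} {Λ : Fin (n + 1) → Fin n → ℤ} {q : Fin (n + 1) → ℕ}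
  {τ : Fin s → ℕ+} {γ : Matrix (Fin s) (Fin (n + 1)) ℤ}
  {U E : Matrix (Fin (n + 1)) (Fin (n + 1)) ℤ}
  {π : PuncturedSpace (n + 1) → ToricVariety (simplexFan fun i => lat (Λ i))}

/-- A polynomial that does not vanish at a point of a coordinate hyperplane does not vanish at some
point of the hyperplane whose other coordinates are nonzero. -/
theorem exists_generic_point {m : ℕ} {j : Fin m} {z : Fin m → ℂ} (hz : z j = 0)
    {Q : MvPolynomial (Fin m) ℂ} (hQ : MvPolynomial.eval z Q ≠ 0) :
    ∃ y : Fin m → ℂ, y j = 0 ∧ (∀ l, l ≠ j → y l ≠ 0) ∧ MvPolynomial.eval y Q ≠ 0 := by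
  classical
  let Q' := MvPolynomial.aeval (fun l => if l = j then (0 : MvPolynomial (Fin m) ℂ)
    else MvPolynomial.X l) Q
  have hQ' : ∀ y : Fin m → ℂ, MvPolynomial.eval y Q' =
      MvPolynomial.eval (fun l => if l = j then 0 else y l) Q := by
    intro y
    simp only [Q']
    clear hQ Q'
    induction Q using MvPolynomial.induction_on with
    | C a => simp
    | add p q hp hq => rw [map_add, map_add, map_add, hp, hq]
    | mul_X p l hp =>
      rw [map_mul, map_mul, map_mul, hp, MvPolynomial.aeval_X, MvPolynomial.eval_X]
      split_ifs <;> simp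
  have h0 : Q' ≠ 0 := by
    intro hc
    apply hQ
    have h1 := hQ' z
    rw [hc, map_zero] at h1
    rw [h1]
    congr 2
    funext l
    split_ifs with hl
    · rw [hl, hz]
    · rfl
  have h1 : Q' * ∏ l ∈ Finset.univ.erase j, MvPolynomial.X l ≠ 0 :=
    mul_ne_zero h0 (Finset.prod_ne_zero_iff.2 fun l _ => MvPolynomial.X_ne_zero l)
  obtain ⟨y, hy⟩ : ∃ y : Fin m → ℂ,
      MvPolynomial.eval y (Q' * ∏ l ∈ Finset.univ.erase j, MvPolynomial.X l) ≠ 0 := by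
    by_contra! hc
    exact h1 (MvPolynomial.funext fun y => by rw [hc, map_zero])
  rw [map_mul, map_prod, hQ'] at hy
  refine ⟨fun l => if l = j then 0 else y l, if_pos rfl, fun l hl => ?_, left_ne_zero_of_mul hy⟩
  have h2 := Finset.prod_ne_zero_iff.1 (right_ne_zero_of_mul hy) l
    (Finset.mem_erase.2 ⟨hl, Finset.mem_univ l⟩)
  rw [MvPolynomial.eval_X] at h2
  simpa [hl] using h2

namespace IsCoordinateMap

/-- The points of a coordinate hyperplane with no further vanishing coordinate map to the orbit of
the characteristic point of the ray. -/
theorem mem_orbit (hπ : IsCoordinateMap Λ π) {j : Fin (n + 1)}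
    (hj : Λ j ∈ rays (simplexFan fun i => lat (Λ i)))
    {z : PuncturedSpace (n + 1)} (hz : z.1 j = 0) (hz' : ∀ l, l ≠ j → z.1 l ≠ 0) :
    π z ∈ Set.range fun t : Torus n => ToricVariety.chart (F := simplexFan fun i => lat (Λ i))
      ⟨cone {lat (Λ j)}, hj.2⟩ (torusAct t (characteristicPoint _)) := by
  classical
  obtain ⟨φ, hφ⟩ : ∃ φ : Torus (n + 1) → Torus n, ∀ t (u : Fin n → ℤ),
      ∏ k, φ t k ^ u k = ∏ l, t l ^ dotProduct u (Λ l) := by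
    refine ⟨fun t k => ∏ l, t l ^ Λ l k, fun t u => ?_⟩
    simp only [← Finset.prod_zpow, ← zpow_mul, dotProduct]
    rw [Finset.prod_comm]
    refine Finset.prod_congr rfl fun l _ => ?_
    rw [prod_zpow_eq_zpow_sum]
    exact Finset.prod_congr rfl fun k _ => by rw [mul_comm]
  let t : Torus (n + 1) := fun l => if hl : l = j then 1 else Units.mk0 (z.1 l) (hz' l hl)
  refine ⟨φ t, (hπ ⟨_, hj.2⟩ _ z ⟨fun l hl => ?_, fun u => ?_⟩).symm⟩
  · have : l = j := by
      by_contra hc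
      exact hz' l hc hl
    rw [this]
    exact subset_cone _ rfl
  · rw [AffinePoints.eval_torusAct, hφ, AffinePoints.eval_characteristicPoint]
    have hiff : (∀ v ∈ cone {lat (Λ j)}, dotProduct (lat u.1) v = 0) ↔
        dotProduct u.1 (Λ j) = 0 := by
      constructor
      · intro h
        have := h _ (subset_cone _ rfl)
        rw [lat_dotProduct] at this
        exact_mod_cast this
      · intro h v hv
        obtain ⟨r, -, rfl⟩ := mem_cone_singleton.1 hv
        rw [dotProduct_smul, lat_dotProduct, h, Int.cast_zero, smul_zero]
    by_cases h : dotProduct u.1 (Λ j) = 0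
    · rw [if_pos (hiff.2 h), mul_one, Units.coe_prod]
      refine Finset.prod_congr rfl fun l _ => ?_
      rw [Units.val_zpow_eq_zpow_val]
      by_cases hl : l = j
      · rw [hl, h, zpow_zero, zpow_zero]
      · simp only [t, dif_neg hl, Units.val_mk0]
    · rw [if_neg fun hc => h (hiff.1 hc), mul_zero]
      refine (Finset.prod_eq_zero (Finset.mem_univ j) ?_).symm
      rw [hz, zero_zpow _ h]

/-- One inclusion moves a point of the hyperplane to a nearby point of the open orbit of the divisor; the
other holds since the image is closed and contains that orbit. -/
theorem image_hyperplane (hπ : IsCoordinateMap Λ π) (h : AdaptedBasis Λ q τ γ U E)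
    (hS : SimplexSystem (fun i => lat (Λ i)) (fun i => (q i : ℝ))) (hn : 0 < n)
    (hπi : ∀ z z', π z = π z' → ∃ (y : ℂˣ) (ε : ∀ k, ZMod (τ k)),
      ∀ j, z'.1 j = (y : ℂ) ^ q j * torsionCoeff γ ε j * z.1 j)
    {j : Fin (n + 1)} (hj : Λ j ∈ rays (simplexFan fun i => lat (Λ i))) :
    π '' {z | z.1 j = 0} = primeDivisor _ ⟨Λ j, hj⟩ := by
  refine Set.Subset.antisymm ?_ (closure_minimal ?_ ?_)
  · rintro _ ⟨z, hz, rfl⟩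
    refine mem_closure_iff.2 fun W hW hzW => ?_
    obtain ⟨Q, hQ0, hQ⟩ := isOpen_puncturedSpace_iff.1 (hπ.isOpen_preimage hW) z hzW
    obtain ⟨y, hyj, hyl, hyQ⟩ := exists_generic_point hz hQ0
    have hy0 : y ≠ 0 := by
      have : Nontrivial (Fin (n + 1)) := Fin.nontrivial_iff_two_le.2 (by omega)
      obtain ⟨l, hl⟩ := exists_ne j
      exact fun hc => hyl l hl (congrFun hc l)
    exact ⟨π ⟨y, hy0⟩, hQ ⟨y, hy0⟩ hyQ, hπ.mem_orbit hj (z := ⟨y, hy0⟩) hyj hyl⟩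
  · rintro _ ⟨t, rfl⟩
    obtain ⟨z, hz⟩ := h.exists_isLift hS hn hj.2
      (torusAct t (characteristicPoint (cone {lat (Λ j)})))
    refine ⟨⟨z, hz.ne_zero hS hn hj.2⟩, ?_, hπ ⟨_, hj.2⟩ _ ⟨z, hz.ne_zero hS hn hj.2⟩ hz⟩
    -- a character that is positive on the ray vanishes on the orbit
    obtain ⟨i, hi⟩ := hS.exists_notMem hn hj.2
    have hji : j ≠ i := fun hc => hi (hc ▸ subset_cone _ rfl)
    obtain ⟨D, v, hD, -, hv⟩ := h.exists_coordinate_characters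
      (fun i => by exact_mod_cast hS.pos i) i
    have hvj : dotProduct (v j) (Λ j) = D := by rw [hv j hji j hji, if_pos rfl]
    have hmem : v j ∈ dualMonoid (cone {lat (Λ j)}) := by
      intro x hx
      obtain ⟨r, hr, rfl⟩ := mem_cone_singleton.1 hx
      rw [dotProduct_smul, lat_dotProduct, hvj, smul_eq_mul]
      exact mul_nonneg hr (by exact_mod_cast hD.le)
    have h1 := hz.2 ⟨v j, hmem⟩
    rw [AffinePoints.eval_torusAct, AffinePoints.eval_characteristicPoint, if_neg, mul_zero] at h1
    · obtain ⟨l, -, hl⟩ := Finset.prod_eq_zero_iff.1 h1.symm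
      have hl0 := eq_zero_of_zpow_eq_zero hl
      by_cases hlj : l = j
      · exact hlj ▸ hl0
      · have hli : l ≠ i := fun hc => hi (hz.1 i (hc ▸ hl0))
        simp only [hv j hji l hli, if_neg hlj, zpow_zero] at hl
        exact absurd hl one_ne_zero
    · intro hc
      have := hc _ (subset_cone _ rfl)
      rw [lat_dotProduct, hvj] at this
      exact hD.ne' (by exact_mod_cast this)
  · rw [← isOpen_compl_iff]
    refine hπ.isOpen_of_preimage h hS hn (isOpen_puncturedSpace_iff.2 fun z hz => ?_)
    refine ⟨MvPolynomial.X j, ?_, fun z' hz' => ?_⟩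
    · rw [MvPolynomial.eval_X]
      exact fun hc => hz ⟨z, hc, rfl⟩
    · rintro ⟨z₁, hz1, e⟩
      rw [MvPolynomial.eval_X] at hz'
      obtain ⟨y, ε, hy⟩ := hπi z₁ z' e
      apply hz'
      rw [hy, show z₁.1 j = 0 from hz1, mul_zero]

end IsCoordinateMap

theorem AdaptedBasis.exists_isQuotientToricIso (h : AdaptedBasis Λ q τ γ U E)
    (hS : SimplexSystem (fun i => lat (Λ i)) (fun i => (q i : ℝ))) (hn : 0 < n)
    (hΛ : ∀ i, IsPrimitive (Λ i)) :
    ∃ e : WPSQuotient q τ γ ≃ ToricVariety (simplexFan fun i => lat (Λ i)),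
      IsQuotientToricIso Λ e := by
  obtain ⟨e, he⟩ := h.exists_equiv hS hn
  have hπ : IsCoordinateMap Λ (e ∘ WPSQuotient.mk q τ γ) := he
  refine ⟨e, ⟨fun W => ?_, fun W _ f => ?_⟩, ?_, fun j => ?_⟩
  · rw [WPSQuotient.isOpen_iff, ← Set.preimage_comp]
    exact ⟨hπ.isOpen_preimage, hπ.isOpen_of_preimage h hS hn⟩
  · rw [WPSQuotient.regular_iff, ← Set.preimage_comp]
    exact ⟨hπ.regular_preimage, hπ.regular_of_preimage h hS hn⟩
  · obtain ⟨φ, hφ⟩ := hπ.apply_torusVec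
    exact ⟨zero_mem_simplexFan _, φ, hφ⟩
  · have hj : Λ j ∈ rays (simplexFan fun i => lat (Λ i)) := by
      rw [SimplexSystem.rays_simplexFan hn hΛ]
      exact ⟨j, rfl⟩
    refine ⟨hj, ?_⟩
    rw [← Set.image_comp]
    exact hπ.image_hyperplane h hS hn
      (fun z z' hzz => WPSQuotient.mk_eq_mk_iff.1 (e.injective hzz)) hj

end Divisors

/-! ### Reduced weight vectors -/

theorem reducedWeights_eq_self {n : ℕ} {a : Fin (n + 1) → ℕ} (h : ∀ i, gcdOthers a i = 1) :
    reducedWeights a = a := by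
  funext i
  have h1 : (Finset.univ.erase i).lcm (gcdOthers a) = 1 :=
    Nat.dvd_one.1 (Finset.lcm_dvd fun j _ => (h j).dvd)
  rw [reducedWeights, h1, Nat.div_one]

theorem card_torsionGroup {n s : ℕ} {a : Fin (n + 1) → ℕ} (ha : ∀ i, 0 < a i)
    (hn : 0 < n) (hg : Finset.univ.gcd a = 1) {τ : Fin s → ℕ+}
    {γ : Matrix (Fin s) (Fin (n + 1)) ℤ} {U E : Matrix (Fin (n + 1)) (Fin (n + 1)) ℤ}
    (h : AdaptedBasis (dualRay a) (reducedWeights a) τ γ U E) :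
    Nat.card (∀ k, ZMod (τ k)) = (∑ i, a i) ^ (n - 1) := by
  rw [Nat.card_pi, ← h.prod_torsion ha hn hg]
  exact Finset.prod_congr rfl fun k _ => Nat.card_zmod _

end FDuality

end

theorem theorem3 (n : ℕ) (hn : 0 < n) (a : Fin (n + 1) → ℕ) (ha : ∀ i, 0 < a i) :
    (FDuality.projectiveFraming a).IsFramedToricVariety ∧
    (Monotone a → Finset.univ.gcd a = 1 →
      ((FDuality.projectiveFraming a).IsCalibrated ↔
        FDuality.ConditionA a ∧ FDuality.ConditionB a) ∧
      ((FDuality.projectiveFraming a).IsCalibrated →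
        (FDuality.projectiveFraming a).dual.IsFramedToricVariety ∧
        ∃ Λ : Fin (n + 1) → Fin n → ℤ,
          Function.Injective Λ ∧
          Set.range Λ = FDuality.rays (FDuality.projectiveFraming a).dual.fan ∧
          (∀ i j, j ≠ i → (FDuality.gcdOthers a i : ℤ) *
            dotProduct (FDuality.projRay j) (Λ i) = -(a j : ℤ)) ∧
          (∀ i, (((FDuality.projectiveFraming a).dual.coeff (Λ i) : ℤ) : ℚ) =
            (if i = Fin.last n then (FDuality.secondLast a : ℚ) else (a (Fin.last n) : ℚ)) /
              (FDuality.gcdOthers a i : ℚ)) ∧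
          (∃ (s : ℕ) (τ : Fin s → ℕ+) (γ : Matrix (Fin s) (Fin (n + 1)) ℤ),
            FDuality.IsTorsionMatrix (Matrix.of Λ).transpose (FDuality.reducedWeights a) τ γ) ∧
          (∀ (s : ℕ) (τ : Fin s → ℕ+) (γ : Matrix (Fin s) (Fin (n + 1)) ℤ),
            FDuality.IsTorsionMatrix (Matrix.of Λ).transpose (FDuality.reducedWeights a) τ γ →
              Nat.card (∀ k, ZMod (τ k)) = (∑ i, a i) ^ (n - 1) ∧
              ∃ e : FDuality.WPSQuotient (FDuality.reducedWeights a) τ γ ≃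
                  FDuality.ToricVariety (FDuality.projectiveFraming a).dual.fan,
                FDuality.IsQuotientToricIso Λ e) ∧
          ((∀ i, FDuality.gcdOthers a i = 1) →
            FDuality.reducedWeights a = a ∧
            ∀ i, (FDuality.projectiveFraming a).dual.coeff (Λ i) =
              if i = Fin.last n then (FDuality.secondLast a : ℤ) else (a (Fin.last n) : ℤ)))) := by
  refine ⟨FDuality.isFramedToricVariety_projectiveFraming hn ha, fun hm hg =>
    ⟨FDuality.isCalibrated_iff hn ha hm, fun _ =>
      ⟨FDuality.isFramedToricVariety_dual hn ha hm, FDuality.dualRay a,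
        FDuality.dualRay_injective hn ha, (FDuality.rays_dual_projectiveFraming hn ha).symm,
        fun i j hji => ?_, fun i => ?_, FDuality.exists_isTorsionMatrix_dualRay hn ha hg,
        fun s τ γ hγ => ?_, fun hd => ⟨FDuality.reducedWeights_eq_self hd, fun i => ?_⟩⟩⟩⟩
  · rw [FDuality.gcdOthers_mul_dot_dualRay, if_neg (Ne.symm hji), zero_sub]
  · have h1 := FDuality.gcdOthers_mul_coeff_dual hn ha hm i
    have h2 : (FDuality.gcdOthers a i : ℚ) ≠ 0 := by
      exact_mod_cast (FDuality.gcdOthers_pos hn ha i).ne'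
    rw [eq_div_iff h2, mul_comm]
    have h3 := congrArg (Int.cast : ℤ → ℚ) h1
    push_cast at h3
    rw [h3, FDuality.maxOthers]
    split_ifs <;> rfl
  · obtain ⟨U, E, h⟩ := hγ.exists_adaptedBasis
    refine ⟨FDuality.card_torsionGroup ha hn hg h, ?_⟩
    rw [FDuality.fan_dual_projectiveFraming hn ha]
    exact h.exists_isQuotientToricIso (FDuality.simplexSystem_dualRay hn ha hg) hn
      (FDuality.isPrimitive_dualRay hn ha)
  · have h1 := FDuality.gcdOthers_mul_coeff_dual hn ha hm i
    rw [hd, Nat.cast_one, one_mul] at h1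
    rw [h1, FDuality.maxOthers]
    split_ifs <;> rfl
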